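/- Let $p$ be a prime and let $\mathcal R$ be the Robba ring of $\mathbb Q_p$, i.e. the ring of Laurent series $f(T)=\sum_{n\in\mathbb Z}a_nT^n$ with $a_n\in\mathbb Q_p$ that converge on some annulus $r<|T|<1$ ($r<1$ depending on $f$). Put $\varphi(f)(T)=f((1+T)^p-1)$, let $\Gamma=\mathbb Z_p^\times$ act by $\gamma_u(f)(T)=f((1+T)^u-1)$ for $u\in\mathbb Z_p^\times$, and let $t=\log(1+T)\in\mathcal R$. A generalized $(\varphi,\Gamma)$-module is a finitely presented $\mathcal R$-module $D$ with commuting semilinear actions of $\varphi$ and of the group $\Gamma$ such that the linearization $\varphi^*D=\mathcal R\otimes_{\varphi,\mathcal R}D\to D$, $f\otimes x\mapsto f\varphi(x)$, is an isomorphism. A torsion $(\varphi,\Gamma)$-module is a generalized $(\varphi,\Gamma)$-module that is $\mathcal R$-torsion; it is pure $t$-torsion if it is killed by $t$ and free as an $\mathcal R/t\mathcal R$-module. (1) If $I\neq 0$ is a principal ideal of $\mathcal R$ with $\varphi(I)\subseteq I$ and $\gamma_u(I)\subseteq I$ for all $u\in\mathbb Z_p^\times$, then $I=(t^k)$ for some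 integer $k\ge 0$. (2) Every torsion $(\varphi,\Gamma)$-module $S$ over $\mathcal R$ is a successive extension of pure $t$-torsion $(\varphi,\Gamma)$-modules: there is a finite filtration $0=F_0\subseteq F_1\subseteq\dots\subseteq F_n=S$ by $\mathcal R$-submodules stable under $\varphi$ and $\Gamma$, each of which is a torsion $(\varphi,\Gamma)$-module, such that every quotient $F_{i+1}/F_i$ with its induced actions is a pure $t$-torsion $(\varphi,\Gamma)$-module. -/

import Mathlib

open Filter Topology

noncomputable section

namespace Robba

variable (p : ℕ) [Fact p.Prime]

/-! ### The boundary of the open unit disc of `ℂ_p` -/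

/-- The filter of (outer) annuli `{x ∈ ℂ_p : r < ‖x‖ < 1}`, `r → 1⁻`. -/
def bdry : Filter ℂ_[p] := comap (fun x : ℂ_[p] => ‖x‖) (𝓝[<] (1 : ℝ))

/-- `f` is given, on some annulus `r < ‖x‖ < 1`, by the convergent Laurent series
`∑ aₙ xⁿ` with coefficients `aₙ ∈ ℚ_p`. -/
def HasLaurentExpansion (a : ℤ → ℚ_[p]) (f : ℂ_[p] → ℂ_[p]) : Prop :=
  ∀ᶠ x in bdry p, HasSum (fun n : ℤ => a n • x ^ n) (f x)

variable {p}

theorem eventually_bdry_iff {P : ℂ_[p] → Prop} :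
    (∀ᶠ x in bdry p, P x) ↔ ∃ r < (1 : ℝ), ∀ x : ℂ_[p], r < ‖x‖ → ‖x‖ < 1 → P x := by
  have h : (bdry p).HasBasis (fun r : ℝ => r < 1)
      (fun r => (fun x : ℂ_[p] => ‖x‖) ⁻¹' Set.Ioo r 1) :=
    (nhdsLT_basis (1 : ℝ)).comap _
  rw [h.eventually_iff]
  simp only [Set.mem_preimage, Set.mem_Ioo, and_imp]

theorem eventually_gt_bdry {r : ℝ} (hr : r < 1) : ∀ᶠ x : ℂ_[p] in bdry p, r < ‖x‖ :=
  eventually_bdry_iff.2 ⟨r, hr, fun _ h _ => h⟩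

theorem eventually_lt_one_bdry : ∀ᶠ x : ℂ_[p] in bdry p, ‖x‖ < 1 :=
  eventually_bdry_iff.2 ⟨0, one_pos, fun _ _ h => h⟩

theorem eventually_ne_zero_bdry : ∀ᶠ x : ℂ_[p] in bdry p, x ≠ 0 :=
  (eventually_gt_bdry one_pos).mono fun _ h => norm_pos_iff.1 h

theorem summable_of_norm {ι E : Type*} [NormedAddCommGroup E] [IsUltrametricDist E]
    [CompleteSpace E] {f : ι → E} (h : Tendsto (fun i => ‖f i‖) cofinite (𝓝 0)) : Summable f :=
  NonarchimedeanAddGroup.summable_of_tendsto_cofinite_zero (tendsto_zero_iff_norm_tendsto_zero.2 h)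

theorem nonarchimedeanRing : NonarchimedeanRing ℂ_[p] where
  is_nonarchimedean := NonarchimedeanAddGroup.is_nonarchimedean

/-- Collecting the terms of a convergent multi-indexed family of monomials by degree. -/
theorem hasSum_regroup {ι : Type*} (c : ι → ℚ_[p]) (d : ι → ℤ) {x S : ℂ_[p]} (hx : x ≠ 0)
    (h : HasSum (fun i => c i • x ^ d i) S) :
    HasSum (fun n : ℤ => (∑' i : {i // d i = n}, c i) • x ^ n) S := by
  have h' : HasSum ((fun i => c i • x ^ d i) ∘ Equiv.sigmaFiberEquiv d) S :=
    (Equiv.hasSum_iff _).2 h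
  refine h'.sigma fun n => ?_
  have h0 : Tendsto (fun i => ‖c i • x ^ d i‖) cofinite (𝓝 0) :=
    tendsto_zero_iff_norm_tendsto_zero.1 h.summable.tendsto_cofinite_zero
  have h1 : Tendsto (fun i : {i // d i = n} => ‖c i • x ^ d i‖) cofinite (𝓝 0) :=
    h0.comp Subtype.val_injective.tendsto_cofinite
  have hn : ‖x ^ n‖ ≠ 0 := norm_ne_zero_iff.2 (zpow_ne_zero _ hx)
  have h2 : Tendsto (fun i : {i // d i = n} => ‖c i‖) cofinite (𝓝 0) := by
    have := h1.mul_const (‖x ^ n‖⁻¹)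
    rw [zero_mul] at this
    refine this.congr fun i => ?_
    rw [norm_smul, i.2, mul_assoc, mul_inv_cancel₀ hn, mul_one]
  have h3 := (summable_of_norm h2).hasSum.smul_const (x ^ n)
  refine h3.congr_fun ?_
  intro i
  simp [Equiv.sigmaFiberEquiv, i.2]

theorem HasLaurentExpansion.add {a b : ℤ → ℚ_[p]} {f g : ℂ_[p] → ℂ_[p]}
    (hf : HasLaurentExpansion p a f) (hg : HasLaurentExpansion p b g) :
    HasLaurentExpansion p (fun n => a n + b n) (fun x => f x + g x) := by
  filter_upwards [hf, hg] with x h1 h2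
  simpa only [add_smul] using h1.add h2

theorem HasLaurentExpansion.neg {a : ℤ → ℚ_[p]} {f : ℂ_[p] → ℂ_[p]}
    (hf : HasLaurentExpansion p a f) :
    HasLaurentExpansion p (fun n => - a n) (fun x => - f x) := by
  filter_upwards [hf] with x h1
  simpa only [neg_smul] using h1.neg

theorem hasLaurentExpansion_const (c : ℚ_[p]) :
    HasLaurentExpansion p (fun n => if n = 0 then c else 0) (fun _ => c • (1 : ℂ_[p])) := by
  refine Eventually.of_forall fun x => ?_
  convert hasSum_ite_eq (0 : ℤ) (c • (1 : ℂ_[p])) using 2 with n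
  split_ifs with h <;> simp [h]

theorem HasLaurentExpansion.mul {a b : ℤ → ℚ_[p]} {f g : ℂ_[p] → ℂ_[p]}
    (hf : HasLaurentExpansion p a f) (hg : HasLaurentExpansion p b g) :
    HasLaurentExpansion p
      (fun n => ∑' i : {i : ℤ × ℤ // i.1 + i.2 = n}, a i.1.1 * b i.1.2)
      (fun x => f x * g x) := by
  filter_upwards [hf, hg, eventually_ne_zero_bdry] with x h1 h2 hx
  refine hasSum_regroup (fun i : ℤ × ℤ => a i.1 * b i.2) (fun i => i.1 + i.2) hx ?_
  have := nonarchimedeanRing (p := p)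
  convert h1.mul_of_nonarchimedean h2 using 2 with i
  rw [zpow_add₀ hx, smul_mul_smul_comm]

/-! ### Power series with geometrically bounded coefficients -/

/-- Power series `∑ gₘ Yᵐ` over `ℚ_p` with `‖gₘ‖ ≤ θᵐ`. -/
def IsBdd (θ : ℝ) (G : PowerSeries ℚ_[p]) : Prop := ∀ m, ‖PowerSeries.coeff m G‖ ≤ θ ^ m

theorem IsBdd.mul {θ : ℝ} (hθ : 0 ≤ θ) {G H : PowerSeries ℚ_[p]} (hG : IsBdd θ G)
    (hH : IsBdd θ H) : IsBdd θ (G * H) := by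
  intro m
  rw [PowerSeries.coeff_mul]
  refine IsUltrametricDist.norm_sum_le_of_forall_le_of_nonneg (by positivity) fun i hi => ?_
  rw [norm_mul, ← Finset.HasAntidiagonal.mem_antidiagonal.1 hi, pow_add]
  exact mul_le_mul (hG _) (hH _) (norm_nonneg _) (by positivity)

theorem isBdd_one {θ : ℝ} (hθ : 0 ≤ θ) : IsBdd θ (1 : PowerSeries ℚ_[p]) := by
  intro m
  rw [PowerSeries.coeff_one]
  split_ifs with h
  · simp [h]
  · simpa using pow_nonneg hθ m

theorem IsBdd.pow {θ : ℝ} (hθ : 0 ≤ θ) {G : PowerSeries ℚ_[p]} (hG : IsBdd θ G) (n : ℕ) :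
    IsBdd θ (G ^ n) := by
  induction n with
  | zero => simpa using isBdd_one hθ
  | succ n ih => rw [pow_succ]; exact ih.mul hθ hG

theorem IsBdd.inv {θ : ℝ} (hθ : 0 ≤ θ) {G : PowerSeries ℚ_[p]} (hG : IsBdd θ G)
    (h0 : ‖PowerSeries.constantCoeff G‖ = 1) : IsBdd θ G⁻¹ := by
  intro m
  induction m using Nat.strong_induction_on with
  | _ m ih =>
    rw [PowerSeries.coeff_inv]
    split_ifs with hm
    · simp [hm, h0]
    · rw [norm_mul, norm_neg, norm_inv, h0, inv_one, one_mul]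
      refine IsUltrametricDist.norm_sum_le_of_forall_le_of_nonneg (by positivity) fun i hi => ?_
      split_ifs with hlt
      · rw [norm_mul, ← Finset.HasAntidiagonal.mem_antidiagonal.1 hi, pow_add]
        exact mul_le_mul (hG _) (ih _ hlt) (norm_nonneg _) (by positivity)
      · simpa using pow_nonneg hθ m

theorem IsBdd.norm_term_le {θ : ℝ} {G : PowerSeries ℚ_[p]} (hG : IsBdd θ G) (y : ℂ_[p]) (m : ℕ) :
    ‖PowerSeries.coeff m G • y ^ m‖ ≤ (θ * ‖y‖) ^ m := by
  rw [norm_smul, norm_pow, mul_pow]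
  exact mul_le_mul_of_nonneg_right (hG m) (by positivity)

theorem IsBdd.summable {θ : ℝ} (hθ : 0 ≤ θ) {G : PowerSeries ℚ_[p]} (hG : IsBdd θ G) {y : ℂ_[p]}
    (hy : θ * ‖y‖ < 1) : Summable fun m : ℕ => PowerSeries.coeff m G • y ^ m :=
  Summable.of_norm_bounded (summable_geometric_of_lt_one (by positivity) hy) (hG.norm_term_le y)

/-- The value at `y` of a power series. -/
def evalPS (G : PowerSeries ℚ_[p]) (y : ℂ_[p]) : ℂ_[p] :=
  ∑' m : ℕ, PowerSeries.coeff m G • y ^ m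

theorem IsBdd.norm_eval_le {θ : ℝ} (hθ : 0 ≤ θ) {G : PowerSeries ℚ_[p]} (hG : IsBdd θ G)
    {y : ℂ_[p]} (hy : θ * ‖y‖ < 1) : ‖evalPS G y‖ ≤ 1 := by
  refine IsUltrametricDist.norm_tsum_le_of_forall_le_of_nonneg zero_le_one fun m => ?_
  exact (hG.norm_term_le y m).trans (pow_le_one₀ (by positivity) hy.le)

theorem evalPS_one (y : ℂ_[p]) : evalPS 1 y = 1 := by
  rw [evalPS, tsum_eq_single 0]
  · simp
  · intro m hm
    simp [PowerSeries.coeff_one, hm]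

theorem coeff_mul_smul_pow {F K : Type*} [Field F] [Field K] [Algebra F K] (G H : PowerSeries F)
    (y : K) (m : ℕ) : PowerSeries.coeff m (G * H) • y ^ m =
      ∑ i ∈ Finset.HasAntidiagonal.antidiagonal m,
        (PowerSeries.coeff i.1 G • y ^ i.1) * (PowerSeries.coeff i.2 H • y ^ i.2) := by
  rw [PowerSeries.coeff_mul, Finset.sum_smul]
  refine Finset.sum_congr rfl fun i hi => ?_
  rw [← Finset.HasAntidiagonal.mem_antidiagonal.1 hi, pow_add, smul_mul_smul_comm]

theorem tsum_coeff_mul {F K : Type*} [Field F] [NormedField K] [NonarchimedeanRing K]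
    [CompleteSpace K] [Algebra F K] (G H : PowerSeries F) (y : K)
    (h1 : Summable fun m : ℕ => PowerSeries.coeff m G • y ^ m)
    (h2 : Summable fun m : ℕ => PowerSeries.coeff m H • y ^ m) :
    ∑' m : ℕ, PowerSeries.coeff m (G * H) • y ^ m =
      (∑' m : ℕ, PowerSeries.coeff m G • y ^ m) * ∑' m : ℕ, PowerSeries.coeff m H • y ^ m := by
  have h3 : Summable fun i : ℕ × ℕ =>
      (PowerSeries.coeff i.1 G • y ^ i.1) * (PowerSeries.coeff i.2 H • y ^ i.2) :=
    Summable.mul_of_nonarchimedean (f := fun m : ℕ => PowerSeries.coeff m G • y ^ m)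
      (g := fun m : ℕ => PowerSeries.coeff m H • y ^ m) h1 h2
  rw [Summable.tsum_mul_tsum_eq_tsum_sum_antidiagonal h1 h2 h3]
  exact tsum_congr fun m => coeff_mul_smul_pow G H y m

theorem evalPS_mul {θ : ℝ} (hθ : 0 ≤ θ) {G H : PowerSeries ℚ_[p]} (hG : IsBdd θ G)
    (hH : IsBdd θ H) {y : ℂ_[p]} (hy : θ * ‖y‖ < 1) :
    evalPS (G * H) y = evalPS G y * evalPS H y :=
  have := nonarchimedeanRing (p := p)
  tsum_coeff_mul G H y (hG.summable hθ hy) (hH.summable hθ hy)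

theorem evalPS_pow {θ : ℝ} (hθ : 0 ≤ θ) {G : PowerSeries ℚ_[p]} (hG : IsBdd θ G) {y : ℂ_[p]}
    (hy : θ * ‖y‖ < 1) (n : ℕ) : evalPS (G ^ n) y = evalPS G y ^ n := by
  induction n with
  | zero => simpa using evalPS_one y
  | succ n ih => rw [pow_succ, evalPS_mul hθ (hG.pow hθ n) hG hy, ih, pow_succ]

/-- The `n`-th power, `n ∈ ℤ`, of a power series. -/
def psZPow (G : PowerSeries ℚ_[p]) : ℤ → PowerSeries ℚ_[p]
  | Int.ofNat n => G ^ n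
  | Int.negSucc n => G⁻¹ ^ (n + 1)

theorem evalPS_inv {θ : ℝ} (hθ : 0 ≤ θ) {G : PowerSeries ℚ_[p]} (hG : IsBdd θ G)
    (h0 : ‖PowerSeries.constantCoeff G‖ = 1) {y : ℂ_[p]} (hy : θ * ‖y‖ < 1) :
    evalPS G y * evalPS G⁻¹ y = 1 := by
  rw [← evalPS_mul hθ hG (hG.inv hθ h0) hy, PowerSeries.mul_inv_cancel, evalPS_one]
  rw [← norm_ne_zero_iff, h0]
  exact one_ne_zero

theorem norm_evalPS {θ : ℝ} (hθ : 0 ≤ θ) {G : PowerSeries ℚ_[p]} (hG : IsBdd θ G)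
    (h0 : ‖PowerSeries.constantCoeff G‖ = 1) {y : ℂ_[p]} (hy : θ * ‖y‖ < 1) :
    ‖evalPS G y‖ = 1 := by
  have h1 := hG.norm_eval_le hθ hy
  have h2 := (hG.inv hθ h0).norm_eval_le hθ hy
  have h3 := congrArg norm (evalPS_inv hθ hG h0 hy)
  rw [norm_mul, norm_one] at h3
  nlinarith [norm_nonneg (evalPS G y), norm_nonneg (evalPS G⁻¹ y)]

theorem IsBdd.zpow {θ : ℝ} (hθ : 0 ≤ θ) {G : PowerSeries ℚ_[p]} (hG : IsBdd θ G)
    (h0 : ‖PowerSeries.constantCoeff G‖ = 1) (n : ℤ) : IsBdd θ (psZPow G n) := by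
  cases n with
  | ofNat n => exact hG.pow hθ n
  | negSucc n => exact (hG.inv hθ h0).pow hθ (n + 1)

theorem evalPS_zpow {θ : ℝ} (hθ : 0 ≤ θ) {G : PowerSeries ℚ_[p]} (hG : IsBdd θ G)
    (h0 : ‖PowerSeries.constantCoeff G‖ = 1) {y : ℂ_[p]} (hy : θ * ‖y‖ < 1) (n : ℤ) :
    evalPS (psZPow G n) y = evalPS G y ^ n := by
  cases n with
  | ofNat n =>
    rw [Int.ofNat_eq_natCast, zpow_natCast]
    exact evalPS_pow hθ hG hy n
  | negSucc n =>
    rw [zpow_negSucc, psZPow, evalPS_pow hθ (hG.inv hθ h0) hy, ← inv_pow,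
      eq_inv_of_mul_eq_one_right (evalPS_inv hθ hG h0 hy)]

/-! ### Substitutions -/

variable (p) in
/-- A sufficient condition for `f ↦ f ∘ w` to preserve the functions that have a Laurent
expansion near the boundary: `w x = x ^ k * G (x ^ e)` there. -/
structure IsSubst (w : ℂ_[p] → ℂ_[p]) (k : ℕ) (e : ℤ) (θ : ℝ) (G : PowerSeries ℚ_[p]) : Prop where
  k_ne_zero : k ≠ 0
  nonneg : 0 ≤ θ
  isBdd : IsBdd θ G
  norm_coeff_zero : ‖PowerSeries.constantCoeff G‖ = 1
  lt_one : ∀ᶠ x : ℂ_[p] in bdry p, θ * ‖x ^ e‖ < 1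
  eq : ∀ᶠ x : ℂ_[p] in bdry p, w x = x ^ k * evalPS G (x ^ e)

theorem IsSubst.norm_eq {w : ℂ_[p] → ℂ_[p]} {k : ℕ} {e : ℤ} {θ : ℝ} {G : PowerSeries ℚ_[p]}
    (hw : IsSubst p w k e θ G) : ∀ᶠ x : ℂ_[p] in bdry p, ‖w x‖ = ‖x‖ ^ k := by
  filter_upwards [hw.lt_one, hw.eq] with x h1 h2
  rw [h2, norm_mul, norm_evalPS hw.nonneg hw.isBdd hw.norm_coeff_zero h1, norm_pow, mul_one]

theorem IsSubst.tendsto {w : ℂ_[p] → ℂ_[p]} {k : ℕ} {e : ℤ} {θ : ℝ} {G : PowerSeries ℚ_[p]}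
    (hw : IsSubst p w k e θ G) : Tendsto w (bdry p) (bdry p) := by
  refine tendsto_comap_iff.2 (tendsto_nhdsWithin_iff.2 ⟨?_, ?_⟩)
  · have h1 : Tendsto (fun x : ℂ_[p] => ‖x‖) (bdry p) (𝓝 1) :=
      tendsto_comap.mono_right nhdsWithin_le_nhds
    have h2 := h1.pow k
    rw [one_pow] at h2
    refine h2.congr' ?_
    filter_upwards [hw.norm_eq] with x hx
    exact hx.symm
  · filter_upwards [hw.norm_eq, eventually_lt_one_bdry] with x hx h1
    simp only [Function.comp_apply, Set.mem_Iio, hx]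
    exact pow_lt_one₀ (norm_nonneg _) h1 hw.k_ne_zero

theorem HasLaurentExpansion.comp {a : ℤ → ℚ_[p]} {f w : ℂ_[p] → ℂ_[p]} {k : ℕ} {e : ℤ} {θ : ℝ}
    {G : PowerSeries ℚ_[p]} (hf : HasLaurentExpansion p a f) (hw : IsSubst p w k e θ G) :
    HasLaurentExpansion p
      (fun l => ∑' i : {i : ℤ × ℕ // k * i.1 + e * i.2 = l},
        a i.1.1 * PowerSeries.coeff i.1.2 (psZPow G i.1.1))
      (fun x => f (w x)) := by
  filter_upwards [hw.tendsto.eventually hf, hw.norm_eq, hw.lt_one, hw.eq,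
    eventually_ne_zero_bdry] with x h1 h2 h3 h4 hx
  refine hasSum_regroup
    (fun i : ℤ × ℕ => a i.1 * PowerSeries.coeff i.2 (psZPow G i.1))
    (fun i => k * i.1 + e * i.2) hx ?_
  have hbd := fun n => hw.isBdd.zpow hw.nonneg hw.norm_coeff_zero n
  have hterm : ∀ i : ℤ × ℕ,
      (a i.1 * PowerSeries.coeff i.2 (psZPow G i.1)) • x ^ (k * i.1 + e * i.2 : ℤ)
        = (a i.1 • x ^ (k * i.1 : ℤ)) *
          (PowerSeries.coeff i.2 (psZPow G i.1) • (x ^ e) ^ i.2) := by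
    intro i
    rw [zpow_add₀ hx, smul_mul_smul_comm, zpow_mul x e, zpow_natCast]
  have hfib : ∀ n : ℤ, HasSum (fun m : ℕ =>
      (a n * PowerSeries.coeff m (psZPow G n)) • x ^ (k * n + e * m : ℤ)) (a n • w x ^ n) := by
    intro n
    have h5 := (((hbd n).summable hw.nonneg h3).hasSum).mul_left (a n • x ^ (k * n : ℤ))
    rw [show (∑' m : ℕ, PowerSeries.coeff m (psZPow G n) • (x ^ e) ^ m) = evalPS G (x ^ e) ^ n from
      evalPS_zpow hw.nonneg hw.isBdd hw.norm_coeff_zero h3 n, smul_mul_assoc, zpow_mul,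
      zpow_natCast, ← mul_zpow, ← h4] at h5
    refine h5.congr_fun fun m => ?_
    rw [hterm (n, m), zpow_mul x (k : ℤ), zpow_natCast]
  have hsum : Summable fun i : ℤ × ℕ =>
      (a i.1 * PowerSeries.coeff i.2 (psZPow G i.1)) • x ^ (k * i.1 + e * i.2 : ℤ) := by
    have hA : Tendsto (fun n : ℤ => ‖a n • w x ^ n‖) cofinite (𝓝 0) :=
      tendsto_zero_iff_norm_tendsto_zero.1 h1.summable.tendsto_cofinite_zero
    have hB : Tendsto (fun m : ℕ => (θ * ‖x ^ e‖) ^ m) cofinite (𝓝 0) := by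
      rw [Nat.cofinite_eq_atTop]
      exact tendsto_pow_atTop_nhds_zero_of_lt_one (mul_nonneg hw.nonneg (norm_nonneg _)) h3
    refine summable_of_norm (squeeze_zero (fun _ => norm_nonneg _) (fun i => ?_)
      (tendsto_mul_cofinite_nhds_zero hA hB))
    have h6 : ‖a i.1 • x ^ (k * i.1 : ℤ)‖ = ‖a i.1 • w x ^ i.1‖ := by
      rw [norm_smul, norm_smul, zpow_mul, zpow_natCast, norm_zpow, norm_zpow, norm_pow, h2]
    rw [hterm, norm_mul, h6]
    exact mul_le_mul_of_nonneg_left ((hbd i.1).norm_term_le (x ^ e) i.2)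
      (norm_nonneg (a i.1 • w x ^ i.1))
  have hS := hsum.hasSum
  rwa [(hS.prod_fiberwise hfib).unique h1] at hS

/-! ### The Robba ring of `ℚ_p` -/

variable (p)

/-- The Robba ring of `ℚ_p`: germs, near the boundary of the open unit disc, of functions given by
a Laurent series `∑_{n ∈ ℤ} aₙ Tⁿ`, `aₙ ∈ ℚ_p`, that converges on some annulus `r < ‖T‖ < 1`. -/
def robbaSubring : Subring ((bdry p).Germ ℂ_[p]) where
  carrier := {g | ∃ (f : ℂ_[p] → ℂ_[p]) (a : ℤ → ℚ_[p]),
    (f : (bdry p).Germ ℂ_[p]) = g ∧ HasLaurentExpansion p a f}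
  mul_mem' := by
    rintro _ _ ⟨f, a, rfl, hf⟩ ⟨g, b, rfl, hg⟩
    exact ⟨_, _, rfl, hf.mul hg⟩
  one_mem' := ⟨_, _, rfl, by simpa using hasLaurentExpansion_const (p := p) 1⟩
  add_mem' := by
    rintro _ _ ⟨f, a, rfl, hf⟩ ⟨g, b, rfl, hg⟩
    exact ⟨_, _, rfl, hf.add hg⟩
  zero_mem' := ⟨_, _, rfl, by simpa using hasLaurentExpansion_const (p := p) 0⟩
  neg_mem' := by
    rintro _ ⟨f, a, rfl, hf⟩
    exact ⟨_, _, rfl, hf.neg⟩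

/-- The Robba ring of `ℚ_p`. -/
abbrev RobbaRing : Type := robbaSubring p

variable {p} in
/-- Composition of germs with `w`. -/
def germComp (w : ℂ_[p] → ℂ_[p]) (hw : Tendsto w (bdry p) (bdry p)) :
    (bdry p).Germ ℂ_[p] →+* (bdry p).Germ ℂ_[p] where
  toFun g := g.compTendsto w hw
  map_one' := rfl
  map_zero' := rfl
  map_mul' a b := by
    induction a using Germ.inductionOn with | _ a
    induction b using Germ.inductionOn with | _ b
    rfl
  map_add' a b := by
    induction a using Germ.inductionOn with | _ a
    induction b using Germ.inductionOn with | _ b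
    rfl

variable {p} in
/-- The endomorphism `f ↦ f ∘ w` of the Robba ring. -/
def substHom (w : ℂ_[p] → ℂ_[p]) {k : ℕ} {e : ℤ} {θ : ℝ} {G : PowerSeries ℚ_[p]}
    (hw : IsSubst p w k e θ G) : RobbaRing p →+* RobbaRing p :=
  (germComp w hw.tendsto).restrict (robbaSubring p) (robbaSubring p) (by
    rintro _ ⟨f, a, rfl, hf⟩
    exact ⟨_, _, rfl, hf.comp hw⟩)

/-! ### The Frobenius `φ(T) = (1 + T) ^ p - 1` -/

/-- `x ↦ (1 + x) ^ p - 1`. -/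
def frobFun (x : ℂ_[p]) : ℂ_[p] := (1 + x) ^ p - 1

/-- The polynomial `((1 + T) ^ p - 1) / T ^ p` in `T⁻¹`. -/
def frobPS : PowerSeries ℚ_[p] := PowerSeries.mk fun m => if m < p then (p.choose m : ℚ_[p]) else 0

theorem frobFun_isSubst :
    IsSubst p (frobFun p) p (-1) ((p : ℝ)⁻¹ ^ (p : ℝ)⁻¹) (frobPS p) := by
  have hp : p.Prime := Fact.out
  have hp1 : (1 : ℝ) < p := by exact_mod_cast hp.one_lt
  have hθ0 : (0 : ℝ) ≤ (p : ℝ)⁻¹ ^ (p : ℝ)⁻¹ := by positivity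
  have hθ1 : (p : ℝ)⁻¹ ^ (p : ℝ)⁻¹ < 1 :=
    Real.rpow_lt_one (by positivity) (inv_lt_one_of_one_lt₀ hp1) (by positivity)
  have hθp : ((p : ℝ)⁻¹ ^ (p : ℝ)⁻¹) ^ p = (p : ℝ)⁻¹ :=
    Real.rpow_inv_natCast_pow (by positivity) hp.ne_zero
  refine ⟨hp.ne_zero, hθ0, ?_, ?_, ?_, ?_⟩
  · intro m
    rw [frobPS, PowerSeries.coeff_mk]
    split_ifs with h
    · rcases Nat.eq_zero_or_pos m with rfl | hm
      · simp
      · obtain ⟨c, hc⟩ := hp.dvd_choose_self hm.ne' h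
        rw [hc, Nat.cast_mul, norm_mul, Padic.norm_p]
        calc (p : ℝ)⁻¹ * ‖(c : ℚ_[p])‖ ≤ (p : ℝ)⁻¹ * 1 :=
              mul_le_mul_of_nonneg_left (by simpa using Padic.norm_int_le_one (p := p) c) (by positivity)
          _ = ((p : ℝ)⁻¹ ^ (p : ℝ)⁻¹) ^ p := by rw [hθp, mul_one]
          _ ≤ _ := pow_le_pow_of_le_one hθ0 hθ1.le h.le
    · simpa using pow_nonneg hθ0 m
  · rw [← PowerSeries.coeff_zero_eq_constantCoeff_apply, frobPS, PowerSeries.coeff_mk,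
      if_pos hp.pos]
    simp
  · filter_upwards [eventually_gt_bdry hθ1] with x hx
    have hx0 : 0 < ‖x‖ := hθ0.trans_lt hx
    rwa [zpow_neg_one, norm_inv, ← div_eq_mul_inv, div_lt_one hx0]
  · filter_upwards [eventually_ne_zero_bdry] with x hx
    rw [evalPS, tsum_eq_sum (s := Finset.range p), Finset.mul_sum, frobFun, add_pow,
      Finset.sum_range_succ]
    · simp only [one_pow, one_mul, tsub_self, pow_zero, Nat.choose_self, Nat.cast_one,
        add_sub_cancel_right]
      refine Finset.sum_congr rfl fun m hm => ?_
      have hm' : m < p := Finset.mem_range.1 hm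
      rw [frobPS, PowerSeries.coeff_mk, if_pos hm', zpow_neg_one, Nat.cast_smul_eq_nsmul,
        nsmul_eq_mul, pow_sub₀ x hx hm'.le, inv_pow]
      ring
    · intro m hm
      rw [frobPS, PowerSeries.coeff_mk, if_neg (by simpa using hm), zero_smul]

/-- The Frobenius endomorphism `φ` of the Robba ring, `φ(f)(T) = f((1 + T) ^ p - 1)`. -/
def frob : RobbaRing p →+* RobbaRing p := substHom (frobFun p) (frobFun_isSubst p)

/-! ### The action of `Γ = ℤ_pˣ`, `γ(T) = (1 + T) ^ χ(γ) - 1` -/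

variable {p} in
/-- `x ↦ (1 + x) ^ u - 1 = ∑_{n ≥ 1} (u choose n) xⁿ` for `u ∈ ℤ_p` and `‖x‖ < 1`. -/
def gammaFun (u : ℤ_[p]) (x : ℂ_[p]) : ℂ_[p] :=
  ∑' n : ℕ, ((Ring.choose u (n + 1) : ℤ_[p]) : ℚ_[p]) • x ^ (n + 1)

variable {p} in
/-- The power series `((1 + T) ^ u - 1) / T`. -/
def gammaPS (u : ℤ_[p]) : PowerSeries ℚ_[p] :=
  PowerSeries.mk fun m => ((Ring.choose u (m + 1) : ℤ_[p]) : ℚ_[p])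

variable {p} in
theorem gammaFun_isSubst (u : ℤ_[p]ˣ) : IsSubst p (gammaFun (u : ℤ_[p])) 1 1 1 (gammaPS u) := by
  refine ⟨one_ne_zero, zero_le_one, ?_, ?_, ?_, ?_⟩
  · intro m
    rw [gammaPS, PowerSeries.coeff_mk, one_pow]
    exact PadicInt.norm_le_one _
  · rw [← PowerSeries.coeff_zero_eq_constantCoeff_apply, gammaPS, PowerSeries.coeff_mk, zero_add,
      Ring.choose_one_right]
    exact PadicInt.norm_units u
  · filter_upwards [eventually_lt_one_bdry] with x hx
    simpa using hx
  · refine Eventually.of_forall fun x => ?_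
    rw [gammaFun, evalPS, pow_one, zpow_one, ← tsum_mul_left]
    refine tsum_congr fun n => ?_
    rw [gammaPS, PowerSeries.coeff_mk, mul_smul_comm, pow_succ']

variable {p} in
/-- The action of `u ∈ Γ = ℤ_pˣ` on the Robba ring, `f(T) ↦ f((1 + T) ^ u - 1)`.
(The cyclotomic character identifies `Γ` with `ℤ_pˣ`.) -/
def gammaHom (u : ℤ_[p]ˣ) : RobbaRing p →+* RobbaRing p :=
  substHom (gammaFun (u : ℤ_[p])) (gammaFun_isSubst u)

/-! ### The element `t = log (1 + T)` -/

/-- The coefficients of `log (1 + T) = ∑_{n ≥ 1} (-1) ^ (n - 1) Tⁿ / n`. -/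
def logCoeff (n : ℤ) : ℚ_[p] := if 0 < n then (-1) ^ (n - 1) / (n : ℚ_[p]) else 0

/-- The function `x ↦ log (1 + x)` on the open unit disc. -/
def logFun (x : ℂ_[p]) : ℂ_[p] := ∑' n : ℤ, logCoeff p n • x ^ n

theorem hasLaurentExpansion_log : HasLaurentExpansion p (logCoeff p) (logFun p) := by
  filter_upwards [eventually_lt_one_bdry] with x hx
  refine Summable.hasSum ?_
  have hinj : Function.Injective (fun n : ℕ => (n : ℤ)) := Nat.cast_injective
  rw [← hinj.summable_iff]
  · refine summable_of_norm ?_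
    rw [Nat.cofinite_eq_atTop]
    refine squeeze_zero (fun _ => norm_nonneg _) (fun n => ?_)
      (tendsto_self_mul_const_pow_of_lt_one (norm_nonneg x) hx)
    simp only [Function.comp_apply]
    rw [norm_smul, zpow_natCast, norm_pow]
    refine mul_le_mul_of_nonneg_right ?_ (by positivity)
    rw [logCoeff]
    split_ifs with hn
    · rw [norm_div, norm_zpow, norm_neg, norm_one, one_zpow, Int.cast_natCast]
      have hn' : n ≠ 0 := by rintro rfl; simp at hn
      have hp0 : (0 : ℝ) < p := by exact_mod_cast (Fact.out : p.Prime).pos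
      rw [Padic.norm_eq_zpow_neg_valuation (by exact_mod_cast hn'), Padic.valuation_natCast,
        zpow_neg, one_div, inv_inv, zpow_natCast]
      exact_mod_cast Nat.le_of_dvd (Nat.pos_of_ne_zero hn') pow_padicValNat_dvd
    · simp
  · intro n hn
    have : ¬ 0 < n := fun h => hn ⟨n.toNat, by simpa using h.le⟩
    rw [logCoeff, if_neg this, zero_smul]

/-- The element `t = log (1 + T)` of the Robba ring. -/
def tElt : RobbaRing p := ⟨(logFun p : (bdry p).Germ ℂ_[p]), _, _, rfl, hasLaurentExpansion_log p⟩

/-! ### `(φ, Γ)`-modules -/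

/-- The Robba ring regarded as an algebra over itself through `φ`. -/
def FrobTwist : Type := RobbaRing p

instance : CommRing (FrobTwist p) := inferInstanceAs (CommRing (RobbaRing p))

instance : Algebra (RobbaRing p) (FrobTwist p) := (frob p).toAlgebra

/-- Commuting semilinear actions of `φ` and `Γ` on a module over the Robba ring. -/
structure PhiGammaAction (D : Type*) [AddCommGroup D] [Module (RobbaRing p) D] where
  /-- the action of `φ` -/
  phi : D →ₛₗ[frob p] D
  /-- the action of `Γ` -/
  gamma : (u : ℤ_[p]ˣ) → D →ₛₗ[gammaHom u] D
  gamma_one : ∀ x, gamma 1 x = x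
  gamma_mul : ∀ u v x, gamma (u * v) x = gamma u (gamma v x)
  phi_gamma : ∀ u x, phi (gamma u x) = gamma u (phi x)

namespace PhiGammaAction

variable {p} {D : Type*} [AddCommGroup D] [Module (RobbaRing p) D] (A : PhiGammaAction p D)

open scoped TensorProduct in
/-- The linearization `φ^*D → D`, `f ⊗ x ↦ f • φ(x)`, where `φ^*D` is the base change of `D`
along `φ`. -/
def linearization : FrobTwist p ⊗[RobbaRing p] D →+ D :=
  TensorProduct.liftAddHom
    (AddMonoidHom.mk' (fun f : FrobTwist p =>
        (AddMonoidHom.mk' (fun x : D => (show RobbaRing p from f) • A.phi x)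
          (fun x y => by rw [map_add, smul_add])))
      (fun f g => by
        ext x
        exact add_smul (show RobbaRing p from f) (show RobbaRing p from g) (A.phi x)))
    (fun r f x => by
      change (frob p r * (show RobbaRing p from f)) • A.phi x
        = (show RobbaRing p from f) • A.phi (r • x)
      rw [LinearMap.map_smulₛₗ, smul_smul, mul_comm])

/-- A submodule stable under `φ` and `Γ`. -/
structure IsStable (N : Submodule (RobbaRing p) D) : Prop where
  phi_mem : ∀ x ∈ N, A.phi x ∈ N
  gamma_mem : ∀ u, ∀ x ∈ N, A.gamma u x ∈ N

/-- The induced actions on a stable submodule. -/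
def sub (N : Submodule (RobbaRing p) D) (hN : A.IsStable N) : PhiGammaAction p N where
  phi := (A.phi.comp N.subtype).codRestrict N (fun x => hN.phi_mem x x.2)
  gamma u := ((A.gamma u).comp N.subtype).codRestrict N (fun x => hN.gamma_mem u x x.2)
  gamma_one x := Subtype.ext (A.gamma_one x)
  gamma_mul u v x := Subtype.ext (A.gamma_mul u v x)
  phi_gamma u x := Subtype.ext (A.phi_gamma u x)

/-- The induced actions on the quotient by a stable submodule. -/
def quot (N : Submodule (RobbaRing p) D) (hN : A.IsStable N) : PhiGammaAction p (D ⧸ N) where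
  phi := N.mapQ N A.phi hN.phi_mem
  gamma u := N.mapQ N (A.gamma u) (hN.gamma_mem u)
  gamma_one x := by
    induction x using Submodule.Quotient.induction_on with | _ x
    simp [A.gamma_one]
  gamma_mul u v x := by
    induction x using Submodule.Quotient.induction_on with | _ x
    simp [A.gamma_mul]
  phi_gamma u x := by
    induction x using Submodule.Quotient.induction_on with | _ x
    simp [A.phi_gamma]

theorem IsStable.submoduleOf {A : PhiGammaAction p D} {M N : Submodule (RobbaRing p) D}
    (hM : A.IsStable M) (hN : A.IsStable N) : (A.sub N hN).IsStable (M.submoduleOf N) :=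
  ⟨fun x hx => hM.phi_mem x hx, fun u x hx => hM.gamma_mem u x hx⟩

/-- Generalized `(φ, Γ)`-modules: finitely presented modules over the Robba ring with commuting
actions of `φ` and `Γ` such that `φ^*D → D` is an isomorphism. -/
structure IsGeneralized : Prop where
  finitePresentation : Module.FinitePresentation (RobbaRing p) D
  bijective_linearization : Function.Bijective A.linearization

/-- Torsion `(φ, Γ)`-modules. -/
structure IsTorsion : Prop where
  isGeneralized : A.IsGeneralized
  isTorsion : Module.IsTorsion (RobbaRing p) D

/-- Pure `t ^ k`-torsion `(φ, Γ)`-modules: torsion `(φ, Γ)`-modules that are killed by `t ^ k` and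
free as modules over `𝓡 / t ^ k`. -/
structure IsPureTorsion (k : ℕ) : Prop where
  isTorsion : A.IsTorsion
  isTorsionBy : Module.IsTorsionBy (RobbaRing p) D (tElt p ^ k)
  free : letI := isTorsionBy.module
    Module.Free (RobbaRing p ⧸ Ideal.span {tElt p ^ k}) D

/-- `D` is a successive extension of pure `t`-torsion `(φ, Γ)`-modules: there is a finite
filtration `0 = F₀ ⊆ F₁ ⊆ ⋯ ⊆ Fₙ = D` by torsion `(φ, Γ)`-submodules such that every
`Fᵢ₊₁ / Fᵢ`, with the induced actions, is a pure `t`-torsion `(φ, Γ)`-module. -/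
def IsSuccessiveExtension : Prop :=
  ∃ (n : ℕ) (F : ℕ → Submodule (RobbaRing p) D) (hF : ∀ i, A.IsStable (F i)),
    F 0 = ⊥ ∧ F n = ⊤ ∧ Monotone F ∧ (∀ i, (A.sub (F i) (hF i)).IsTorsion) ∧
    ∀ i < n, ((A.sub (F (i + 1)) (hF (i + 1))).quot ((F i).submoduleOf (F (i + 1)))
      ((hF i).submoduleOf (hF (i + 1)))).IsPureTorsion 1

end PhiGammaAction

end Robba

end

open scoped BoundedContinuousFunction

noncomputable section

namespace Robba

variable {p : ℕ} [Fact p.Prime]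

/-! ### Laurent polynomials on circles -/

/-! Elements of the Robba ring are analytic functions near the boundary of the disc, and `t`
vanishes there, to first order, exactly at the torsion points ζ - 1 with ζ a root of unity of
p-power order.

Ideals. Let finitely many functions generate an ideal stable under φ and Γ. If they had a common
zero x with log(1 + x) ≠ 0, then the iterates of γ with u = 1 + p would give common zeros on the
same circle with logarithms (1 + p)^n log(1 + x), all distinct; but a nonzero analytic function has
finitely many zeros on a closed annulus. So the common zeros are torsion points. They are stable
under φ, which lowers the order of ζ, and under conjugation over ℚ_p, since the cyclotomic
polynomials of p-power order stay irreducible. If they accumulate at the boundary, all torsion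
points of the annulus are therefore common zeros, every function is divisible by `t`, and the
quotients form a stable family again. If not, the functions have no common zero near the boundary
and generate the unit ideal. Division by `t` must stop, because only 0 is divisible by all powers of
`t`. Hence the ideal is (t^k): `StableFamily.dichotomy`, `StableFamily.span_eq`,
`exists_eq_span_tElt_pow`. The argument works for finitely generated ideals, so no Bézout property
is needed.

Analysis. On a closed annulus, an approximate Weierstrass division shows that a nonzero closed ideal
has finite codimension (`finiteDimensional_quotient`). This yields a Nullstellensatz, the finiteness
of zeros, and divisibility by the logarithm of functions vanishing at its zeros. Half-open annuli
are reached by gluing quotients (`logO_dvd_of_forall_zero`) and by a Mittag-Leffler argument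
(`exists_sum_mul_eq_one`).

Modules. The Fitting ideal of a torsion module S is finitely generated, nonzero and stable, hence
equals (t^k), and it kills S. The filtration is by the submodules t^j S. The point is that S/tS is
free over 𝓡/t. The fiber of S at x is a quotient of the fiber at φ(x), so over torsion points near
the boundary the fiber dimension is a constant d. Combinations of generators with coefficients on
the moment curve, in general position for the countably many torsion points, give d elements
inducing a basis of all these fibers. They generate S modulo `t`, hence S; and a combination of them
lying in tS has coefficients vanishing at the torsion points, hence divisible by `t`
(`exists_generators_independent_mod`). So S/tS is free, all relations are divisible by `t`, and tS
is again a torsion (φ, Γ)-module; induction finishes. -/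

theorem norm_smul_zpow (c : ℚ_[p]) (x : ℂ_[p]) (n : ℤ) : ‖c • x ^ n‖ = ‖c‖ * ‖x‖ ^ n := by
  rw [norm_smul, norm_zpow]

theorem norm_p_lt_one : ‖(p : ℂ_[p])‖ < 1 := by
  have h : ((p : ℚ_[p]) : ℂ_[p]) = (p : ℂ_[p]) := by
    exact map_natCast (algebraMap ℚ_[p] ℂ_[p]) p
  have h2 : ‖((p : ℚ_[p]) : ℂ_[p])‖ = ‖(p : ℚ_[p])‖ := norm_algebraMap' ℂ_[p] (p : ℚ_[p])
  rw [← h, h2]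
  exact Padic.norm_p_lt_one

theorem norm_natCast_eq (n : ℕ) : ‖(n : ℂ_[p])‖ = ‖(n : ℚ_[p])‖ := by
  rw [← map_natCast (algebraMap ℚ_[p] ℂ_[p]) n]
  exact norm_algebraMap' ℂ_[p] (n : ℚ_[p])

theorem norm_natCast_le_one (n : ℕ) : ‖(n : ℂ_[p])‖ ≤ 1 := by
  rw [norm_natCast_eq]
  exact_mod_cast Padic.norm_int_le_one (p := p) n

theorem norm_add_eq_left {x y : ℂ_[p]} (h : ‖y‖ < ‖x‖) : ‖x + y‖ = ‖x‖ := by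
  rw [IsUltrametricDist.norm_add_eq_max_of_norm_ne_norm h.ne', max_eq_left h.le]

theorem norm_pow_add_one {j : ℕ} (hj : j ≠ 0) : ‖((p ^ j + 1 : ℕ) : ℂ_[p])‖ = 1 := by
  push_cast
  rw [add_comm, norm_add_eq_left, norm_one]
  rw [norm_one, norm_pow]
  exact pow_lt_one₀ (norm_nonneg _) norm_p_lt_one hj

/-- The coefficients of a Laurent polynomial are bounded by its values on a circle. -/
theorem coeff_bound (s : Finset ℤ) (c : ℤ → ℚ_[p]) {x₀ : ℂ_[p]} {C : ℝ}
    (hC : 0 ≤ C) (h : ∀ x : ℂ_[p], ‖x‖ = ‖x₀‖ → ‖∑ n ∈ s, c n • x ^ n‖ ≤ C) {n : ℤ} (hn : n ∈ s) :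
    ‖c n‖ * ‖x₀‖ ^ n ≤ C := by
  have hp1 : 1 < p := (Fact.out : p.Prime).one_lt
  -- The number N = p^j + 1 has norm 1 because j ≥ 1, and it exceeds every |k - n|. Averaging over
  -- the N-th roots of unity therefore isolates the n-th coefficient without any loss in norm.
  set j : ℕ := 1 + ∑ k ∈ s, (k - n).natAbs with hj
  set N : ℕ := p ^ j + 1 with hN
  have hNk : ∀ k ∈ s, (k - n).natAbs < N := by
    intro k hk
    have h1 : (k - n).natAbs ≤ ∑ k ∈ s, (k - n).natAbs :=
      Finset.single_le_sum (f := fun k : ℤ => (k - n).natAbs) (fun _ _ => Nat.zero_le _) hk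
    have h2 : j < p ^ j := Nat.lt_pow_self hp1
    omega
  have hN0 : N ≠ 0 := by omega
  have : NeZero N := ⟨hN0⟩
  have : NeZero (N : ℂ_[p]) := ⟨by exact_mod_cast hN0⟩
  obtain ⟨η, hη⟩ := HasEnoughRootsOfUnity.exists_primitiveRoot ℂ_[p] N
  have hη1 : ‖η‖ = 1 := (pow_eq_one_iff_of_nonneg (norm_nonneg _) hN0).1 (by rw [← norm_pow, hη.pow_eq_one, norm_one])
  have hη0 : η ≠ 0 := by
    rintro rfl
    simp at hη1
  have hnorm : ‖((N : ℕ) : ℂ_[p])‖ = 1 := norm_pow_add_one (by omega)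
  have key : ∑ i ∈ Finset.range N, (η ^ i) ^ (-n) * ∑ k ∈ s, c k • (η ^ i * x₀) ^ k
      = (N : ℂ_[p]) * (c n • x₀ ^ n) := by
    simp_rw [Finset.mul_sum]
    rw [Finset.sum_comm, Finset.sum_eq_single n]
    · rw [Finset.sum_congr rfl (g := fun _ => c n • x₀ ^ n), Finset.sum_const, Finset.card_range,
        nsmul_eq_mul]
      intro i _
      rw [mul_zpow, mul_smul_comm, ← mul_assoc, ← zpow_add₀ (pow_ne_zero _ hη0), neg_add_cancel,
        zpow_zero, one_mul]
    · intro k hk hkn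
      have h1 : ∀ i ∈ Finset.range N, (η ^ i) ^ (-n) * c k • (η ^ i * x₀) ^ k
          = (η ^ (k - n)) ^ i * (c k • x₀ ^ k) := by
        intro i _
        rw [mul_zpow, mul_smul_comm, ← mul_assoc, ← zpow_add₀ (pow_ne_zero _ hη0), mul_smul_comm,
          ← zpow_natCast, ← zpow_mul, ← zpow_natCast, ← zpow_mul]
        congr 3
        ring
      rw [Finset.sum_congr rfl h1, ← Finset.sum_mul]
      have h2 : η ^ (k - n) ≠ 1 := by
        intro h3
        have h4 := (hη.zpow_eq_one_iff_dvd _).1 h3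
        have h5 := Int.natAbs_dvd_natAbs.2 h4
        have h6 := Nat.le_of_dvd (by omega) h5
        have := hNk k hk
        simp only [Int.natAbs_natCast] at h6
        omega
      have h3 : (∑ i ∈ Finset.range N, (η ^ (k - n)) ^ i) * (η ^ (k - n) - 1) = 0 := by
        rw [geom_sum_mul, ← zpow_natCast, ← zpow_mul, mul_comm (k - n), zpow_mul, zpow_natCast,
          hη.pow_eq_one, one_zpow, sub_self]
      rw [(mul_eq_zero.1 h3).resolve_right (sub_ne_zero.2 h2), zero_mul]
    · exact fun h => absurd hn h
  have h7 := congrArg norm key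
  rw [norm_mul, hnorm, one_mul, norm_smul_zpow] at h7
  rw [← h7]
  refine IsUltrametricDist.norm_sum_le_of_forall_le_of_nonneg hC fun i _ => ?_
  rw [norm_mul, norm_zpow, norm_pow, hη1, one_pow, one_zpow, one_mul]
  exact h _ (by rw [norm_mul, norm_pow, hη1, one_pow, one_mul])

/-! ### Analytic functions on a closed annulus -/

variable (p) in
/-- Points of the punctured open unit disc, used as radii. -/
abbrev Rad := {a : ℂ_[p] // a ≠ 0 ∧ ‖a‖ < 1}

theorem Rad.pos (a : Rad p) : 0 < ‖a.1‖ := norm_pos_iff.2 a.2.1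

/-- The closed annulus `‖a‖ ≤ ‖x‖ ≤ ‖b‖`. -/
abbrev Annulus (a b : Rad p) := {x : ℂ_[p] // ‖a.1‖ ≤ ‖x‖ ∧ ‖x‖ ≤ ‖b.1‖}

theorem Annulus.pos {a b : Rad p} (x : Annulus a b) : 0 < ‖x.1‖ := a.pos.trans_le x.2.1

theorem Annulus.ne_zero {a b : Rad p} (x : Annulus a b) : x.1 ≠ 0 := norm_pos_iff.1 x.pos

instance {α : Type*} [TopologicalSpace α] : IsUltrametricDist (α →ᵇ ℂ_[p]) :=
  IsUltrametricDist.isUltrametricDist_of_forall_norm_add_le_max_norm fun f g => by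
    rw [BoundedContinuousFunction.norm_le (le_max_of_le_left (norm_nonneg _))]
    intro x
    exact (IsUltrametricDist.norm_add_le_max (f x) (g x)).trans
      (max_le_max (f.norm_coe_le_norm x) (g.norm_coe_le_norm x))

/-- The norm of the monomial `Tⁿ` on the annulus. -/
def wt (a b : Rad p) (n : ℤ) : ℝ := max (‖a.1‖ ^ n) (‖b.1‖ ^ n)

theorem wt_pos (a b : Rad p) (n : ℤ) : 0 < wt a b n := lt_max_of_lt_left (zpow_pos a.pos n)

theorem norm_zpow_le_wt {a b : Rad p} (x : Annulus a b) (n : ℤ) : ‖x.1‖ ^ n ≤ wt a b n := by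
  rcases le_total 0 n with hn | hn
  · exact le_max_of_le_right (zpow_le_zpow_left₀ hn x.pos.le x.2.2)
  · refine le_max_of_le_left ?_
    obtain ⟨m, rfl⟩ := Int.exists_eq_neg_ofNat hn
    rw [zpow_neg, zpow_neg, zpow_natCast, zpow_natCast]
    exact inv_anti₀ (pow_pos a.pos m) (pow_le_pow_left₀ a.pos.le x.2.1 m)

/-- The monomial `Tⁿ` on the annulus. -/
def mon (a b : Rad p) (n : ℤ) : Annulus a b →ᵇ ℂ_[p] :=
  BoundedContinuousFunction.ofNormedAddCommGroup (fun x => x.1 ^ n)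
    (continuous_iff_continuousAt.2 fun x =>
      ContinuousAt.zpow₀ continuous_subtype_val.continuousAt n (Or.inl x.ne_zero))
    (wt a b n) fun x => by rw [norm_zpow]; exact norm_zpow_le_wt x n

@[simp] theorem mon_apply {a b : Rad p} (n : ℤ) (x : Annulus a b) : mon a b n x = x.1 ^ n := rfl

theorem norm_mon_le (a b : Rad p) (n : ℤ) : ‖mon a b n‖ ≤ wt a b n :=
  BoundedContinuousFunction.norm_ofNormedAddCommGroup_le _ (wt_pos a b n).le _

theorem mon_mul (a b : Rad p) (m n : ℤ) : mon a b m * mon a b n = mon a b (m + n) := by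
  ext x
  simp [zpow_add₀ x.ne_zero]

theorem mon_zero (a b : Rad p) : mon a b 0 = 1 := by
  ext x
  simp

/-- Laurent polynomials on the annulus. -/
def laurentPoly (a b : Rad p) : Subalgebra ℚ_[p] (Annulus a b →ᵇ ℂ_[p]) :=
  (Submodule.span ℚ_[p] (Set.range (mon a b))).toSubalgebra
    (by rw [← mon_zero]; exact Submodule.subset_span ⟨0, rfl⟩)
    (fun f g hf hg => by
      have := Submodule.mul_mem_mul hf hg
      rw [Submodule.span_mul_span] at this
      refine Submodule.span_mono ?_ this
      rintro _ ⟨_, ⟨m, rfl⟩, _, ⟨n, rfl⟩, rfl⟩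
      exact ⟨m + n, (mon_mul a b m n).symm⟩)

theorem mem_laurentPoly {a b : Rad p} {f : Annulus a b →ᵇ ℂ_[p]} :
    f ∈ laurentPoly a b ↔ ∃ c : ℤ →₀ ℚ_[p], f = ∑ n ∈ c.support, c n • mon a b n := by
  change f ∈ Submodule.span ℚ_[p] (Set.range (mon a b)) ↔ _
  rw [Finsupp.mem_span_range_iff_exists_finsupp]
  exact ⟨fun ⟨c, hc⟩ => ⟨c, hc.symm⟩, fun ⟨c, hc⟩ => ⟨c, hc.symm⟩⟩

theorem mon_mem_laurentPoly (a b : Rad p) (n : ℤ) : mon a b n ∈ laurentPoly a b :=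
  Submodule.subset_span (s := Set.range (mon a b)) ⟨n, rfl⟩

/-- The algebra of analytic functions, defined over `ℚ_p`, on a closed annulus. -/
def AnnAlg (a b : Rad p) : Subalgebra ℚ_[p] (Annulus a b →ᵇ ℂ_[p]) :=
  (laurentPoly a b).topologicalClosure

theorem isClosed_annAlg (a b : Rad p) : IsClosed (AnnAlg a b : Set (Annulus a b →ᵇ ℂ_[p])) :=
  Subalgebra.isClosed_topologicalClosure _

instance (a b : Rad p) : NormedCommRing (AnnAlg a b) := Subalgebra.normedCommRing _

instance (a b : Rad p) : NormedAlgebra ℚ_[p] (AnnAlg a b) := Subalgebra.toNormedAlgebra _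

instance (a b : Rad p) : NormedSpace ℚ_[p] (AnnAlg a b) :=
  NormedAlgebra.toNormedSpace _

instance (a b : Rad p) : CompleteSpace (AnnAlg a b) :=
  (isClosed_annAlg a b).completeSpace_coe

instance (a b : Rad p) : IsUltrametricDist (AnnAlg a b) :=
  ⟨fun f g h => IsUltrametricDist.dist_triangle_max (f : Annulus a b →ᵇ ℂ_[p]) g h⟩

theorem laurentPoly_le (a b : Rad p) : laurentPoly a b ≤ AnnAlg a b :=
  Subalgebra.le_topologicalClosure _

/-- The monomial `Tⁿ` as an analytic function. -/
def amon (a b : Rad p) (n : ℤ) : AnnAlg a b := ⟨mon a b n, laurentPoly_le a b (mon_mem_laurentPoly a b n)⟩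

theorem norm_sub_le_max {E : Type*} [SeminormedAddCommGroup E] [IsUltrametricDist E] (x y : E) :
    ‖x - y‖ ≤ max ‖x‖ ‖y‖ := by
  rw [sub_eq_add_neg, ← norm_neg y]
  exact IsUltrametricDist.norm_add_le_max x (-y)

theorem norm_amon_le (a b : Rad p) (n : ℤ) : ‖amon a b n‖ ≤ wt a b n := norm_mon_le a b n

theorem amon_mul (a b : Rad p) (m n : ℤ) : amon a b m * amon a b n = amon a b (m + n) :=
  Subtype.ext (mon_mul a b m n)

theorem amon_zero (a b : Rad p) : amon a b 0 = 1 := Subtype.ext (mon_zero a b)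

/-- The value of an analytic function at a point. -/
def ev {a b : Rad p} (x : Annulus a b) : AnnAlg a b →ₐ[ℚ_[p]] ℂ_[p] where
  toFun f := f.1 x
  map_one' := rfl
  map_mul' _ _ := rfl
  map_zero' := rfl
  map_add' _ _ := rfl
  commutes' c := by
    rw [Algebra.algebraMap_eq_smul_one, Algebra.algebraMap_eq_smul_one]
    rfl

@[simp] theorem ev_amon {a b : Rad p} (x : Annulus a b) (n : ℤ) : ev x (amon a b n) = x.1 ^ n := rfl

theorem norm_ev_le {a b : Rad p} (x : Annulus a b) (f : AnnAlg a b) : ‖ev x f‖ ≤ ‖f‖ :=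
  f.1.norm_coe_le_norm x

theorem norm_le_iff {a b : Rad p} {f : AnnAlg a b} {C : ℝ} (hC : 0 ≤ C) :
    ‖f‖ ≤ C ↔ ∀ x, ‖ev x f‖ ≤ C := BoundedContinuousFunction.norm_le hC

theorem AnnAlg.ext {a b : Rad p} {f g : AnnAlg a b} (h : ∀ x, ev x f = ev x g) : f = g :=
  Subtype.ext (BoundedContinuousFunction.ext h)

theorem continuous_ev {a b : Rad p} (x : Annulus a b) : Continuous (ev x) :=
  (BoundedContinuousFunction.lipschitz_eval_const x).continuous.comp continuous_subtype_val

/-- The Laurent polynomial with given coefficients. -/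
def lpoly (a b : Rad p) : (ℤ →₀ ℚ_[p]) →ₗ[ℚ_[p]] AnnAlg a b :=
  Finsupp.linearCombination ℚ_[p] (amon a b)

theorem lpoly_eq_sum {a b : Rad p} (c : ℤ →₀ ℚ_[p]) {s : Finset ℤ} (hs : c.support ⊆ s) :
    lpoly a b c = ∑ n ∈ s, c n • amon a b n :=
  Finsupp.linearCombination_apply_of_mem_supported ℚ_[p] hs

theorem hasSum_lpoly {a b : Rad p} (c : ℤ →₀ ℚ_[p]) :
    HasSum (fun n => c n • amon a b n) (lpoly a b c) := by
  rw [lpoly_eq_sum c subset_rfl]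
  refine hasSum_sum_of_ne_finset_zero fun n hn => ?_
  rw [Finsupp.notMem_support_iff.1 hn, zero_smul]

/-- Approximation by Laurent polynomials. -/
theorem exists_lpoly_approx {a b : Rad p} (f : AnnAlg a b) {ε : ℝ} (hε : 0 < ε) :
    ∃ c : ℤ →₀ ℚ_[p], ‖f - lpoly a b c‖ < ε := by
  obtain ⟨g, hg, hfg⟩ := Metric.mem_closure_iff.1 f.2 ε hε
  obtain ⟨c, hc⟩ := mem_laurentPoly.1 hg
  refine ⟨c, ?_⟩
  have h1 : ((lpoly a b c : AnnAlg a b) : Annulus a b →ᵇ ℂ_[p]) = g := by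
    rw [hc, lpoly_eq_sum c subset_rfl, AddSubmonoidClass.coe_finsetSum]
    rfl
  rw [dist_eq_norm, ← h1] at hfg
  exact hfg

theorem denseRange_lpoly (a b : Rad p) : DenseRange (lpoly a b) := by
  intro f
  rw [Metric.mem_closure_iff]
  intro ε hε
  obtain ⟨c, hc⟩ := exists_lpoly_approx f hε
  exact ⟨_, ⟨c, rfl⟩, by rwa [dist_eq_norm]⟩

theorem norm_smul_amon_le {a b : Rad p} (c : ℚ_[p]) (n : ℤ) :
    ‖c • amon a b n‖ ≤ ‖c‖ * wt a b n := by
  rw [norm_smul]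
  exact mul_le_mul_of_nonneg_left (norm_amon_le a b n) (norm_nonneg _)

theorem hasSum_ev {a b : Rad p} {c : ℤ → ℚ_[p]} {f : AnnAlg a b}
    (h : HasSum (fun n => c n • amon a b n) f) (x : Annulus a b) :
    HasSum (fun n => c n • x.1 ^ n) (ev x f) := by
  have := h.map (ev x) (continuous_ev x)
  refine this.congr_fun fun n => ?_
  simp

/-- Cauchy's estimate. -/
theorem coeff_le_of_circles {a b : Rad p} (hab : ‖a.1‖ ≤ ‖b.1‖) {c : ℤ → ℚ_[p]} {f : AnnAlg a b}
    (h : HasSum (fun n => c n • amon a b n) f) {C : ℝ} (hC : 0 ≤ C)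
    (hf : ∀ x : Annulus a b, ‖x.1‖ = ‖a.1‖ ∨ ‖x.1‖ = ‖b.1‖ → ‖ev x f‖ ≤ C) (n : ℤ) :
    ‖c n‖ * wt a b n ≤ C := by
  refine le_of_forall_pos_le_add fun ε hε => ?_
  have h1 : ∀ᶠ s : Finset ℤ in atTop, dist (∑ n ∈ s, c n • amon a b n) f < ε :=
    h (Metric.ball_mem_nhds f hε)
  obtain ⟨s, hs1, hs2⟩ := (h1.and (eventually_ge_atTop {n})).exists
  have hns : n ∈ s := hs2 (Finset.mem_singleton_self n)
  rw [dist_eq_norm] at hs1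
  have h2 : ∀ x : Annulus a b, ‖x.1‖ = ‖a.1‖ ∨ ‖x.1‖ = ‖b.1‖ →
      ‖∑ n ∈ s, c n • x.1 ^ n‖ ≤ C + ε := by
    intro x hx
    have h3 : ∑ n ∈ s, c n • x.1 ^ n = ev x (∑ n ∈ s, c n • amon a b n - f) + ev x f := by
      rw [← map_add, sub_add_cancel, map_sum]
      simp
    rw [h3]
    refine (norm_add_le _ _).trans ?_
    rw [add_comm]
    exact add_le_add (hf x hx) ((norm_ev_le x _).trans hs1.le)
  rw [wt, mul_max_of_nonneg _ _ (norm_nonneg _)]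
  refine max_le ?_ ?_
  · exact coeff_bound s c (by positivity) (fun x hx =>
      h2 ⟨x, hx.ge, hx.le.trans hab⟩ (Or.inl hx)) hns
  · exact coeff_bound s c (by positivity) (fun x hx =>
      h2 ⟨x, hab.trans hx.ge, hx.le⟩ (Or.inr hx)) hns

theorem coeff_le_of_hasSum {a b : Rad p} (hab : ‖a.1‖ ≤ ‖b.1‖) {c : ℤ → ℚ_[p]} {f : AnnAlg a b}
    (h : HasSum (fun n => c n • amon a b n) f) (n : ℤ) : ‖c n‖ * wt a b n ≤ ‖f‖ :=
  coeff_le_of_circles hab h (norm_nonneg _) (fun x _ => norm_ev_le x f) n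

theorem norm_le_of_hasSum {a b : Rad p} {c : ℤ → ℚ_[p]} {f : AnnAlg a b}
    (h : HasSum (fun n => c n • amon a b n) f) {C : ℝ} (hC : 0 ≤ C)
    (hc : ∀ n, ‖c n‖ * wt a b n ≤ C) : ‖f‖ ≤ C := by
  rw [← h.tsum_eq]
  exact IsUltrametricDist.norm_tsum_le_of_forall_le_of_nonneg hC fun n =>
    (norm_smul_amon_le _ _).trans (hc n)

theorem summable_amon {a b : Rad p} {c : ℤ → ℚ_[p]}
    (h : Tendsto (fun n => ‖c n‖ * wt a b n) cofinite (𝓝 0)) :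
    Summable fun n => c n • amon a b n :=
  summable_of_norm (squeeze_zero (fun _ => norm_nonneg _) (fun n => norm_smul_amon_le _ n) h)

/-- The Laurent expansion of an analytic function. -/
theorem exists_expansion {a b : Rad p} (hab : ‖a.1‖ ≤ ‖b.1‖) (f : AnnAlg a b) :
    ∃ c : ℤ → ℚ_[p], Tendsto (fun n => ‖c n‖ * wt a b n) cofinite (𝓝 0) ∧
      HasSum (fun n => c n • amon a b n) f := by
  -- Take Laurent polynomials g_i within 2^{-i} of f. Cauchy's estimate makes their coefficients
  -- Cauchy sequences, uniformly in the weighted norm, and the limits are the coefficients of f.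
  have hε : ∀ i : ℕ, (0 : ℝ) < (1 / 2) ^ i := fun i => by positivity
  choose g hg using fun i => exists_lpoly_approx f (hε i)
  have hanti : ∀ i j : ℕ, i ≤ j → ((1 : ℝ) / 2) ^ j ≤ (1 / 2) ^ i := fun i j hij =>
    pow_le_pow_of_le_one (by norm_num) (by norm_num) hij
  have hd : ∀ i j : ℕ, i ≤ j → ∀ n, ‖g j n - g i n‖ * wt a b n ≤ (1 / 2) ^ i := by
    intro i j hij n
    have h1 := coeff_le_of_hasSum hab (hasSum_lpoly (a := a) (b := b) (g j - g i)) n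
    refine h1.trans ?_
    have h2 : lpoly a b (g j - g i) = (f - lpoly a b (g i)) - (f - lpoly a b (g j)) := by
      rw [map_sub]
      ring
    rw [h2]
    exact (norm_sub_le_max _ _).trans
      (max_le (hg i).le ((hg j).le.trans (hanti i j hij)))
  have hcau : ∀ n, CauchySeq fun i => g i n := by
    intro n
    refine cauchySeq_of_le_tendsto_0 (fun i : ℕ => (1 / 2 : ℝ) ^ i / wt a b n * 2) ?_ ?_
    · intro i j N hi hj
      rw [dist_eq_norm]
      have h1 : ‖g i n - g j n‖ ≤ ‖g i n - g N n‖ + ‖g j n - g N n‖ := by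
        have : g i n - g j n = (g i n - g N n) - (g j n - g N n) := by ring
        rw [this]
        exact norm_sub_le _ _
      have h2 := (le_div_iff₀ (wt_pos a b n)).2 (hd N i hi n)
      have h3 := (le_div_iff₀ (wt_pos a b n)).2 (hd N j hj n)
      linarith
    · have : Tendsto (fun i : ℕ => (1 / 2 : ℝ) ^ i) atTop (𝓝 0) :=
        tendsto_pow_atTop_nhds_zero_of_lt_one (by norm_num) (by norm_num)
      simpa using (this.div_const (wt a b n)).mul_const 2
  choose c hc using fun n => cauchySeq_tendsto_of_complete (hcau n)
  have hcg : ∀ i n, ‖c n - g i n‖ * wt a b n ≤ (1 / 2) ^ i := by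
    intro i n
    have h1 : Tendsto (fun j => ‖g j n - g i n‖ * wt a b n) atTop
        (𝓝 (‖c n - g i n‖ * wt a b n)) := (((hc n).sub_const _).norm).mul_const _
    exact le_of_tendsto h1 ((eventually_ge_atTop i).mono fun j hj => hd i j hj n)
  have hlim : Tendsto (fun n => ‖c n‖ * wt a b n) cofinite (𝓝 0) := by
    rw [Metric.tendsto_nhds]
    intro ε hε'
    obtain ⟨i, hi⟩ := exists_pow_lt_of_lt_one hε' (by norm_num : (1 / 2 : ℝ) < 1)
    -- Outside the finite support of g_i, the weighted coefficient is at most 2^{-i} < ε.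
    refine (g i).support.finite_toSet.subset ?_
    intro n hn
    by_contra hns
    refine hn ?_
    have h1 := hcg i n
    rw [Finset.mem_coe, Finsupp.notMem_support_iff] at hns
    rw [hns, sub_zero] at h1
    have h0 : 0 ≤ ‖c n‖ * wt a b n := mul_nonneg (norm_nonneg _) (wt_pos a b n).le
    simp only [Set.mem_ofPred_eq]
    rw [dist_zero_right, Real.norm_of_nonneg h0]
    exact h1.trans_lt hi
  refine ⟨c, hlim, ?_⟩
  have hS := (summable_amon hlim).hasSum
  convert hS using 1
  refine eq_of_norm_sub_le_zero (le_of_forall_pos_le_add fun ε hε' => ?_)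
  obtain ⟨i, hi⟩ := exists_pow_lt_of_lt_one hε' (by norm_num : (1 / 2 : ℝ) < 1)
  rw [zero_add]
  refine le_trans ?_ hi.le
  have h2 : HasSum (fun n => (c n - g i n) • amon a b n)
      ((∑' n, c n • amon a b n) - lpoly a b (g i)) := by
    simpa only [sub_smul] using hS.sub (hasSum_lpoly (g i))
  have h3 := norm_le_of_hasSum h2 (hε i).le (hcg i)
  have h4 : f - ∑' n, c n • amon a b n =
      (f - lpoly a b (g i)) - ((∑' n, c n • amon a b n) - lpoly a b (g i)) := by ring
  rw [h4]
  exact (norm_sub_le_max _ _).trans (max_le (hg i).le h3)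

/-- The maximum principle. -/
theorem norm_le_of_circles {a b : Rad p} (hab : ‖a.1‖ ≤ ‖b.1‖) {f : AnnAlg a b} {C : ℝ}
    (hC : 0 ≤ C) (hf : ∀ x : Annulus a b, ‖x.1‖ = ‖a.1‖ ∨ ‖x.1‖ = ‖b.1‖ → ‖ev x f‖ ≤ C) :
    ‖f‖ ≤ C := by
  obtain ⟨c, -, hc⟩ := exists_expansion hab f
  exact norm_le_of_hasSum hc hC (coeff_le_of_circles hab hc hC hf)

theorem tendsto_wt_of_summable {a b : Rad p} {c : ℤ → ℚ_[p]}
    (ha : Summable fun n => c n • a.1 ^ n) (hb : Summable fun n => c n • b.1 ^ n) :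
    Tendsto (fun n => ‖c n‖ * wt a b n) cofinite (𝓝 0) := by
  have h1 := tendsto_zero_iff_norm_tendsto_zero.1 ha.tendsto_cofinite_zero
  have h2 := tendsto_zero_iff_norm_tendsto_zero.1 hb.tendsto_cofinite_zero
  have h3 := h1.max h2
  rw [max_self] at h3
  refine h3.congr fun n => ?_
  rw [norm_smul_zpow, norm_smul_zpow, wt, mul_max_of_nonneg _ _ (norm_nonneg _)]

/-- A pointwise convergent Laurent series is analytic. -/
theorem exists_of_pointwise {a b : Rad p} {c : ℤ → ℚ_[p]}
    (ha : Summable fun n => c n • a.1 ^ n) (hb : Summable fun n => c n • b.1 ^ n) :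
    ∃ f : AnnAlg a b, HasSum (fun n => c n • amon a b n) f :=
  summable_amon (tendsto_wt_of_summable ha hb)

/-- Uniqueness of Laurent coefficients. -/
theorem coeff_eq_zero_of_circle {a : Rad p} {c : ℤ → ℚ_[p]}
    (h : ∀ x : ℂ_[p], ‖x‖ = ‖a.1‖ → HasSum (fun n => c n • x ^ n) 0) (n : ℤ) : c n = 0 := by
  have ha := (h a.1 rfl).summable
  obtain ⟨f, hf⟩ := exists_of_pointwise ha ha
  have hf0 : f = 0 := AnnAlg.ext fun x => by
    rw [map_zero]
    exact (hasSum_ev hf x).unique (h x.1 (le_antisymm x.2.2 x.2.1))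
  have h1 := coeff_le_of_hasSum le_rfl hf n
  rw [hf0, norm_zero] at h1
  have h2 : ‖c n‖ ≤ 0 := nonpos_of_mul_nonpos_left h1 (wt_pos a a n)
  exact norm_le_zero_iff.1 h2

/-! ### Finite-dimensionality of quotients of the algebra of an annulus -/

/-- Approximate Weierstrass division, with `e k` standing for T^k and `y n` for f T^n. Solve f
T^{n-M} / c_M for its term T^n. Terms with index in [-D, n) are replaced by approximants from the
induction; terms above n are small because M is the last index of maximal size on the outer circle;
terms below -D are small on the inner circle by the choice of D. Keeping `e` abstract lets the lemma
be reused for negative exponents. -/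
theorem exists_approx_nonneg {X : Type*} [NormedAddCommGroup X] [NormedSpace ℚ_[p] X]
    [IsUltrametricDist X] {α β δ : ℝ} (hα : 0 < α) (hαβ : α ≤ β) (hδ : 0 ≤ δ)
    {e : ℤ → X} (he : ∀ k, ‖e k‖ ≤ max (α ^ k) (β ^ k)) {W : Submodule ℚ_[p] X} {c : ℤ → ℚ_[p]}
    {y : ℤ → X} (hy : ∀ n, y n ∈ W) (hsum : ∀ n, HasSum (fun j => c j • e (j + n)) (y n)) {M : ℤ}
    {D : ℕ} (hM : c M ≠ 0) (h1 : ∀ j, ‖c j‖ * β ^ j ≤ ‖c M‖ * β ^ M)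
    (h2 : ∀ j, M < j → ‖c j‖ * β ^ j ≤ δ * (‖c M‖ * β ^ M))
    (h3 : ∀ j, j ≤ M - D → ‖c j‖ * α ^ j ≤ δ * (‖c M‖ * α ^ M))
    (hW : ∀ k : ℤ, -D ≤ k → k ≤ D → e k ∈ W) (n : ℕ) : ∃ w ∈ W, ‖e n - w‖ ≤ δ * β ^ (n : ℤ) := by
  have hβ : 0 < β := hα.trans_le hαβ
  induction n using Nat.strong_induction_on with
  | _ n ih =>
  by_cases hnD : n ≤ D
  · exact ⟨e n, hW n (by omega) (by omega), by rw [sub_self, norm_zero]; positivity⟩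
  -- These are the coefficients of f T^{n-M} / c_M, normalised so that T^n has coefficient 1.
  set q : ℤ → ℚ_[p] := fun k => (c M)⁻¹ * c (k + (M - n)) with hq
  have hqn : q n = 1 := by
    simp only [hq]
    rw [show (n : ℤ) + (M - n) = M by ring, inv_mul_cancel₀ hM]
  have hscale : ∀ {r θ : ℝ} (k : ℤ), 0 < r →
      ‖c (k + (M - n))‖ * r ^ (k + (M - n)) ≤ θ * (‖c M‖ * r ^ M) →
      ‖q k‖ * r ^ k ≤ θ * r ^ (n : ℤ) := by
    intro r θ k hr h
    have hcM : 0 < ‖c M‖ := norm_pos_iff.2 hM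
    simp only [hq]
    rw [norm_mul, norm_inv]
    have h5 : r ^ (k + (M - n)) = r ^ k * (r ^ M / r ^ (n : ℤ)) := by
      rw [zpow_add₀ hr.ne', zpow_sub₀ hr.ne']
    rw [h5] at h
    have h6 : 0 < r ^ M := zpow_pos hr _
    have h7 : 0 < r ^ (n : ℤ) := zpow_pos hr _
    have h8 : ‖c (k + (M - n))‖ * (r ^ k * (r ^ M / r ^ (n : ℤ)))
        = (‖c M‖⁻¹ * ‖c (k + (M - n))‖ * r ^ k) * (‖c M‖ * r ^ M) / r ^ (n : ℤ) := by
      field_simp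
    rw [h8, div_le_iff₀ h7] at h
    have h9 : 0 < ‖c M‖ * r ^ M := by positivity
    nlinarith
  have hw : ∀ k : ℤ, ∃ w ∈ W, (-D ≤ k → k < n → ‖e k - w‖ ≤ δ * β ^ k ∧ (k ≤ D → e k = w)) := by
    intro k
    by_cases hk : -D ≤ k ∧ k < n
    · by_cases hkD : k ≤ D
      · refine ⟨e k, hW k hk.1 hkD, fun _ _ => ⟨?_, fun _ => rfl⟩⟩
        rw [sub_self, norm_zero]
        positivity
      · obtain ⟨m, rfl⟩ := Int.eq_ofNat_of_zero_le (show 0 ≤ k by omega)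
        obtain ⟨w, hwW, hw⟩ := ih m (by omega)
        exact ⟨w, hwW, fun _ _ => ⟨hw, fun h => absurd h hkD⟩⟩
    · exact ⟨0, W.zero_mem, fun h h' => absurd ⟨h, h'⟩ hk⟩
  choose w hwW hw using hw
  have hs1 : HasSum (fun k => q k • e k) ((c M)⁻¹ • y (n - M)) := by
    have h := (hsum (n - M)).const_smul (c M)⁻¹
    rw [← (Equiv.addRight (M - (n : ℤ))).hasSum_iff] at h
    refine h.congr_fun fun k => ?_
    simp only [hq, Function.comp_apply, Equiv.coe_addRight, smul_smul]
    congr 2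
    ring
  set K : Finset ℤ := Finset.Ico (-D : ℤ) n with hK
  have hnK : (n : ℤ) ∉ K := by simp [hK]
  -- The term T^n together with the chosen approximants. The series of f T^{n-M} / c_M minus `u` is,
  -- up to sign, the error to be bounded term by term.
  set u : ℤ → X := fun k => if k = n then e n else if k ∈ K then q k • w k else 0 with hu
  have hs2 : HasSum u (e n + ∑ k ∈ K, q k • w k) := by
    have h : ∑ k ∈ insert (n : ℤ) K, u k = e n + ∑ k ∈ K, q k • w k := by
      rw [Finset.sum_insert hnK]
      congr 1
      · simp [hu]
      · refine Finset.sum_congr rfl fun k hk => ?_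
        have : k ≠ n := fun h => hnK (h ▸ hk)
        simp [hu, this, hk]
    rw [← h]
    refine hasSum_sum_of_ne_finset_zero fun k hk => ?_
    rw [Finset.mem_insert, not_or] at hk
    simp [hu, hk.1, hk.2]
  have hs3 := hs1.sub hs2
  refine ⟨(c M)⁻¹ • y (n - M) - ∑ k ∈ K, q k • w k, W.sub_mem (W.smul_mem _ (hy _))
    (W.sum_mem fun k _ => W.smul_mem _ (hwW k)), ?_⟩
  have h4 : e n - ((c M)⁻¹ • y (n - M) - ∑ k ∈ K, q k • w k)
      = -((c M)⁻¹ • y (n - M) - (e n + ∑ k ∈ K, q k • w k)) := by abel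
  rw [h4, norm_neg, ← hs3.tsum_eq]
  refine IsUltrametricDist.norm_tsum_le_of_forall_le_of_nonneg (by positivity) fun k => ?_
  by_cases hkn : k = n
  · subst hkn
    simp only [hu, if_true, hqn, one_smul, sub_self, norm_zero]
    positivity
  by_cases hkK : k ∈ K
  · have hk := Finset.mem_Ico.1 hkK
    obtain ⟨h5, h6⟩ := hw k hk.1 hk.2
    simp only [hu, if_neg hkn, if_pos hkK]
    rw [← smul_sub, norm_smul]
    have h7 := hscale (θ := 1) k hβ (by rw [one_mul]; exact h1 _)
    calc ‖q k‖ * ‖e k - w k‖ ≤ ‖q k‖ * (δ * β ^ k) :=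
          mul_le_mul_of_nonneg_left h5 (norm_nonneg _)
      _ = δ * (‖q k‖ * β ^ k) := by ring
      _ ≤ δ * β ^ (n : ℤ) := by
          rw [one_mul] at h7
          exact mul_le_mul_of_nonneg_left h7 hδ
  · simp only [hu, if_neg hkn, if_neg hkK, sub_zero]
    rw [norm_smul]
    have hkK' : k < -D ∨ n < k := by
      by_contra hcon
      push Not at hcon
      exact hkK (Finset.mem_Ico.2 ⟨hcon.1, by omega⟩)
    rcases hkK' with hk | hk
    · have h5 : ‖e k‖ ≤ α ^ k := by
        refine (he k).trans (max_le le_rfl ?_)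
        obtain ⟨m, rfl⟩ := Int.exists_eq_neg_ofNat (show k ≤ 0 by omega)
        rw [zpow_neg, zpow_neg, zpow_natCast, zpow_natCast]
        exact inv_anti₀ (pow_pos hα m) (pow_le_pow_left₀ hα.le hαβ m)
      have h6 := hscale (θ := δ) k hα (h3 _ (by omega))
      calc ‖q k‖ * ‖e k‖ ≤ ‖q k‖ * α ^ k := mul_le_mul_of_nonneg_left h5 (norm_nonneg _)
        _ ≤ δ * α ^ (n : ℤ) := h6
        _ ≤ δ * β ^ (n : ℤ) := by
            rw [zpow_natCast, zpow_natCast]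
            exact mul_le_mul_of_nonneg_left (pow_le_pow_left₀ hα.le hαβ n) hδ
    · have h5 : ‖e k‖ ≤ β ^ k := by
        refine (he k).trans (max_le ?_ le_rfl)
        exact zpow_le_zpow_left₀ (by omega) hα.le hαβ
      have h6 := hscale (θ := δ) k hβ (h2 _ (by omega))
      exact (mul_le_mul_of_nonneg_left h5 (norm_nonneg _)).trans h6

theorem exists_forall_le_of_tendsto {ι : Type*} [Nonempty ι] {u : ι → ℝ} (h0 : ∀ i, 0 ≤ u i)
    (h : Tendsto u cofinite (𝓝 0)) : ∃ i, ∀ j, u j ≤ u i := by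
  by_cases hz : ∃ i, 0 < u i
  · obtain ⟨i, hi⟩ := hz
    have hfin : {j | ¬ u j < u i}.Finite := (h.eventually (gt_mem_nhds hi))
    obtain ⟨m, hm, hmax⟩ := Set.exists_max_image _ u hfin ⟨i, by simp⟩
    refine ⟨m, fun j => ?_⟩
    by_cases hj : u j < u i
    · exact hj.le.trans (hmax i (by simp))
    · exact hmax j hj
  · push Not at hz
    exact ⟨Classical.arbitrary ι, fun j => (hz j).trans (h0 _)⟩

/-- Only finitely many indices reach a positive threshold, so the maximum is attained at a last
index M. The values beyond M attain a maximum too, which is strictly smaller; the quotient gives a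
uniform δ < 1. -/
theorem exists_dominant {u : ℤ → ℝ} (h0 : ∀ i, 0 ≤ u i) (h : Tendsto u cofinite (𝓝 0)) {j₀ : ℤ}
    (hj₀ : 0 < u j₀) : ∃ (M : ℤ) (δ : ℝ), 0 < δ ∧ δ < 1 ∧ 0 < u M ∧ (∀ j, u j ≤ u M) ∧
      ∀ j, M < j → u j ≤ δ * u M := by
  obtain ⟨i, hi⟩ := exists_forall_le_of_tendsto h0 h
  have hui : 0 < u i := hj₀.trans_le (hi j₀)
  have hfin : {j | ¬ u j < u i}.Finite := (h.eventually (gt_mem_nhds hui))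
  obtain ⟨M, hM, hmax⟩ := Set.exists_max_image _ id hfin ⟨i, by simp⟩
  have hMi : u M = u i := le_antisymm (hi M) (not_lt.1 hM)
  have hne : Nonempty (Set.Ioi M) := ⟨⟨M + 1, by simp⟩⟩
  obtain ⟨m, hm⟩ := exists_forall_le_of_tendsto (u := fun j : Set.Ioi M => u j) (fun j => h0 _)
    (h.comp Subtype.val_injective.tendsto_cofinite)
  have hlt : u m < u M := by
    by_contra hcon
    have h1 := hmax m.1 (by rw [Set.mem_ofPred_eq, ← hMi]; exact hcon)
    exact absurd m.2 (not_lt.2 h1)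
  -- The 1/2 only keeps δ positive when the sequence vanishes beyond M.
  refine ⟨M, max (1 / 2) (u m / u M), by positivity, max_lt (by norm_num) ?_, hMi ▸ hui,
    fun j => hMi ▸ hi j, fun j hj => ?_⟩
  · rwa [div_lt_one (hMi ▸ hui)]
  · calc u j ≤ u m := hm ⟨j, hj⟩
      _ = u m / u M * u M := by rw [div_mul_cancel₀ _ (hMi ▸ hui.ne')]
      _ ≤ _ := mul_le_mul_of_nonneg_right (le_max_right _ _) (h0 _)

theorem exists_le_of_tendsto_atBot {v : ℤ → ℝ} (h : Tendsto v cofinite (𝓝 0)) {ε : ℝ} (hε : 0 < ε)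
    (M : ℤ) : ∃ D : ℕ, ∀ j : ℤ, j ≤ M - D → v j ≤ ε := by
  have hfin : {j | ¬ v j < ε}.Finite := (h.eventually (gt_mem_nhds hε))
  obtain ⟨B, hB⟩ := hfin.bddBelow
  refine ⟨(M - B).toNat + 1, fun j hj => ?_⟩
  by_contra hcon
  have h1 : B ≤ j := hB (show ¬ v j < ε from fun h => hcon h.le)
  omega

/-- For n < 0 the substitution T ↦ T⁻¹ replaces the radii α ≤ β by β⁻¹ ≤ α⁻¹ and turns the first
dominant index on the inner circle into a last one, so that division applies again. One D and one δ
are taken to serve both directions. -/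
theorem exists_approx_int {X : Type*} [NormedAddCommGroup X] [NormedSpace ℚ_[p] X]
    [IsUltrametricDist X] {α β : ℝ} (hα : 0 < α) (hαβ : α ≤ β)
    {e : ℤ → X} (he : ∀ k, ‖e k‖ ≤ max (α ^ k) (β ^ k)) {W₀ : Submodule ℚ_[p] X} {c : ℤ → ℚ_[p]}
    {y : ℤ → X} (hy : ∀ n, y n ∈ W₀) (hsum : ∀ n, HasSum (fun j => c j • e (j + n)) (y n))
    (hcα : Tendsto (fun j => ‖c j‖ * α ^ j) cofinite (𝓝 0))
    (hcβ : Tendsto (fun j => ‖c j‖ * β ^ j) cofinite (𝓝 0)) (hc : c ≠ 0) :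
    ∃ (D : ℕ) (δ : ℝ), 0 < δ ∧ δ < 1 ∧ ∀ n : ℤ,
      ∃ w ∈ W₀ ⊔ Submodule.span ℚ_[p] (e '' Set.Icc (-D : ℤ) D),
        ‖e n - w‖ ≤ δ * max (α ^ n) (β ^ n) := by
  have hβ : 0 < β := hα.trans_le hαβ
  obtain ⟨j₀, hj₀⟩ := Function.ne_iff.1 hc
  have hpos : ∀ {r : ℝ}, 0 < r → ∀ j, 0 ≤ ‖c j‖ * r ^ j := fun hr j => by positivity
  have hj₀' : 0 < ‖c j₀‖ := norm_pos_iff.2 hj₀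
  obtain ⟨M, δ₁, hδ₁, hδ₁', hM, hM1, hM2⟩ := exists_dominant (hpos hβ) hcβ
    (j₀ := j₀) (by positivity)
  have hneg : ∀ (r : ℝ) (j : ℤ), ‖c (-j)‖ * (r⁻¹) ^ j = ‖c (-j)‖ * r ^ (-j) := by
    intro r j
    rw [inv_zpow, zpow_neg]
  have htneg : ∀ {r : ℝ}, Tendsto (fun j => ‖c j‖ * r ^ j) cofinite (𝓝 0) →
      Tendsto (fun j => ‖c (-j)‖ * (r⁻¹) ^ j) cofinite (𝓝 0) := by
    intro r hr
    simp_rw [hneg]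
    exact hr.comp neg_injective.tendsto_cofinite
  obtain ⟨m, δ₂, hδ₂, hδ₂', hm, hm1, hm2⟩ := exists_dominant
    (u := fun j => ‖c (-j)‖ * (α⁻¹) ^ j) (fun j => by positivity) (htneg hcα)
    (j₀ := -j₀) (by rw [neg_neg]; positivity)
  have hcM : c M ≠ 0 := by
    intro h
    rw [h, norm_zero, zero_mul] at hM
    exact lt_irrefl _ hM
  have hcm : c (-m) ≠ 0 := by
    intro h
    rw [h, norm_zero, zero_mul] at hm
    exact lt_irrefl _ hm
  have hcM' : 0 < ‖c M‖ := norm_pos_iff.2 hcM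
  have hcm' : 0 < ‖c (-m)‖ := norm_pos_iff.2 hcm
  set δ := max δ₁ δ₂ with hδdef
  have hδ : 0 < δ := lt_max_of_lt_left hδ₁
  obtain ⟨D₁, hD₁⟩ := exists_le_of_tendsto_atBot hcα (ε := δ * (‖c M‖ * α ^ M))
    (by positivity) M
  obtain ⟨D₂, hD₂⟩ := exists_le_of_tendsto_atBot (htneg hcβ)
    (ε := δ * (‖c (-m)‖ * (β⁻¹) ^ m)) (by positivity) m
  set D := max D₁ D₂ with hD
  set W := W₀ ⊔ Submodule.span ℚ_[p] (e '' Set.Icc (-D : ℤ) D) with hWdef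
  have hWe : ∀ k : ℤ, -D ≤ k → k ≤ D → e k ∈ W := fun k h1 h2 =>
    Submodule.mem_sup_right (Submodule.subset_span ⟨k, ⟨h1, h2⟩, rfl⟩)
  refine ⟨D, δ, hδ, max_lt hδ₁' hδ₂', fun n => ?_⟩
  rcases le_total 0 n with hn | hn
  · obtain ⟨k, rfl⟩ := Int.eq_ofNat_of_zero_le hn
    obtain ⟨w, hw, hle⟩ := exists_approx_nonneg hα hαβ hδ.le he (W := W)
      (fun n => Submodule.mem_sup_left (hy n)) hsum hcM hM1
      (fun j hj => (hM2 j hj).trans (mul_le_mul_of_nonneg_right (le_max_left _ _) hM.le))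
      (fun j hj => hD₁ j (by omega)) hWe k
    exact ⟨w, hw, hle.trans (mul_le_mul_of_nonneg_left (le_max_right _ _) hδ.le)⟩
  · obtain ⟨k, rfl⟩ := Int.exists_eq_neg_ofNat hn
    obtain ⟨w, hw, hle⟩ := exists_approx_nonneg (inv_pos.2 hβ) (inv_anti₀ hα hαβ) hδ.le
      (e := fun k => e (-k)) (fun k => by
        refine (he (-k)).trans ?_
        rw [inv_zpow, inv_zpow, ← zpow_neg, ← zpow_neg, max_comm])
      (W := W) (c := fun j => c (-j)) (y := fun n => y (-n))
      (fun n => Submodule.mem_sup_left (hy _)) (fun n => by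
        have h := hsum (-n)
        rw [← (Equiv.neg ℤ).hasSum_iff] at h
        refine h.congr_fun fun j => ?_
        simp only [Function.comp_apply, Equiv.neg_apply]
        rw [show -j + -n = -(j + n) by ring]) hcm hm1
      (fun j hj => (hm2 j hj).trans (mul_le_mul_of_nonneg_right (le_max_right _ _) hm.le))
      (fun j hj => hD₂ j (by omega)) (fun k h1 h2 => hWe (-k) (by omega) (by omega)) k
    refine ⟨w, hw, hle.trans (mul_le_mul_of_nonneg_left ?_ hδ.le)⟩
    rw [inv_zpow, ← zpow_neg]
    exact le_max_left _ _

/-- The image of `V` in E/J is finite-dimensional over a complete field, hence closed. Its preimage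
is a closed subspace containing the dense subspace J + V, so it is everything. -/
theorem finiteDimensional_quotient_of_dense {E : Type*} [NormedAddCommGroup E] [NormedSpace ℚ_[p] E]
    {J V : Submodule ℚ_[p] E} [FiniteDimensional ℚ_[p] V] (hJ : IsClosed (J : Set E))
    (hdense : (J ⊔ V).topologicalClosure = ⊤) : FiniteDimensional ℚ_[p] (E ⧸ J) := by
  have hmapfin : FiniteDimensional ℚ_[p] (V.map J.mkQ) := inferInstance
  have hmapclosed : IsClosed (V.map J.mkQ : Set (E ⧸ J)) :=
    Submodule.closed_of_finiteDimensional _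
  have hpre : IsClosed (((V.map J.mkQ).comap J.mkQ : Submodule ℚ_[p] E) : Set E) :=
    hmapclosed.preimage continuous_quotient_mk'
  have hWle : J ⊔ V ≤ (V.map J.mkQ).comap J.mkQ := by
    refine sup_le ?_ (Submodule.le_comap_map _ _)
    intro g hg
    rw [Submodule.mem_comap, Submodule.mkQ_apply, (Submodule.Quotient.mk_eq_zero J).2 hg]
    exact Submodule.zero_mem _
  have htop : (V.map J.mkQ).comap J.mkQ = ⊤ := by
    rw [eq_top_iff, ← hdense]
    exact (J ⊔ V).topologicalClosure_minimal hWle hpre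
  have hVtop : V.map J.mkQ = ⊤ := by
    rw [eq_top_iff]
    intro z _
    obtain ⟨g, rfl⟩ := J.mkQ_surjective z
    have : g ∈ (V.map J.mkQ).comap J.mkQ := htop ▸ Submodule.mem_top
    exact this
  rw [hVtop] at hmapfin
  exact Module.Finite.equiv Submodule.topEquiv

/-- Replacing each monomial of a Laurent polynomial close to g by its approximant in J + V gives
relative error at most δ < 1, because Cauchy's estimate bounds each weighted coefficient by the norm
of g. By Riesz's lemma a proper closed subspace cannot approximate all vectors that well, so J + V
is dense. -/
theorem finiteDimensional_quotient {a b : Rad p} (hab : ‖a.1‖ ≤ ‖b.1‖) {J : Ideal (AnnAlg a b)}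
    (hJ : IsClosed (J : Set (AnnAlg a b))) {f : AnnAlg a b} (hf : f ∈ J) (hf0 : f ≠ 0) :
    FiniteDimensional ℚ_[p] (AnnAlg a b ⧸ J) := by
  obtain ⟨c, hclim, hc⟩ := exists_expansion hab f
  have hcne : c ≠ 0 := by
    rintro rfl
    refine hf0 (hc.unique ?_)
    simp
  have hsum : ∀ n : ℤ, HasSum (fun j => c j • amon a b (j + n)) (f * amon a b n) := by
    intro n
    refine (hc.mul_right (amon a b n)).congr_fun fun j => ?_
    rw [smul_mul_assoc, amon_mul]
  have hcα : Tendsto (fun j => ‖c j‖ * ‖a.1‖ ^ j) cofinite (𝓝 0) :=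
    squeeze_zero (fun j => by positivity)
      (fun j => mul_le_mul_of_nonneg_left (le_max_left _ _) (norm_nonneg _)) hclim
  have hcβ : Tendsto (fun j => ‖c j‖ * ‖b.1‖ ^ j) cofinite (𝓝 0) :=
    squeeze_zero (fun j => by positivity)
      (fun j => mul_le_mul_of_nonneg_left (le_max_right _ _) (norm_nonneg _)) hclim
  obtain ⟨D, δ, hδ, hδ1, happ⟩ := exists_approx_int a.pos hab (e := amon a b)
    (norm_amon_le a b) (W₀ := J.restrictScalars ℚ_[p]) (fun n => J.mul_mem_right _ hf) hsum
    hcα hcβ hcne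
  set V := Submodule.span ℚ_[p] (amon a b '' Set.Icc (-D : ℤ) D) with hV
  set W := J.restrictScalars ℚ_[p] ⊔ V with hW
  have hstep : ∀ g : AnnAlg a b, ∃ w ∈ W, ‖g - w‖ ≤ δ * ‖g‖ := by
    intro g
    by_cases hg : g = 0
    · exact ⟨0, W.zero_mem, by simp [hg]⟩
    have hg' : 0 < ‖g‖ := norm_pos_iff.2 hg
    obtain ⟨d, hd⟩ := exists_lpoly_approx g (ε := δ * ‖g‖) (by positivity)
    choose w hwW hw using happ
    refine ⟨∑ n ∈ d.support, d n • w n, W.sum_mem fun n _ => W.smul_mem _ (hwW n), ?_⟩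
    have hdn : ‖lpoly a b d‖ ≤ ‖g‖ := by
      have : lpoly a b d = g - (g - lpoly a b d) := by ring
      rw [this]
      refine (norm_sub_le_max _ _).trans (max_le le_rfl (hd.le.trans ?_))
      nlinarith
    have h1 : g - ∑ n ∈ d.support, d n • w n
        = (g - lpoly a b d) + ∑ n ∈ d.support, d n • (amon a b n - w n) := by
      simp_rw [smul_sub]
      rw [Finset.sum_sub_distrib, lpoly_eq_sum d subset_rfl]
      abel
    rw [h1]
    refine (IsUltrametricDist.norm_add_le_max _ _).trans (max_le hd.le ?_)
    refine IsUltrametricDist.norm_sum_le_of_forall_le_of_nonneg (by positivity) fun n _ => ?_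
    rw [norm_smul]
    calc ‖d n‖ * ‖amon a b n - w n‖ ≤ ‖d n‖ * (δ * wt a b n) :=
          mul_le_mul_of_nonneg_left (hw n) (norm_nonneg _)
      _ = δ * (‖d n‖ * wt a b n) := by ring
      _ ≤ δ * ‖lpoly a b d‖ :=
          mul_le_mul_of_nonneg_left (coeff_le_of_hasSum hab (hasSum_lpoly d) n) hδ.le
      _ ≤ _ := mul_le_mul_of_nonneg_left hdn hδ.le
  have hdense : W.topologicalClosure = ⊤ := by
    by_contra hne
    have hx : ∃ x, x ∉ W.topologicalClosure := by
      by_contra hcon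
      push Not at hcon
      exact hne (eq_top_iff.2 fun x _ => hcon x)
    -- Any ratio strictly between δ and 1 gives the contradiction.
    obtain ⟨x, hxW, hx⟩ := riesz_lemma (𝕜 := ℚ_[p]) W.isClosed_topologicalClosure hx
      (r := (δ + 1) / 2) (by linarith)
    obtain ⟨w, hwW, hw⟩ := hstep x
    have h1 := hx w (W.le_topologicalClosure hwW)
    have h2 : 0 < ‖x‖ := norm_pos_iff.2 fun h => hxW (h ▸ Submodule.zero_mem _)
    nlinarith
  have hJ' : IsClosed ((J.restrictScalars ℚ_[p] : Submodule ℚ_[p] (AnnAlg a b)) :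
      Set (AnnAlg a b)) := hJ
  have hVfin : FiniteDimensional ℚ_[p] V :=
    FiniteDimensional.span_of_finite ℚ_[p] ((Set.finite_Icc _ _).image _)
  have := finiteDimensional_quotient_of_dense hJ' hdense
  exact Module.Finite.equiv (Submodule.Quotient.restrictScalarsEquiv ℚ_[p] J)

/-! ### Maximal ideals, zeros and units -/

section Quotients

variable {E F : Type*} [NormedAddCommGroup E] [NormedSpace ℚ_[p] E] [NormedAddCommGroup F]
  [NormedSpace ℚ_[p] F] {J : Submodule ℚ_[p] E}

theorem continuous_of_le_ker [FiniteDimensional ℚ_[p] (E ⧸ J)] (hJ : IsClosed (J : Set E))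
    (χ : E →ₗ[ℚ_[p]] F) (hχ : J ≤ LinearMap.ker χ) : Continuous χ := by
  have h : Continuous (J.liftQ χ hχ) := LinearMap.continuous_of_finiteDimensional _
  exact h.comp (continuous_quotient_mk' : Continuous (Submodule.Quotient.mk (p := J)))

theorem exists_sub_mem_of_dense [FiniteDimensional ℚ_[p] (E ⧸ J)] (hJ : IsClosed (J : Set E))
    {L : Submodule ℚ_[p] E} (hL : Dense (L : Set E)) (g : E) : ∃ l ∈ L, g - l ∈ J := by
  have hclosed : IsClosed (L.map J.mkQ : Set (E ⧸ J)) := Submodule.closed_of_finiteDimensional _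
  have hpre : IsClosed (((L.map J.mkQ).comap J.mkQ : Submodule ℚ_[p] E) : Set E) :=
    hclosed.preimage continuous_quotient_mk'
  have h1 : g ∈ (L.map J.mkQ).comap J.mkQ := by
    have h2 : closure (L : Set E) ⊆ ((L.map J.mkQ).comap J.mkQ : Submodule ℚ_[p] E) :=
      closure_minimal (Submodule.le_comap_map _ _) hpre
    exact h2 (hL g)
  obtain ⟨l, hl, hlg⟩ := h1
  exact ⟨l, hl, (Submodule.Quotient.eq J).1 hlg.symm⟩

end Quotients

theorem exists_algHom_of_isMaximal {B : Type*} [CommRing B] [Algebra ℚ_[p] B] {𝔪 : Ideal B}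
    (h𝔪 : 𝔪.IsMaximal) [FiniteDimensional ℚ_[p] (B ⧸ 𝔪)] :
    ∃ χ : B →ₐ[ℚ_[p]] ℂ_[p], ∀ g ∈ 𝔪, χ g = 0 := by
  let _ := Ideal.Quotient.field 𝔪
  let σ : (B ⧸ 𝔪) →ₐ[ℚ_[p]] ℂ_[p] := IsAlgClosed.lift
  refine ⟨σ.comp (Ideal.Quotient.mkₐ ℚ_[p] 𝔪), fun g hg => ?_⟩
  change σ (Ideal.Quotient.mk 𝔪 g) = 0
  rw [Ideal.Quotient.eq_zero_iff_mem.2 hg, map_zero]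

theorem exists_aeval_mem {B : Type*} [CommRing B] [Algebra ℚ_[p] B] (J : Ideal B)
    [FiniteDimensional ℚ_[p] (B ⧸ J)] (x : B) :
    ∃ P : Polynomial ℚ_[p], P ≠ 0 ∧ Polynomial.aeval x P ∈ J := by
  obtain ⟨P, hP0, hP⟩ := Algebra.IsAlgebraic.isAlgebraic (R := ℚ_[p]) (Ideal.Quotient.mk J x)
  refine ⟨P, hP0, ?_⟩
  rw [← Ideal.Quotient.eq_zero_iff_mem, ← hP]
  exact (Polynomial.aeval_algHom_apply (Ideal.Quotient.mkₐ ℚ_[p] J) _ P).symm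

theorem le_of_forall_pow_le {r s C : ℝ} (hs : 0 ≤ s)
    (h : ∀ n : ℕ, r ^ n ≤ C * s ^ n) : r ≤ s := by
  by_contra hcon
  push Not at hcon
  rcases hs.eq_or_lt with rfl | hs
  · have h2 := h 1
    simp only [pow_one, mul_zero] at h2
    linarith
  · have h1 : Tendsto (fun n : ℕ => (r / s) ^ n) atTop atTop :=
      tendsto_pow_atTop_atTop_of_one_lt ((one_lt_div hs).2 hcon)
    obtain ⟨n, hn⟩ := (h1.eventually (eventually_gt_atTop C)).exists
    rw [div_pow, lt_div_iff₀ (by positivity)] at hn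
    exact absurd (h n) (not_le.2 hn)

theorem amon_natCast (a b : Rad p) (n : ℕ) : amon a b n = amon a b 1 ^ n := by
  induction n with
  | zero => rw [Nat.cast_zero, amon_zero, pow_zero]
  | succ n ih => rw [pow_succ, ← ih, amon_mul, Nat.cast_succ]

theorem wt_one {a b : Rad p} (hab : ‖a.1‖ ≤ ‖b.1‖) : wt a b 1 = ‖b.1‖ := by
  rw [wt, zpow_one, zpow_one, max_eq_right hab]

theorem wt_neg_one {a b : Rad p} (hab : ‖a.1‖ ≤ ‖b.1‖) : wt a b (-1) = ‖a.1‖⁻¹ := by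
  rw [wt, zpow_neg_one, zpow_neg_one, max_eq_left (inv_anti₀ a.pos hab)]

/-- Every character of the algebra of an annulus is the evaluation at a point. -/
theorem exists_eq_ev {a b : Rad p} (hab : ‖a.1‖ ≤ ‖b.1‖) (χ : AnnAlg a b →ₐ[ℚ_[p]] ℂ_[p])
    (hχ : Continuous χ) : ∃ x : Annulus a b, χ = ev x := by
  obtain ⟨C, hC⟩ : ∃ C, ∀ g, ‖χ g‖ ≤ C * ‖g‖ :=
    ⟨_, (⟨χ.toLinearMap, hχ⟩ : AnnAlg a b →L[ℚ_[p]] ℂ_[p]).le_opNorm⟩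
  -- The constant of continuity is removed by applying the bound to powers of g. Being
  -- norm-decreasing on T and T⁻¹ forces χ(T) into the annulus, and χ is then determined by χ(T) on
  -- the dense Laurent polynomials.
  have hle : ∀ g, ‖χ g‖ ≤ ‖g‖ := by
    intro g
    refine le_of_forall_pow_le (C := max C 1) (norm_nonneg _) fun n => ?_
    rcases Nat.eq_zero_or_pos n with rfl | hn
    · simp
    rw [← norm_pow, ← map_pow]
    calc ‖χ (g ^ n)‖ ≤ C * ‖g ^ n‖ := hC _
      _ ≤ max C 1 * ‖g ^ n‖ := mul_le_mul_of_nonneg_right (le_max_left _ _) (norm_nonneg _)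
      _ ≤ _ := mul_le_mul_of_nonneg_left (norm_pow_le' g hn) (by positivity)
  set x := χ (amon a b 1) with hx
  have hinv : χ (amon a b (-1)) * x = 1 := by
    rw [hx, ← map_mul, amon_mul, neg_add_cancel, amon_zero, map_one]
  have hx0 : x ≠ 0 := right_ne_zero_of_mul_eq_one hinv
  have h1 : ‖x‖ ≤ ‖b.1‖ := (hle _).trans ((norm_amon_le a b 1).trans (wt_one hab).le)
  have h2 : ‖a.1‖ ≤ ‖x‖ := by
    have h3 := (hle _).trans ((norm_amon_le a b (-1)).trans (wt_neg_one hab).le)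
    rw [eq_inv_of_mul_eq_one_left hinv, norm_inv] at h3
    exact (inv_le_inv₀ (norm_pos_iff.2 hx0) a.pos).1 h3
  refine ⟨⟨x, h2, h1⟩, ?_⟩
  have hmon : ∀ n : ℤ, χ (amon a b n) = x ^ n := by
    have hnat : ∀ n : ℕ, χ (amon a b n) = x ^ n := fun n => by rw [amon_natCast, map_pow]
    intro n
    rcases le_total 0 n with hn | hn
    · obtain ⟨k, rfl⟩ := Int.eq_ofNat_of_zero_le hn
      rw [hnat, zpow_natCast]
    · obtain ⟨k, rfl⟩ := Int.exists_eq_neg_ofNat hn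
      rw [zpow_neg, zpow_natCast, ← hnat]
      refine eq_inv_of_mul_eq_one_left ?_
      rw [← map_mul, amon_mul, neg_add_cancel, amon_zero, map_one]
  have h3 := (denseRange_lpoly a b).equalizer hχ (continuous_ev ⟨x, h2, h1⟩) (by
    funext c
    simp only [Function.comp_apply, lpoly_eq_sum c subset_rfl, map_sum, map_smul, hmon, ev_amon])
  exact AlgHom.ext fun g => congrFun h3 g

/-- A maximal ideal of a Banach algebra is closed; containing f ≠ 0 it has finite codimension. Its
residue field embeds into the algebraically closed ℂ_p, and the resulting character is continuous,
hence an evaluation. -/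
theorem exists_zero_of_isMaximal {a b : Rad p} (hab : ‖a.1‖ ≤ ‖b.1‖) {𝔪 : Ideal (AnnAlg a b)}
    (h𝔪 : 𝔪.IsMaximal) {f : AnnAlg a b} (hf : f ∈ 𝔪) (hf0 : f ≠ 0) :
    ∃ x : Annulus a b, ∀ g ∈ 𝔪, ev x g = 0 := by
  have hclosed : IsClosed (𝔪 : Set (AnnAlg a b)) := Ideal.IsMaximal.isClosed
  have hfd := finiteDimensional_quotient hab hclosed hf hf0
  obtain ⟨χ, hker⟩ := exists_algHom_of_isMaximal (p := p) h𝔪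
  have hfd' : FiniteDimensional ℚ_[p] (AnnAlg a b ⧸ 𝔪.restrictScalars ℚ_[p]) :=
    Module.Finite.equiv (Submodule.Quotient.restrictScalarsEquiv ℚ_[p] 𝔪).symm
  have hcont : Continuous χ := continuous_of_le_ker (J := 𝔪.restrictScalars ℚ_[p]) hclosed
    χ.toLinearMap hker
  obtain ⟨x, hx⟩ := exists_eq_ev hab χ hcont
  exact ⟨x, fun g hg => by rw [← hx]; exact hker g hg⟩

/-- Functions without common zero generate the unit ideal. -/
theorem span_eq_top_of_forall_exists_ne_zero {a b : Rad p} (hab : ‖a.1‖ ≤ ‖b.1‖) {ι : Type*}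
    {F : ι → AnnAlg a b} (h : ∀ x, ∃ i, ev x (F i) ≠ 0) : Ideal.span (Set.range F) = ⊤ := by
  by_contra hne
  obtain ⟨𝔪, h𝔪, hle⟩ := Ideal.exists_le_maximal _ hne
  obtain ⟨i, hi⟩ := h ⟨a.1, le_rfl, hab⟩
  have hmem : ∀ j, F j ∈ 𝔪 := fun j => hle (Ideal.subset_span ⟨j, rfl⟩)
  obtain ⟨x, hx⟩ := exists_zero_of_isMaximal hab h𝔪 (hmem i) (by
    intro h0
    rw [h0, map_zero] at hi
    exact hi rfl)
  obtain ⟨j, hj⟩ := h x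
  exact hj (hx _ (hmem j))

theorem isUnit_of_forall_ne_zero {a b : Rad p} (hab : ‖a.1‖ ≤ ‖b.1‖) {f : AnnAlg a b}
    (h : ∀ x, ev x f ≠ 0) : IsUnit f := by
  have := span_eq_top_of_forall_exists_ne_zero hab (F := fun _ : Unit => f) fun x => ⟨(), h x⟩
  rwa [Set.range_const, Ideal.span_singleton_eq_top] at this

theorem closure_le_ker_ev {a b : Rad p} {f : AnnAlg a b} {x : Annulus a b} (hx : ev x f = 0)
    {g : AnnAlg a b} (hg : g ∈ (Ideal.span {f}).closure) : ev x g = 0 := by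
  have hclosed : IsClosed {g : AnnAlg a b | ev x g = 0} :=
    isClosed_eq (continuous_ev x) continuous_const
  refine closure_minimal ?_ hclosed hg
  intro g hg
  obtain ⟨q, rfl⟩ := Ideal.mem_span_singleton'.1 hg
  rw [Set.mem_ofPred_eq, map_mul, hx, mul_zero]

/-- A nonzero analytic function has finitely many zeros. -/
theorem finite_zeros {a b : Rad p} (hab : ‖a.1‖ ≤ ‖b.1‖) {f : AnnAlg a b} (hf : f ≠ 0) :
    {x : Annulus a b | ev x f = 0}.Finite := by
  -- The closure has finite codimension, so some nonzero polynomial P(T) lies in it. Evaluation at a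
  -- zero of f is continuous and kills the closure, so every zero of f is a root of P.
  set J := (Ideal.span {f}).closure with hJ
  have hfJ : f ∈ J := subset_closure (Ideal.mem_span_singleton_self f)
  have hfd := finiteDimensional_quotient hab (J := J) isClosed_closure hfJ hf
  obtain ⟨P, hP0, hPJ⟩ := exists_aeval_mem (p := p) J (amon a b 1)
  classical
  refine ((P.aroots ℂ_[p]).toFinset.finite_toSet.preimage
    (f := (Subtype.val : Annulus a b → ℂ_[p])) Subtype.val_injective.injOn).subset ?_
  intro x hx
  have h1 := closure_le_ker_ev hx hPJ
  rw [← Polynomial.aeval_algHom_apply, ev_amon, zpow_one] at h1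
  simp only [Set.mem_preimage, Finset.mem_coe, Multiset.mem_toFinset]
  exact (Polynomial.mem_aroots).2 ⟨hP0, h1⟩

/-- A function without zeros on a circle is bounded below there. -/
theorem exists_lower_bound {a : Rad p} {f : AnnAlg a a} (h : ∀ x, ev x f ≠ 0) :
    ∃ c > 0, ∀ x, c ≤ ‖ev x f‖ := by
  obtain ⟨g, hg⟩ := (isUnit_of_forall_ne_zero le_rfl h).exists_right_inv
  have h1 : ∀ x, ‖ev x f‖ * ‖ev x g‖ = 1 := fun x => by
    rw [← norm_mul, ← map_mul, hg, map_one, norm_one]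
  have h0 : 0 < ‖g‖ := by
    rw [norm_pos_iff]
    rintro rfl
    have := h1 ⟨a.1, le_rfl, le_rfl⟩
    rw [map_zero, norm_zero, mul_zero] at this
    exact zero_ne_one this
  refine ⟨‖g‖⁻¹, inv_pos.2 h0, fun x => ?_⟩
  refine (inv_le_iff_one_le_mul₀ h0).2 ((h1 x).symm.le.trans ?_)
  exact mul_le_mul_of_nonneg_left (norm_ev_le x g) (norm_nonneg _)

/-- Restriction to a smaller annulus. -/
def bcfRestrict {a b a' b' : Rad p} (h1 : ‖a.1‖ ≤ ‖a'.1‖) (h2 : ‖b'.1‖ ≤ ‖b.1‖)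
    (f : Annulus a b →ᵇ ℂ_[p]) : Annulus a' b' →ᵇ ℂ_[p] :=
  f.compContinuous ⟨fun x => ⟨x.1, h1.trans x.2.1, x.2.2.trans h2⟩, by fun_prop⟩

theorem bcfRestrict_mem {a b a' b' : Rad p} (h1 : ‖a.1‖ ≤ ‖a'.1‖) (h2 : ‖b'.1‖ ≤ ‖b.1‖)
    (f : AnnAlg a b) : bcfRestrict h1 h2 f.1 ∈ AnnAlg a' b' := by
  refine Metric.mem_closure_iff.2 fun ε hε => ?_
  obtain ⟨c, hc⟩ := exists_lpoly_approx f (half_pos hε)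
  refine ⟨(lpoly a' b' c).1, ?_, ?_⟩
  · rw [lpoly_eq_sum c subset_rfl, AddSubmonoidClass.coe_finsetSum]
    exact Subalgebra.sum_mem _ fun n _ =>
      Subalgebra.smul_mem _ (mon_mem_laurentPoly a' b' n) _
  · rw [dist_eq_norm]
    refine lt_of_le_of_lt ((BoundedContinuousFunction.norm_le (half_pos hε).le).2 fun x => ?_)
      (half_lt_self hε)
    have h3 := (norm_ev_le (⟨x.1, h1.trans x.2.1, x.2.2.trans h2⟩ : Annulus a b) _).trans hc.le
    rw [lpoly_eq_sum c subset_rfl, map_sub, map_sum] at h3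
    rw [lpoly_eq_sum c subset_rfl]
    have h4 : (↑(∑ n ∈ c.support, c n • amon a' b' n) : Annulus a' b' →ᵇ ℂ_[p]) x
        = ∑ n ∈ c.support, c n • x.1 ^ n := by
      change ev x _ = _
      rw [map_sum]
      simp
    rw [BoundedContinuousFunction.sub_apply, h4]
    simp only [map_smul, ev_amon] at h3
    exact h3

/-- Restriction to a smaller annulus. -/
def res {a b a' b' : Rad p} (h1 : ‖a.1‖ ≤ ‖a'.1‖) (h2 : ‖b'.1‖ ≤ ‖b.1‖) :
    AnnAlg a b →ₐ[ℚ_[p]] AnnAlg a' b' where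
  toFun f := ⟨bcfRestrict h1 h2 f.1, bcfRestrict_mem h1 h2 f⟩
  map_one' := rfl
  map_mul' _ _ := rfl
  map_zero' := rfl
  map_add' _ _ := rfl
  commutes' c := by
    rw [Algebra.algebraMap_eq_smul_one, Algebra.algebraMap_eq_smul_one]
    rfl

theorem ev_res {a b a' b' : Rad p} (h1 : ‖a.1‖ ≤ ‖a'.1‖) (h2 : ‖b'.1‖ ≤ ‖b.1‖) (f : AnnAlg a b)
    (x : Annulus a' b') :
    ev x (res h1 h2 f) = ev ⟨x.1, h1.trans x.2.1, x.2.2.trans h2⟩ f := rfl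

theorem res_amon {a b a' b' : Rad p} (h1 : ‖a.1‖ ≤ ‖a'.1‖) (h2 : ‖b'.1‖ ≤ ‖b.1‖) (n : ℤ) :
    res h1 h2 (amon a b n) = amon a' b' n := rfl

theorem norm_res_le {a b a' b' : Rad p} (h1 : ‖a.1‖ ≤ ‖a'.1‖) (h2 : ‖b'.1‖ ≤ ‖b.1‖)
    (f : AnnAlg a b) : ‖res h1 h2 f‖ ≤ ‖f‖ :=
  (norm_le_iff (norm_nonneg _)).2 fun _ => norm_ev_le _ f

theorem res_lpoly {a b a' b' : Rad p} (h1 : ‖a.1‖ ≤ ‖a'.1‖) (h2 : ‖b'.1‖ ≤ ‖b.1‖)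
    (c : ℤ →₀ ℚ_[p]) : res h1 h2 (lpoly a b c) = lpoly a' b' c := by
  rw [lpoly_eq_sum c subset_rfl, lpoly_eq_sum c subset_rfl, map_sum]
  simp only [map_smul, res_amon]

/-- Multiplication by a function without zeros on the boundary circles is bounded below. -/
theorem exists_norm_mul_ge {a b : Rad p} (hab : ‖a.1‖ ≤ ‖b.1‖) {f : AnnAlg a b}
    (h : ∀ x : Annulus a b, ‖x.1‖ = ‖a.1‖ ∨ ‖x.1‖ = ‖b.1‖ → ev x f ≠ 0) :
    ∃ c > 0, ∀ g, c * ‖g‖ ≤ ‖f * g‖ := by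
  obtain ⟨c₁, hc₁, h₁⟩ := exists_lower_bound (f := res (a' := a) (b' := a) le_rfl hab f)
    fun x => h _ (Or.inl (le_antisymm x.2.2 x.2.1))
  obtain ⟨c₂, hc₂, h₂⟩ := exists_lower_bound (f := res (a' := b) (b' := b) hab le_rfl f)
    fun x => h _ (Or.inr (le_antisymm x.2.2 x.2.1))
  refine ⟨min c₁ c₂, lt_min hc₁ hc₂, fun g => ?_⟩
  have hm : 0 < min c₁ c₂ := lt_min hc₁ hc₂
  rw [← le_div_iff₀' hm]
  refine norm_le_of_circles hab (by positivity) fun x hx => ?_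
  rw [le_div_iff₀' hm]
  refine le_trans ?_ (norm_ev_le x (f * g))
  rw [map_mul, norm_mul]
  refine mul_le_mul_of_nonneg_right ?_ (norm_nonneg _)
  rcases hx with hx | hx
  · exact (min_le_left _ _).trans (h₁ ⟨x.1, hx.ge, hx.le⟩)
  · exact (min_le_right _ _).trans (h₂ ⟨x.1, hx.ge, hx.le⟩)

/-- Multiplication by f is antilipschitz on a complete space, so its range is closed. -/
theorem isClosed_span_singleton {a b : Rad p} {f : AnnAlg a b} {c : ℝ} (hc : 0 < c)
    (h : ∀ g, c * ‖g‖ ≤ ‖f * g‖) : IsClosed (Ideal.span {f} : Set (AnnAlg a b)) := by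
  have h1 : AntilipschitzWith ⟨c⁻¹, (inv_pos.2 hc).le⟩ (fun g => f * g) := by
    refine AntilipschitzWith.of_le_mul_dist fun g g' => ?_
    rw [dist_eq_norm, dist_eq_norm, ← mul_sub]
    change _ ≤ c⁻¹ * _
    rw [← div_eq_inv_mul, le_div_iff₀' hc]
    exact h _
  have h2 := h1.isClosed_range (by
    refine (LipschitzWith.of_dist_le_mul (K := ‖f‖₊) fun g g' => ?_).uniformContinuous
    rw [dist_eq_norm, dist_eq_norm, ← mul_sub]
    exact norm_mul_le f (g - g'))
  have h3 : (Ideal.span {f} : Set (AnnAlg a b)) = Set.range fun g => f * g := by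
    ext g
    rw [SetLike.mem_coe, Ideal.mem_span_singleton, Set.mem_range]
    exact ⟨fun ⟨q, hq⟩ => ⟨q, hq.symm⟩, fun ⟨q, hq⟩ => ⟨q, hq.symm⟩⟩
  rw [h3]
  exact h2

/-- The Laurent polynomials are dense, so they surject onto the finite-dimensional quotient by J. -/
theorem exists_lpoly_sub_mem {a b : Rad p} (hab : ‖a.1‖ ≤ ‖b.1‖) {J : Ideal (AnnAlg a b)}
    (hJ : IsClosed (J : Set (AnnAlg a b))) {f : AnnAlg a b} (hf : f ∈ J) (hf0 : f ≠ 0)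
    (g : AnnAlg a b) : ∃ c, g - lpoly a b c ∈ J := by
  have hfd := finiteDimensional_quotient hab hJ hf hf0
  have hfd' : FiniteDimensional ℚ_[p] (AnnAlg a b ⧸ J.restrictScalars ℚ_[p]) :=
    Module.Finite.equiv (Submodule.Quotient.restrictScalarsEquiv ℚ_[p] J).symm
  obtain ⟨_, ⟨c, rfl⟩, hl⟩ := exists_sub_mem_of_dense (J := J.restrictScalars ℚ_[p]) hJ
    (L := LinearMap.range (lpoly a b)) (denseRange_lpoly a b) g
  exact ⟨c, hl⟩

/-! ### The logarithm -/

theorem norm_p : ‖(p : ℂ_[p])‖ = (p : ℝ)⁻¹ := by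
  rw [norm_natCast_eq, Padic.norm_p]

theorem norm_inv_natCast_le (n : ℕ) : ‖((n : ℂ_[p]))⁻¹‖ ≤ n := by
  rcases Nat.eq_zero_or_pos n with rfl | hn
  · simp
  · have hn' : (n : ℚ_[p]) ≠ 0 := by exact_mod_cast hn.ne'
    rw [norm_inv, norm_natCast_eq, Padic.norm_eq_zpow_neg_valuation hn', Padic.valuation_natCast,
      zpow_neg, inv_inv, zpow_natCast]
    exact_mod_cast Nat.le_of_dvd hn pow_padicValNat_dvd

/-- The terms of the logarithmic series. -/
def logTerm (x : ℂ_[p]) (n : ℕ) : ℂ_[p] := (-1) ^ n * (((n + 1 : ℕ) : ℂ_[p])⁻¹ * x ^ (n + 1))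

theorem norm_inv_mul_pow_le (x : ℂ_[p]) (n : ℕ) :
    ‖((n + 1 : ℕ) : ℂ_[p])⁻¹ * x ^ (n + 1)‖ ≤ ((n + 1 : ℕ) : ℝ) * ‖x‖ ^ (n + 1) := by
  rw [norm_mul, norm_pow]
  exact mul_le_mul_of_nonneg_right (norm_inv_natCast_le _) (by positivity)

theorem norm_logTerm_le (x : ℂ_[p]) (n : ℕ) :
    ‖logTerm x n‖ ≤ ((n + 1 : ℕ) : ℝ) * ‖x‖ ^ (n + 1) := by
  rw [logTerm, norm_mul, norm_pow, norm_neg, norm_one, one_pow, one_mul]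
  exact norm_inv_mul_pow_le x n

theorem summable_bound {r : ℝ} (h0 : 0 ≤ r) (h1 : r < 1) :
    Summable fun n : ℕ => ((n + 1 : ℕ) : ℝ) * r ^ (n + 1) := by
  have h := summable_pow_mul_geometric_of_norm_lt_one 1 (r := r)
    (by rwa [Real.norm_of_nonneg h0])
  have h2 := (summable_nat_add_iff 1).2 h
  refine h2.congr fun n => ?_
  rw [pow_one]

theorem summable_logTerm {x : ℂ_[p]} (hx : ‖x‖ < 1) : Summable (logTerm x) :=
  Summable.of_norm_bounded (summable_bound (norm_nonneg x) hx) (norm_logTerm_le x)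

theorem logFun_eq (x : ℂ_[p]) : logFun p x = ∑' n : ℕ, logTerm x n := by
  have hinj : Function.Injective (fun n : ℕ => (n : ℤ) + 1) := fun m n h => by
    have : (m : ℤ) + 1 = n + 1 := h
    omega
  rw [logFun, ← hinj.tsum_eq]
  · refine tsum_congr fun n => ?_
    have hn : (0 : ℤ) < (n : ℤ) + 1 := by omega
    rw [logCoeff, if_pos hn, logTerm, Algebra.smul_def, map_div₀, add_sub_cancel_right,
      zpow_natCast, map_pow, map_neg, map_one]
    push_cast
    rw [div_eq_mul_inv, mul_assoc]
    norm_cast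
  · intro n hn
    by_contra hcon
    have : ¬ 0 < n := fun h => hcon ⟨(n - 1).toNat, by
      change (((n - 1).toNat : ℕ) : ℤ) + 1 = n
      omega⟩
    rw [Function.mem_support, logCoeff, if_neg this, zero_smul] at hn
    exact hn rfl

theorem hasSum_logTerm {x : ℂ_[p]} (hx : ‖x‖ < 1) : HasSum (logTerm x) (logFun p x) := by
  rw [logFun_eq]
  exact (summable_logTerm hx).hasSum

theorem norm_choose_pow_le (m k : ℕ) :
    ‖(((p ^ m).choose (k + 1) : ℕ) : ℂ_[p])‖ ≤ ‖(p : ℂ_[p])‖ ^ m * ((k + 1 : ℕ) : ℝ) := by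
  have hpos : 0 < p ^ m := pow_pos (Fact.out : p.Prime).pos m
  have h := Nat.add_one_mul_choose_eq (p ^ m - 1) k
  rw [Nat.sub_add_cancel hpos] at h
  have hk : ((k + 1 : ℕ) : ℂ_[p]) ≠ 0 := by exact_mod_cast Nat.succ_ne_zero k
  have h2 : (((p ^ m).choose (k + 1) : ℕ) : ℂ_[p])
      = (p : ℂ_[p]) ^ m * (((p ^ m - 1).choose k : ℕ) : ℂ_[p]) * ((k + 1 : ℕ) : ℂ_[p])⁻¹ := by
    rw [eq_mul_inv_iff_mul_eq₀ hk, ← Nat.cast_mul, ← h]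
    push_cast
    rfl
  rw [h2, norm_mul, norm_mul, norm_pow]
  refine mul_le_mul ?_ (norm_inv_natCast_le _) (norm_nonneg _) (by positivity)
  exact mul_le_of_le_one_right (by positivity) (norm_natCast_le_one _)

theorem tendsto_norm_p_pow : Tendsto (fun m : ℕ => ‖(p : ℂ_[p])‖ ^ m) atTop (𝓝 0) :=
  tendsto_pow_atTop_nhds_zero_of_lt_one (norm_nonneg _) norm_p_lt_one

/-- By Pascal's rule, since binom(p^m, k + 1) tends to 0 p-adically. -/
theorem tendsto_choose_sub_one (k : ℕ) :
    Tendsto (fun m : ℕ => (((p ^ m - 1).choose k : ℕ) : ℂ_[p])) atTop (𝓝 ((-1) ^ k)) := by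
  induction k with
  | zero => simp
  | succ k ih =>
    have h0 : Tendsto (fun m : ℕ => (((p ^ m).choose (k + 1) : ℕ) : ℂ_[p])) atTop (𝓝 0) := by
      refine squeeze_zero_norm (fun m => norm_choose_pow_le m k) ?_
      simpa using tendsto_norm_p_pow.mul_const ((k + 1 : ℕ) : ℝ)
    have h1 := h0.sub ih
    rw [zero_sub, ← neg_one_mul, ← pow_succ'] at h1
    refine h1.congr fun m => ?_
    have hpos : 0 < p ^ m := pow_pos (Fact.out : p.Prime).pos m
    obtain ⟨N, hN⟩ : ∃ N, p ^ m = N + 1 := ⟨p ^ m - 1, by omega⟩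
    rw [hN, Nat.choose_succ_succ, Nat.add_sub_cancel]
    push_cast
    ring

theorem pow_sub_one_div_eq (x : ℂ_[p]) (m : ℕ) :
    ((1 + x) ^ (p ^ m) - 1) / (p : ℂ_[p]) ^ m = ∑' k : ℕ, (((p ^ m - 1).choose k : ℕ) : ℂ_[p]) *
      (((k + 1 : ℕ) : ℂ_[p])⁻¹ * x ^ (k + 1)) := by
  have hp0 : (p : ℂ_[p]) ≠ 0 := by exact_mod_cast (Fact.out : p.Prime).ne_zero
  have hpos : 0 < p ^ m := pow_pos (Fact.out : p.Prime).pos m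
  rw [tsum_eq_sum (s := Finset.range (p ^ m))]
  · rw [add_comm, add_pow, Finset.sum_range_succ', div_eq_iff (pow_ne_zero _ hp0), Finset.sum_mul]
    simp only [one_pow, mul_one, pow_zero, Nat.choose_zero_right, Nat.cast_one, add_sub_cancel_right]
    refine Finset.sum_congr rfl fun k _ => ?_
    have hk : ((k + 1 : ℕ) : ℂ_[p]) ≠ 0 := by exact_mod_cast Nat.succ_ne_zero k
    have h := Nat.add_one_mul_choose_eq (p ^ m - 1) k
    rw [Nat.sub_add_cancel hpos] at h
    have h' : (p : ℂ_[p]) ^ m * (((p ^ m - 1).choose k : ℕ) : ℂ_[p])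
        = (((p ^ m).choose (k + 1) : ℕ) : ℂ_[p]) * ((k + 1 : ℕ) : ℂ_[p]) := by
      exact_mod_cast h
    field_simp
    rw [mul_comm, ← mul_assoc, mul_comm _ ((p : ℂ_[p]) ^ m)] at *
    linear_combination (-x ^ (k + 1)) * h'
  · intro k hk
    rw [Finset.mem_range, not_lt] at hk
    rw [Nat.choose_eq_zero_of_lt (by omega), Nat.cast_zero, zero_mul]

/-- The (k + 1)-st coefficient of ((1 + x)^(p^m) - 1) / p^m is binom(p^m - 1, k) / (k + 1), which
tends to (-1)^k / (k + 1); dominated convergence does the rest. This formula makes the functional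
equations of the logarithm immediate. -/
theorem tendsto_log {x : ℂ_[p]} (hx : ‖x‖ < 1) :
    Tendsto (fun m : ℕ => ((1 + x) ^ (p ^ m) - 1) / (p : ℂ_[p]) ^ m) atTop (𝓝 (logFun p x)) := by
  simp_rw [pow_sub_one_div_eq, logFun_eq]
  refine tendsto_tsum_of_dominated_convergence (summable_bound (norm_nonneg x) hx)
    (fun k => (tendsto_choose_sub_one k).mul_const _) (Eventually.of_forall fun m k => ?_)
  rw [norm_mul]
  exact (mul_le_of_le_one_left (norm_nonneg _) (norm_natCast_le_one _)).trans
    (norm_inv_mul_pow_le x k)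

theorem tendsto_pow_p_pow {x : ℂ_[p]} (hx : ‖x‖ < 1) :
    Tendsto (fun m : ℕ => (1 + x) ^ (p ^ m) - 1) atTop (𝓝 0) := by
  have hp0 : (p : ℂ_[p]) ≠ 0 := by exact_mod_cast (Fact.out : p.Prime).ne_zero
  have h1 : Tendsto (fun m : ℕ => (p : ℂ_[p]) ^ m) atTop (𝓝 0) :=
    tendsto_zero_iff_norm_tendsto_zero.2 (by simpa only [norm_pow] using tendsto_norm_p_pow)
  have h2 := (tendsto_log hx).mul h1
  rw [mul_zero] at h2
  exact h2.congr fun m => div_mul_cancel₀ _ (pow_ne_zero _ hp0)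

/-- In the limit formula, ab - 1 = (a - 1) + a(b - 1) with a = (1 + x)^(p^m) tending to 1. -/
theorem log_mul {x y z : ℂ_[p]} (hx : ‖x‖ < 1) (hy : ‖y‖ < 1) (hz : ‖z‖ < 1)
    (h : (1 + x) * (1 + y) = 1 + z) : logFun p z = logFun p x + logFun p y := by
  have h1 : Tendsto (fun m : ℕ => (1 + x) ^ (p ^ m)) atTop (𝓝 1) := by
    simpa using (tendsto_pow_p_pow hx).add_const 1
  have h2 := (tendsto_log hx).add (h1.mul (tendsto_log hy))
  rw [one_mul] at h2
  refine tendsto_nhds_unique (tendsto_log hz) (h2.congr fun m => ?_)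
  rw [← h, mul_pow]
  ring

theorem logFun_zero : logFun p 0 = 0 := by
  rw [logFun_eq]
  simp [logTerm]

theorem norm_pow_sub_one_le {x : ℂ_[p]} (hx : ‖x‖ < 1) (n : ℕ) : ‖(1 + x) ^ n - 1‖ ≤ ‖x‖ := by
  have h1 : ‖1 + x‖ = 1 := by rw [norm_add_eq_left (by rwa [norm_one]), norm_one]
  have h2 : (1 + x) ^ n - 1 = (∑ i ∈ Finset.range n, (1 + x) ^ i) * x := by
    rw [← geom_sum_mul]
    ring
  rw [h2, norm_mul]
  refine mul_le_of_le_one_left (norm_nonneg _) ?_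
  refine IsUltrametricDist.norm_sum_le_of_forall_le_of_nonneg zero_le_one fun i _ => ?_
  rw [norm_pow, h1, one_pow]

theorem log_pow {x : ℂ_[p]} (hx : ‖x‖ < 1) (n : ℕ) :
    logFun p ((1 + x) ^ n - 1) = n * logFun p x := by
  induction n with
  | zero => simp [logFun_zero]
  | succ n ih =>
    have hn : ∀ n, ‖(1 + x) ^ n - 1‖ < 1 := fun n => (norm_pow_sub_one_le hx n).trans_lt hx
    rw [log_mul (hn n) hx (hn (n + 1)) (by ring), ih]
    push_cast
    ring

/-- The denominator of the term of degree n + 2 costs at most a factor n + 2, and (n + 2) 2^{-n} ≤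
2. The estimate shows that 0 is the only zero of the logarithm in the disc of radius 1/2. -/
theorem norm_log_sub_le {y : ℂ_[p]} (hy : ‖y‖ ≤ 1 / 2) : ‖logFun p y - y‖ ≤ 2 * ‖y‖ * ‖y‖ := by
  have hy1 : ‖y‖ < 1 := hy.trans_lt (by norm_num)
  have h1 := (hasSum_nat_add_iff' 1).2 (hasSum_logTerm hy1)
  have h2 : ∑ i ∈ Finset.range 1, logTerm y i = y := by simp [logTerm]
  rw [h2] at h1
  rw [← h1.tsum_eq]
  refine IsUltrametricDist.norm_tsum_le_of_forall_le_of_nonneg (by positivity) fun n => ?_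
  refine (norm_logTerm_le y (n + 1)).trans ?_
  have h3 : (((n + 1 + 1 : ℕ)) : ℝ) * ‖y‖ ^ n ≤ 2 := by
    have h4 : ‖y‖ ^ n ≤ (1 / 2) ^ n := pow_le_pow_left₀ (norm_nonneg _) hy n
    have h5 : ((n + 1 + 1 : ℕ) : ℝ) ≤ 2 * 2 ^ n := by
      have : n + 1 ≤ 2 ^ n := Nat.lt_two_pow_self
      have h6 : n + 1 + 1 ≤ 2 * 2 ^ n := by omega
      exact_mod_cast h6
    calc (((n + 1 + 1 : ℕ)) : ℝ) * ‖y‖ ^ n ≤ (2 * 2 ^ n) * (1 / 2) ^ n :=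
          mul_le_mul h5 h4 (by positivity) (by positivity)
      _ = 2 := by rw [mul_assoc, ← mul_pow]; norm_num
  calc ((n + 1 + 1 : ℕ) : ℝ) * ‖y‖ ^ (n + 1 + 1)
      = (((n + 1 + 1 : ℕ)) : ℝ) * ‖y‖ ^ n * (‖y‖ * ‖y‖) := by ring
    _ ≤ 2 * (‖y‖ * ‖y‖) := mul_le_mul_of_nonneg_right h3 (by positivity)
    _ = _ := by ring

theorem eq_zero_of_log_eq_zero {y : ℂ_[p]} (hy : ‖y‖ < 1 / 2) (h : logFun p y = 0) : y = 0 := by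
  have h1 := norm_log_sub_le hy.le
  rw [h, zero_sub, norm_neg] at h1
  by_contra h0
  have : 0 < ‖y‖ := norm_pos_iff.2 h0
  nlinarith

/-- The points (1 + x)^(p^m) - 1 eventually enter the disc of radius 1/2, where the logarithm
vanishes only at 0. -/
theorem log_eq_zero_iff {x : ℂ_[p]} (hx : ‖x‖ < 1) :
    logFun p x = 0 ↔ ∃ m : ℕ, (1 + x) ^ (p ^ m) = 1 := by
  constructor
  · intro h
    have h1 := (tendsto_zero_iff_norm_tendsto_zero.1 (tendsto_pow_p_pow hx)).eventually
      (gt_mem_nhds (show (0 : ℝ) < 1 / 2 by norm_num))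
    obtain ⟨m, hm⟩ := h1.exists
    refine ⟨m, sub_eq_zero.1 (eq_zero_of_log_eq_zero hm ?_)⟩
    rw [log_pow hx, h, mul_zero]
  · rintro ⟨m, hm⟩
    have h1 := log_pow hx (p ^ m)
    rw [hm, sub_self, logFun_zero] at h1
    refine (mul_eq_zero.1 h1.symm).resolve_left ?_
    exact_mod_cast (pow_pos (Fact.out : p.Prime).pos m).ne'

theorem log_frobFun {x : ℂ_[p]} (hx : ‖x‖ < 1) : logFun p (frobFun p x) = p * logFun p x :=
  log_pow hx p

theorem continuousOn_log {r : ℝ} (hr : r < 1) :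
    ContinuousOn (logFun p) (Metric.closedBall 0 r) := by
  rcases lt_or_ge r 0 with h0 | h0
  · rw [Metric.closedBall_eq_empty.2 h0]
    exact continuousOn_empty _
  have h : logFun p = fun x => ∑' n, logTerm x n := funext logFun_eq
  rw [h]
  refine continuousOn_tsum (fun n => ?_) (summable_bound h0 hr) fun n x hx => ?_
  · unfold logTerm
    fun_prop
  · rw [mem_closedBall_zero_iff] at hx
    refine (norm_logTerm_le x n).trans ?_
    gcongr

/-! ### The logarithm and the action of Γ. -/

theorem norm_gammaTerm_le (u : ℤ_[p]) (x : ℂ_[p]) (n : ℕ) :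
    ‖((Ring.choose u (n + 1) : ℤ_[p]) : ℚ_[p]) • x ^ (n + 1)‖ ≤ ‖x‖ ^ (n + 1) := by
  rw [norm_smul, norm_pow]
  exact mul_le_of_le_one_left (by positivity) (PadicInt.norm_le_one _)

theorem norm_gammaFun_le (u : ℤ_[p]) {x : ℂ_[p]} (hx : ‖x‖ < 1) : ‖gammaFun u x‖ ≤ ‖x‖ := by
  refine IsUltrametricDist.norm_tsum_le_of_forall_le_of_nonneg (norm_nonneg _) fun n => ?_
  refine (norm_gammaTerm_le u x n).trans ?_
  rw [pow_succ]
  exact mul_le_of_le_one_left (norm_nonneg _) (pow_le_one₀ (norm_nonneg _) hx.le)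

theorem gammaFun_natCast (n : ℕ) (x : ℂ_[p]) : gammaFun (n : ℤ_[p]) x = (1 + x) ^ n - 1 := by
  rw [gammaFun, tsum_eq_sum (s := Finset.range n)]
  · rw [add_comm, add_pow, Finset.sum_range_succ']
    simp only [one_pow, mul_one, pow_zero, Nat.choose_zero_right, Nat.cast_one, add_sub_cancel_right]
    refine Finset.sum_congr rfl fun k _ => ?_
    rw [Ring.choose_natCast, Algebra.smul_def, PadicInt.coe_natCast, map_natCast, mul_comm]
  · intro k hk
    rw [Finset.mem_range, not_lt] at hk
    rw [Ring.choose_natCast, Nat.choose_eq_zero_of_lt (by omega)]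
    simp

theorem continuous_gammaFun {x : ℂ_[p]} (hx : ‖x‖ < 1) :
    Continuous fun u : ℤ_[p] => gammaFun u x := by
  refine continuous_tsum (u := fun n : ℕ => ‖x‖ ^ (n + 1)) (fun n => ?_) ?_
    fun n u => norm_gammaTerm_le u x n
  · have h := PadicInt.continuous_choose (p := p) (n + 1)
    exact (continuous_subtype_val.comp h).smul continuous_const
  · exact (summable_nat_add_iff 1).2 (summable_geometric_of_lt_one (norm_nonneg _) hx)

/-- Both sides are continuous in u and agree on the dense subset ℕ of ℤ_p. -/
theorem log_gammaFun (u : ℤ_[p]) {x : ℂ_[p]} (hx : ‖x‖ < 1) :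
    logFun p (gammaFun u x) = (u : ℚ_[p]) • logFun p x := by
  have h1 : Continuous fun u : ℤ_[p] => logFun p (gammaFun u x) :=
    (continuousOn_log hx).comp_continuous (continuous_gammaFun hx) fun u => by
      rw [mem_closedBall_zero_iff]
      exact norm_gammaFun_le u hx
  have h2 : Continuous fun u : ℤ_[p] => (u : ℚ_[p]) • logFun p x :=
    continuous_subtype_val.smul continuous_const
  refine congrFun (PadicInt.denseRange_natCast.equalizer h1 h2 ?_) u
  funext n
  simp only [Function.comp_apply]
  rw [gammaFun_natCast, log_pow hx, PadicInt.coe_natCast, Algebra.smul_def, map_natCast]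

/-! ### Torsion points -/

theorem norm_frobFun_le_max (x : ℂ_[p]) (hx : ‖x‖ ≤ 1) :
    ‖frobFun p x‖ ≤ max (‖x‖ ^ p) (‖(p : ℂ_[p])‖ * ‖x‖) := by
  have h : frobFun p x = x ^ p + p * x * ∑ k ∈ Finset.Ioo 0 p,
      1 ^ (k - 1) * x ^ (p - k - 1) * ((p.choose k / p : ℕ) : ℂ_[p]) := by
    rw [frobFun, add_pow_prime_eq Fact.out]
    ring
  rw [h]
  refine (IsUltrametricDist.norm_add_le_max _ _).trans (max_le_max (by rw [norm_pow]) ?_)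
  rw [norm_mul, norm_mul]
  refine mul_le_of_le_one_right (by positivity) ?_
  refine IsUltrametricDist.norm_sum_le_of_forall_le_of_nonneg zero_le_one fun k _ => ?_
  rw [one_pow, one_mul, norm_mul, norm_pow]
  exact mul_le_one₀ (pow_le_one₀ (norm_nonneg _) hx) (norm_nonneg _) (norm_natCast_le_one _)

theorem norm_frobFun_le {x : ℂ_[p]} (hx : ‖x‖ < 1) : ‖frobFun p x‖ ≤ ‖x‖ :=
  norm_pow_sub_one_le hx p

/-- On the disc of radius r, Frobenius contracts by the factor max(r, |p|) < 1, since ‖φ(y)‖ is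
bounded by the larger of ‖y‖^p and |p| ‖y‖. The exponent found is uniform in x. -/
theorem exists_norm_pow_sub_one_le {r ε : ℝ} (hr0 : 0 ≤ r) (hr : r < 1) (hε : 0 < ε) :
    ∃ n : ℕ, ∀ x : ℂ_[p], ‖x‖ ≤ r → ‖(1 + x) ^ (p ^ n) - 1‖ ≤ ε := by
  have hp1 : 1 < p := (Fact.out : p.Prime).one_lt
  set κ : ℝ := max r ‖(p : ℂ_[p])‖ with hκ
  have hκ0 : 0 ≤ κ := hr0.trans (le_max_left _ _)
  have hκ1 : κ < 1 := max_lt hr norm_p_lt_one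
  have h : ∀ (n : ℕ) (x : ℂ_[p]), ‖x‖ ≤ r → ‖(1 + x) ^ (p ^ n) - 1‖ ≤ κ ^ n := by
    intro n x hx
    have hx1 := hx.trans_lt hr
    induction n with
    | zero => simpa using hx1.le
    | succ n ih =>
      set y := (1 + x) ^ (p ^ n) - 1 with hy
      have hyr : ‖y‖ ≤ r := (norm_pow_sub_one_le hx1 _).trans hx
      have h1 : (1 + x) ^ (p ^ (n + 1)) - 1 = frobFun p y := by
        rw [frobFun, hy, add_sub_cancel, ← pow_mul, pow_succ]
      rw [h1, pow_succ']
      refine (norm_frobFun_le_max y (hyr.trans hr.le)).trans (max_le ?_ ?_)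
      · obtain ⟨q, rfl⟩ : ∃ q, p = q + 2 := ⟨p - 2, by omega⟩
        calc ‖y‖ ^ (q + 2) = ‖y‖ ^ q * (‖y‖ * ‖y‖) := by ring
          _ ≤ 1 * (r * κ ^ n) := by
              refine mul_le_mul (pow_le_one₀ (norm_nonneg _) (hyr.trans hr.le)) ?_
                (by positivity) zero_le_one
              exact mul_le_mul hyr ih (norm_nonneg _) hr0
          _ ≤ κ * κ ^ n := by
              rw [one_mul]
              exact mul_le_mul_of_nonneg_right (le_max_left _ _) (by positivity)
      · exact mul_le_mul (le_max_right _ _) ih (norm_nonneg _) hκ0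
  obtain ⟨n, hn⟩ := exists_pow_lt_of_lt_one hε hκ1
  exact ⟨n, fun x hx => (h n x hx).trans hn.le⟩

theorem exists_isPrimitiveRoot {x : ℂ_[p]} (hx : ‖x‖ < 1) (h : logFun p x = 0) :
    ∃ n, IsPrimitiveRoot (1 + x) (p ^ n) := by
  obtain ⟨m, hm⟩ := (log_eq_zero_iff hx).1 h
  obtain ⟨n, -, hn⟩ := (Nat.dvd_prime_pow (Fact.out : p.Prime)).1 (orderOf_dvd_of_pow_eq_one hm)
  exact ⟨n, hn ▸ IsPrimitiveRoot.orderOf _⟩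

/-- Since 1 + y is a power (1 + x)^i, the point y = (1 + x)^i - 1 is an integral multiple of x. Thus
the norm of a torsion point depends only on its order and does not decrease with it. -/
theorem norm_le_of_isPrimitiveRoot {x y : ℂ_[p]} (hx : ‖x‖ < 1) {N n : ℕ} (hnN : n ≤ N)
    (hxN : IsPrimitiveRoot (1 + x) (p ^ N)) (hyn : (1 + y) ^ (p ^ n) = 1) : ‖y‖ ≤ ‖x‖ := by
  have hpos : p ^ N ≠ 0 := (pow_pos (Fact.out : p.Prime).pos N).ne'
  have : NeZero (p ^ N) := ⟨hpos⟩
  have h1 : (1 + y) ^ (p ^ N) = 1 := by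
    obtain ⟨k, rfl⟩ := Nat.exists_eq_add_of_le hnN
    rw [pow_add, pow_mul, hyn, one_pow]
  obtain ⟨i, -, hi⟩ := hxN.eq_pow_of_pow_eq_one h1
  have h2 : y = (1 + x) ^ i - 1 := by rw [hi]; ring
  rw [h2]
  exact norm_pow_sub_one_le hx i

theorem one_add_iterate_frobFun (x : ℂ_[p]) (i : ℕ) :
    1 + (frobFun p)^[i] x = (1 + x) ^ (p ^ i) := by
  induction i with
  | zero => simp
  | succ i ih =>
    rw [Function.iterate_succ_apply', frobFun, add_sub_cancel, ih, ← pow_mul, pow_succ]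

theorem norm_iterate_frobFun_le {x : ℂ_[p]} (hx : ‖x‖ < 1) (i : ℕ) :
    ‖(frobFun p)^[i] x‖ ≤ ‖x‖ := by
  have h : (frobFun p)^[i] x = (1 + x) ^ (p ^ i) - 1 := by
    rw [← one_add_iterate_frobFun]
    ring
  rw [h]
  exact norm_pow_sub_one_le hx _

/-- Iterating Frobenius goes down in the tower of torsion points. -/
theorem isPrimitiveRoot_iterate {x : ℂ_[p]} {N n : ℕ} (hnN : n ≤ N)
    (hx : IsPrimitiveRoot (1 + x) (p ^ N)) :
    IsPrimitiveRoot (1 + (frobFun p)^[N - n] x) (p ^ n) := by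
  rw [one_add_iterate_frobFun]
  refine hx.pow (pow_pos (Fact.out : p.Prime).pos N) ?_
  rw [← pow_add, Nat.sub_add_cancel hnN]

theorem norm_le_norm_iterate {x y : ℂ_[p]} (hx1 : ‖x‖ < 1) {N n : ℕ} (hnN : n ≤ N)
    (hx : IsPrimitiveRoot (1 + x) (p ^ N)) (hy : IsPrimitiveRoot (1 + y) (p ^ n)) {i : ℕ}
    (hi : i ≤ N - n) : ‖y‖ ≤ ‖(frobFun p)^[i] x‖ := by
  refine norm_le_of_isPrimitiveRoot ((norm_iterate_frobFun_le hx1 i).trans_lt hx1)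
    (N := N - i) (n := n) (by omega) ?_ hy.pow_eq_one
  have := isPrimitiveRoot_iterate (n := N - i) (by omega) hx
  rwa [show N - (N - i) = i by omega] at this

/-! ### Divisibility by the logarithm on a closed annulus -/

theorem hasSum_logCoeff {x : ℂ_[p]} (hx : ‖x‖ < 1) :
    HasSum (fun n : ℤ => logCoeff p n • x ^ n) (logFun p x) := by
  have hinj : Function.Injective (fun n : ℕ => (n : ℤ) + 1) := fun m n h => by
    have : (m : ℤ) + 1 = n + 1 := h
    omega
  have hsupp : ∀ n ∉ Set.range (fun n : ℕ => (n : ℤ) + 1), logCoeff p n • x ^ n = 0 := by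
    intro n hn
    have : ¬ 0 < n := fun h => hn ⟨(n - 1).toNat, by
      change (((n - 1).toNat : ℕ) : ℤ) + 1 = n
      omega⟩
    rw [logCoeff, if_neg this, zero_smul]
  refine (hinj.hasSum_iff hsupp).1 ((hasSum_logTerm hx).congr_fun fun n => ?_)
  have hn : (0 : ℤ) < (n : ℤ) + 1 := by omega
  rw [Function.comp_apply, logCoeff, if_pos hn, logTerm, Algebra.smul_def, map_div₀,
    add_sub_cancel_right, zpow_natCast, map_pow, map_neg, map_one]
  push_cast
  rw [div_eq_mul_inv, mul_assoc]
  norm_cast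

theorem exists_logA (a b : Rad p) : ∃ f : AnnAlg a b, ∀ x, ev x f = logFun p x.1 := by
  obtain ⟨f, hf⟩ := exists_of_pointwise (hasSum_logCoeff a.2.2).summable
    (hasSum_logCoeff b.2.2).summable
  exact ⟨f, fun x => (hasSum_ev hf x).unique (hasSum_logCoeff (x.2.2.trans_lt b.2.2))⟩

/-- The logarithm as an analytic function on a closed annulus. -/
def logA (a b : Rad p) : AnnAlg a b := (exists_logA a b).choose

@[simp] theorem ev_logA {a b : Rad p} (x : Annulus a b) : ev x (logA a b) = logFun p x.1 :=
  (exists_logA a b).choose_spec x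

/-- The circle of radius `‖a‖` contains no zero of the logarithm. -/
def Good (a : Rad p) : Prop := ∀ x : ℂ_[p], ‖x‖ = ‖a.1‖ → logFun p x ≠ 0

/-- Clearing negative exponents costs only a unit and makes gcd arguments in ℚ_p[T] available. -/
theorem exists_monomial_mul_lpoly (a b : Rad p) (c : ℤ →₀ ℚ_[p]) :
    ∃ (N : ℕ) (G : Polynomial ℚ_[p]),
      amon a b N * lpoly a b c = Polynomial.aeval (amon a b 1) G := by
  set N := ∑ n ∈ c.support, n.natAbs with hN
  refine ⟨N, ∑ n ∈ c.support, Polynomial.C (c n) * Polynomial.X ^ (n + N).toNat, ?_⟩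
  rw [lpoly_eq_sum c subset_rfl, Finset.mul_sum, map_sum]
  refine Finset.sum_congr rfl fun n hn => ?_
  have h1 : n.natAbs ≤ N :=
    Finset.single_le_sum (f := fun k : ℤ => k.natAbs) (fun _ _ => Nat.zero_le _) hn
  rw [map_mul, Polynomial.aeval_C, map_pow, Polynomial.aeval_X, ← amon_natCast,
    Int.toNat_of_nonneg (by omega), mul_smul_comm, amon_mul, Algebra.smul_def, add_comm]

theorem isUnit_amon (a b : Rad p) (n : ℤ) : IsUnit (amon a b n) :=
  IsUnit.of_mul_eq_one (amon a b (-n)) (by rw [amon_mul, add_neg_cancel, amon_zero])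

/-- The polynomial `(1 + T) ^ (p ^ n) - 1`. -/
def omegaPoly (p : ℕ) [Fact p.Prime] (n : ℕ) : Polynomial ℚ_[p] :=
  (1 + Polynomial.X) ^ (p ^ n) - 1

theorem aeval_omegaPoly {B : Type*} [CommRing B] [Algebra ℚ_[p] B] (x : B) (n : ℕ) :
    Polynomial.aeval x (omegaPoly p n) = (1 + x) ^ (p ^ n) - 1 := by
  simp [omegaPoly]

theorem ev_aeval {a b : Rad p} (x : Annulus a b) (P : Polynomial ℚ_[p]) :
    ev x (Polynomial.aeval (amon a b 1) P) = Polynomial.aeval x.1 P := by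
  rw [← Polynomial.aeval_algHom_apply, ev_amon, zpow_one]

theorem aeval_derivative_omegaPoly_ne_zero {x : ℂ_[p]} {n : ℕ}
    (hx : Polynomial.aeval x (omegaPoly p n) = 0) :
    Polynomial.aeval x (Polynomial.derivative (omegaPoly p n)) ≠ 0 := by
  rw [aeval_omegaPoly, sub_eq_zero] at hx
  have hpos : p ^ n ≠ 0 := (pow_pos (Fact.out : p.Prime).pos n).ne'
  have h1 : 1 + x ≠ 0 := by
    intro h
    rw [h, zero_pow hpos] at hx
    exact zero_ne_one hx
  have h2 : Polynomial.aeval x (Polynomial.derivative (omegaPoly p n))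
      = ((p ^ n : ℕ) : ℂ_[p]) * (1 + x) ^ (p ^ n - 1) := by
    simp [omegaPoly, Polynomial.derivative_pow]
  rw [h2]
  exact mul_ne_zero (by exact_mod_cast hpos) (pow_ne_zero _ h1)

/-- If `P` kills the zeros of `(1 + T) ^ (p ^ n) - 1` that lie in the annulus, then it is divisible
by `(1 + T) ^ (p ^ n) - 1` on the annulus. -/
theorem omega_dvd_aeval {a b : Rad p} (hab : ‖a.1‖ ≤ ‖b.1‖) {n : ℕ} {G : Polynomial ℚ_[p]}
    (hG : ∀ x : Annulus a b, Polynomial.aeval x.1 (omegaPoly p n) = 0 →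
      Polynomial.aeval x.1 G = 0) :
    Polynomial.aeval (amon a b 1) (omegaPoly p n) ∣ Polynomial.aeval (amon a b 1) G := by
  classical
  set W := omegaPoly p n with hW
  set D := EuclideanDomain.gcd W G with hD
  obtain ⟨P, hP⟩ := EuclideanDomain.gcd_dvd_left W G
  obtain ⟨Q, hQ⟩ := EuclideanDomain.gcd_dvd_right W G
  rw [← hD] at hP hQ
  have hbez := EuclideanDomain.gcd_eq_gcd_ab W G
  rw [← hD] at hbez
  -- A zero of the cofactor P is a zero of `W`, hence of `G`, hence of the gcd `D`. It would be a
  -- double zero of `W` = P D, which is separable. So P has no zero on the annulus.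
  have hunit : IsUnit (Polynomial.aeval (amon a b 1) P) := by
    refine isUnit_of_forall_ne_zero hab fun x hx => ?_
    rw [ev_aeval] at hx
    have hWx : Polynomial.aeval x.1 W = 0 := by rw [hP, map_mul, hx, mul_zero]
    have hDx : Polynomial.aeval x.1 D = 0 := by
      rw [hbez, map_add, map_mul, map_mul, hWx, hG x hWx, zero_mul, zero_mul, add_zero]
    refine aeval_derivative_omegaPoly_ne_zero hWx ?_
    rw [← hW, hP, Polynomial.derivative_mul, map_add, map_mul, map_mul, hx, hDx]
    ring
  rw [← hunit.dvd_mul_right, ← map_mul]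
  refine ⟨Polynomial.aeval (amon a b 1) Q, ?_⟩
  rw [← map_mul]
  congr 1
  linear_combination P * hQ - Q * hP

theorem exists_omega {a b : Rad p} : ∃ n : ℕ, ∀ x : Annulus a b,
    ‖(1 + x.1) ^ (p ^ n) - 1‖ ≤ 1 / 4 := by
  obtain ⟨n, hn⟩ := exists_norm_pow_sub_one_le (p := p) (norm_nonneg b.1) b.2.2
    (show (0 : ℝ) < 1 / 4 by norm_num)
  exact ⟨n, fun x => hn x.1 x.2.2⟩

theorem summable_bound_quarter : Summable fun k : ℕ => ((k + 1 : ℕ) : ℝ) * (1 / 4) ^ k := by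
  have h := (summable_bound (r := 1 / 4) (by norm_num) (by norm_num)).mul_right 4
  refine h.congr fun k => ?_
  rw [pow_succ]
  ring

/-- The logarithm is a unit multiple of `(1 + T) ^ (p ^ n) - 1` for large `n`. -/
theorem logA_dvd_omega {a b : Rad p} (hab : ‖a.1‖ ≤ ‖b.1‖) {n : ℕ}
    (hn : ∀ x : Annulus a b, ‖(1 + x.1) ^ (p ^ n) - 1‖ ≤ 1 / 4) :
    logA a b ∣ Polynomial.aeval (amon a b 1) (omegaPoly p n) := by
  set ω := Polynomial.aeval (amon a b 1) (omegaPoly p n) with hω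
  have hωx : ∀ x, ev x ω = (1 + x.1) ^ (p ^ n) - 1 := fun x => by
    rw [hω, ev_aeval, aeval_omegaPoly]
  have hωn : ‖ω‖ ≤ 1 / 4 := (norm_le_iff (by norm_num)).2 fun x => by rw [hωx]; exact hn x
  -- The series U = ∑ (-1)^k ω^k / (k + 1) satisfies log(1 + ω) = ω U, while log(1 + ω) = p^n log(1
  -- + T).
  set u : ℕ → AnnAlg a b := fun k => ((-1) ^ k * (((k + 1 : ℕ) : ℚ_[p]))⁻¹) • ω ^ k with hu
  have hsum : Summable u := by
    refine Summable.of_norm_bounded summable_bound_quarter fun k => ?_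
    simp only [hu]
    rw [norm_smul, norm_mul, norm_pow, norm_neg, norm_one, one_pow, one_mul]
    have h1 : ‖(((k + 1 : ℕ) : ℚ_[p]))⁻¹‖ ≤ ((k + 1 : ℕ) : ℝ) := by
      have := norm_inv_natCast_le (p := p) (k + 1)
      rwa [norm_inv, norm_natCast_eq, ← norm_inv] at this
    refine mul_le_mul h1 ?_ (norm_nonneg _) (Nat.cast_nonneg _)
    rcases Nat.eq_zero_or_pos k with rfl | hk
    · rw [pow_zero, pow_zero]
      exact (norm_le_iff zero_le_one).2 fun x => by rw [map_one, norm_one]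
    · exact (norm_pow_le' ω hk).trans (pow_le_pow_left₀ (norm_nonneg _) hωn k)
  have hUx : ∀ x, HasSum (fun k => (-1) ^ k * (((k + 1 : ℕ) : ℂ_[p])⁻¹ * (ev x ω) ^ k))
      (ev x (∑' k, u k)) := fun x => by
    refine (hsum.hasSum.map (ev x) (continuous_ev x)).congr_fun fun k => ?_
    simp only [hu, Function.comp_apply]
    rw [map_smul, map_pow, Algebra.smul_def, map_mul, map_pow, map_neg, map_one, map_inv₀,
      map_natCast, mul_assoc]
  have hprod : ∀ x, logFun p (ev x ω) = ev x ω * ev x (∑' k, u k) := fun x => by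
    have hlt : ‖ev x ω‖ < 1 := (norm_ev_le x ω).trans_lt (hωn.trans_lt (by norm_num))
    refine (hasSum_logTerm hlt).unique (((hUx x).mul_left _).congr_fun fun k => ?_)
    rw [logTerm, pow_succ]
    ring
  -- Where ω vanishes, U equals 1. Elsewhere a zero of U would be a zero of log(1 + ω) with 0 < ‖ω‖
  -- < 1/2, which does not exist.
  have hUunit : IsUnit (∑' k, u k) := by
    refine isUnit_of_forall_ne_zero hab fun x hx => ?_
    by_cases h0 : ev x ω = 0
    · have h1 := hUx x
      rw [h0, hx] at h1
      have h2 := h1.unique (hasSum_single 0 fun k hk => by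
        rw [zero_pow hk, mul_zero, mul_zero])
      simp at h2
    · refine h0 (eq_zero_of_log_eq_zero ?_ (by rw [hprod, hx, mul_zero]))
      exact (norm_ev_le x ω).trans_lt (hωn.trans_lt (by norm_num))
  have hp0 : ((p : ℚ_[p]) ^ n) ≠ 0 :=
    pow_ne_zero _ (by exact_mod_cast (Fact.out : p.Prime).ne_zero)
  have heq : logA a b * algebraMap ℚ_[p] _ ((p : ℚ_[p]) ^ n) = ω * ∑' k, u k := by
    refine AnnAlg.ext fun x => ?_
    have hx1 : ‖x.1‖ < 1 := x.2.2.trans_lt b.2.2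
    rw [map_mul, map_mul, ev_logA, AlgHom.commutes, ← hprod, hωx, log_pow hx1, map_pow,
      map_natCast]
    push_cast
    ring
  rw [← hUunit.dvd_mul_right, ← heq]
  exact dvd_mul_right _ _

/-- The logarithm is a unit times ω = (1 + T)^(p^n) - 1 for large n. As the boundary circles carry
no zero of ω, the ideal (ω) is closed, so h is congruent modulo ω to a Laurent polynomial with the
same vanishing; there divisibility is a statement about polynomials. -/
theorem log_dvd_of_forall_zero {a b : Rad p} (hab : ‖a.1‖ ≤ ‖b.1‖) (ha : Good a) (hb : Good b)
    {h : AnnAlg a b} (hv : ∀ x : Annulus a b, logFun p x.1 = 0 → ev x h = 0) :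
    logA a b ∣ h := by
  obtain ⟨n, hn⟩ := exists_omega (a := a) (b := b)
  set ω := Polynomial.aeval (amon a b 1) (omegaPoly p n) with hω
  have hωx : ∀ x, ev x ω = (1 + x.1) ^ (p ^ n) - 1 := fun x => by
    rw [hω, ev_aeval, aeval_omegaPoly]
  have hzero : ∀ x : Annulus a b, ev x ω = 0 → logFun p x.1 = 0 := fun x hx =>
    (log_eq_zero_iff (x.2.2.trans_lt b.2.2)).2 ⟨n, by rw [hωx] at hx; exact sub_eq_zero.1 hx⟩
  have hcirc : ∀ x : Annulus a b, ‖x.1‖ = ‖a.1‖ ∨ ‖x.1‖ = ‖b.1‖ → ev x ω ≠ 0 := by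
    intro x hx h0
    rcases hx with hx | hx
    · exact ha _ hx (hzero x h0)
    · exact hb _ hx (hzero x h0)
  obtain ⟨c, hc, hmul⟩ := exists_norm_mul_ge hab hcirc
  have hω0 : ω ≠ 0 := by
    intro h0
    refine hcirc ⟨a.1, le_rfl, hab⟩ (Or.inl rfl) ?_
    rw [h0, map_zero]
  obtain ⟨d, hd⟩ := exists_lpoly_sub_mem hab (isClosed_span_singleton hc hmul)
    (Ideal.mem_span_singleton_self ω) hω0 h
  rw [Ideal.mem_span_singleton] at hd
  obtain ⟨N, G, hG⟩ := exists_monomial_mul_lpoly a b d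
  have hdvd : ω ∣ lpoly a b d := by
    rw [← (isUnit_amon a b N).dvd_mul_left, hG]
    refine omega_dvd_aeval hab fun x hx => ?_
    rw [← ev_aeval, ← hω] at hx
    rw [← ev_aeval, ← hG, map_mul]
    obtain ⟨q, hq⟩ := hd
    have h1 : lpoly a b d = h - ω * q := by rw [← hq]; ring
    rw [h1, map_sub, map_mul, hx, hv x (hzero x hx)]
    ring
  refine (logA_dvd_omega hab hn).trans ?_
  have h2 : h = (h - lpoly a b d) + lpoly a b d := by ring
  rw [h2]
  exact dvd_add hd hdvd

/-- The powers of x generate a stationary chain of ideals in the Artinian quotient. -/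
theorem exists_pow_succ_mul_sub_mem {F B : Type*} [Field F] [CommRing B] [Algebra F B]
    (J : Ideal B) [FiniteDimensional F (B ⧸ J)] (x : B) :
    ∃ (k : ℕ) (y : B), x ^ (k + 1) * y - x ^ k ∈ J := by
  have hart : IsArtinianRing (B ⧸ J) := IsArtinianRing.of_finite F _
  obtain ⟨k, y, hy⟩ := IsArtinian.exists_pow_succ_smul_dvd (Ideal.Quotient.mk J x) (1 : B ⧸ J)
  obtain ⟨y, rfl⟩ := Ideal.Quotient.mk_surjective y
  refine ⟨k, y, ?_⟩
  rw [← Ideal.Quotient.eq, map_mul, map_pow, map_pow]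
  simpa using hy

/-- A function divisible by all powers of the logarithm is zero. -/
theorem eq_zero_of_forall_log_pow_dvd {a b : Rad p} (hab : ‖a.1‖ ≤ ‖b.1‖) (ha : Good a)
    (hb : Good b) {f : AnnAlg a b} (hf : ∀ k, logA a b ^ k ∣ f) {x : Annulus a b}
    (hx : logFun p x.1 = 0) : f = 0 := by
  by_contra hf0
  have hcirc : ∀ k (x : Annulus a b), ‖x.1‖ = ‖a.1‖ ∨ ‖x.1‖ = ‖b.1‖ →
      ev x (logA a b ^ k) ≠ 0 := by
    intro k x hx h0
    rw [map_pow, ev_logA] at h0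
    rcases hx with hx | hx
    · exact pow_ne_zero k (ha _ hx) h0
    · exact pow_ne_zero k (hb _ hx) h0
  set J := (Ideal.span {f}).closure with hJ
  have hfJ : f ∈ J := subset_closure (Ideal.mem_span_singleton_self f)
  have hfd := finiteDimensional_quotient hab (J := J) isClosed_closure hfJ hf0
  obtain ⟨k, y, hmem⟩ := exists_pow_succ_mul_sub_mem (F := ℚ_[p]) J (logA a b)
  obtain ⟨c, hc, hmul⟩ := exists_norm_mul_ge hab (hcirc (k + 1))
  -- The ideal generated by log^(k+1) is closed and contains f, so it contains the closure `J`. Then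
  -- log^k ∈ (log^(k+1)), and cancelling log^k makes the logarithm a unit, contradicting its zero x.
  have hJle : J ≤ Ideal.span {logA a b ^ (k + 1)} := by
    refine closure_minimal ?_ (isClosed_span_singleton hc hmul)
    exact (Ideal.span_singleton_le_span_singleton).2 (hf (k + 1))
  obtain ⟨q, hq⟩ := Ideal.mem_span_singleton.1 (hJle hmem)
  obtain ⟨c', hc', hmul'⟩ := exists_norm_mul_ge hab (hcirc k)
  have h1 : logA a b ^ k * (1 - logA a b * (y - q)) = 0 := by
    rw [pow_succ] at hq
    linear_combination -hq
  have h2 := hmul' (1 - logA a b * (y - q))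
  rw [h1, norm_zero] at h2
  have h3 : ‖1 - logA a b * (y - q)‖ ≤ 0 := nonpos_of_mul_nonpos_right h2 hc'
  have h4 := congrArg (ev x) (norm_le_zero_iff.1 h3)
  rw [map_sub, map_mul, ev_logA, hx, map_one, zero_mul, sub_zero, map_zero] at h4
  exact one_ne_zero h4

/-! ### Conjugate points -/

/-- After the shift X ↦ X + 1 the polynomial is Eisenstein at p over ℤ, hence over ℤ_p; Gauss's
lemma passes to ℚ_p. -/
theorem irreducible_cyclotomic (n : ℕ) : Irreducible (Polynomial.cyclotomic (p ^ n) ℚ_[p]) := by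
  rcases n with _ | n
  · rw [pow_zero, Polynomial.cyclotomic_one]
    exact Polynomial.irreducible_of_degree_eq_one (by
      rw [← Polynomial.C_1]
      exact Polynomial.degree_X_sub_C _)
  have hmonic : (Polynomial.cyclotomic (p ^ (n + 1)) ℤ_[p]).Monic := Polynomial.cyclotomic.monic _ _
  rw [← Polynomial.map_cyclotomic _ (algebraMap ℤ_[p] ℚ_[p]),
    ← hmonic.irreducible_iff_irreducible_map_fraction_map]
  have hE := cyclotomic_prime_pow_comp_X_add_one_isEisensteinAt p n
  set f := (Polynomial.cyclotomic (p ^ (n + 1)) ℤ).comp (Polynomial.X + 1) with hf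
  have hfm : f.Monic := by
    rw [hf, show (Polynomial.X + 1 : Polynomial ℤ) = Polynomial.X + Polynomial.C 1 by simp]
    refine (Polynomial.cyclotomic.monic _ ℤ).comp (Polynomial.monic_X_add_C 1) fun h => ?_
    rw [Polynomial.natDegree_X_add_C] at h
    exact one_ne_zero h
  set g := f.map (Int.castRingHom ℤ_[p]) with hg
  have hgm : g.Monic := hfm.map _
  have hgdeg : g.natDegree = f.natDegree := hfm.natDegree_map _
  have hmem : ∀ z : ℤ, (z : ℤ_[p]) ∈ IsLocalRing.maximalIdeal ℤ_[p] ↔ (p : ℤ) ∣ z := by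
    intro z
    rw [IsLocalRing.mem_maximalIdeal, PadicInt.mem_nonunits, PadicInt.norm_int_lt_one_iff_dvd]
  have hgE : g.IsEisensteinAt (IsLocalRing.maximalIdeal ℤ_[p]) := by
    refine ⟨?_, fun {i} hi => ?_, ?_⟩
    · rw [hgm.leadingCoeff]
      exact fun h => (Ideal.ne_top_iff_one _).1 (IsLocalRing.maximalIdeal.isMaximal _).ne_top h
    · rw [hg, Polynomial.coeff_map, eq_intCast, hmem]
      have := hE.mem (n := i) (hgdeg ▸ hi)
      rwa [Ideal.submodule_span_eq, Ideal.mem_span_singleton] at this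
    · rw [hg, Polynomial.coeff_map, eq_intCast, PadicInt.maximalIdeal_eq_span_p,
        Ideal.span_singleton_pow, ← PadicInt.norm_le_pow_iff_mem_span_pow]
      intro hle
      have h2 := (PadicInt.norm_int_le_pow_iff_dvd).1 hle
      refine hE.notMem ?_
      rw [Ideal.submodule_span_eq, Ideal.span_singleton_pow, Ideal.mem_span_singleton]
      exact_mod_cast h2
  have hirr : Irreducible g := hgE.irreducible (IsLocalRing.maximalIdeal.isMaximal _).isPrime
    hgm.isPrimitive (by
      rw [hgdeg, hf, Polynomial.natDegree_comp, Polynomial.natDegree_cyclotomic,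
        show (Polynomial.X + 1 : Polynomial ℤ) = Polynomial.X + Polynomial.C 1 by simp,
        Polynomial.natDegree_X_add_C, mul_one]
      exact Nat.totient_pos.2 (pow_pos (Fact.out : p.Prime).pos _))
  have hcomp : g = (Polynomial.cyclotomic (p ^ (n + 1)) ℤ_[p]).comp
      (Polynomial.X + Polynomial.C 1) := by
    rw [hg, hf, Polynomial.map_comp, Polynomial.map_cyclotomic]
    simp
  have hcomp' : g = Polynomial.algEquivAevalXAddC (1 : ℤ_[p])
      (Polynomial.cyclotomic (p ^ (n + 1)) ℤ_[p]) := by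
    rw [hcomp, Polynomial.algEquivAevalXAddC_apply, Polynomial.comp, Polynomial.aeval_def]
    rfl
  rw [hcomp'] at hirr
  exact (MulEquiv.irreducible_iff _).1 hirr

/-- A function vanishing at a torsion point vanishes at its conjugates. -/
theorem ev_eq_zero_of_isPrimitiveRoot {a b : Rad p} (hab : ‖a.1‖ ≤ ‖b.1‖) {f : AnnAlg a b}
    {x y : Annulus a b} {n : ℕ} (hx : IsPrimitiveRoot (1 + x.1) (p ^ n))
    (hy : IsPrimitiveRoot (1 + y.1) (p ^ n)) (hf : ev x f = 0) : ev y f = 0 := by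
  have hpos : 0 < p ^ n := pow_pos (Fact.out : p.Prime).pos n
  have : NeZero ((p ^ n : ℕ) : ℚ_[p]) := ⟨by exact_mod_cast hpos.ne'⟩
  have hmx := hx.minpoly_eq_cyclotomic_of_irreducible (irreducible_cyclotomic (p := p) n)
  have hmy := hy.minpoly_eq_cyclotomic_of_irreducible (irreducible_cyclotomic (p := p) n)
  have hint : IsIntegral ℚ_[p] (1 + x.1) := 
    ⟨Polynomial.X ^ (p ^ n) - Polynomial.C 1, Polynomial.monic_X_pow_sub_C _ hpos.ne', by
      simp [hx.pow_eq_one]⟩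
  let K := IntermediateField.adjoin ℚ_[p] {1 + x.1}
  have hfd : FiniteDimensional ℚ_[p] K := IntermediateField.adjoin.finiteDimensional hint
  let σ : K →ₐ[ℚ_[p]] ℂ_[p] := (IntermediateField.adjoin.powerBasis hint).lift (1 + y.1) (by
    rw [IntermediateField.adjoin.powerBasis_gen, IntermediateField.minpoly_gen, ← hmx, hmy]
    exact minpoly.aeval _ _)
  have hσ : σ (IntermediateField.AdjoinSimple.gen ℚ_[p] (1 + x.1)) = 1 + y.1 := by
    have := (IntermediateField.adjoin.powerBasis hint).lift_gen (1 + y.1) (by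
      rw [IntermediateField.adjoin.powerBasis_gen, IntermediateField.minpoly_gen, ← hmx, hmy]
      exact minpoly.aeval _ _)
    exact (congrArg σ (IntermediateField.adjoin.powerBasis_gen hint).symm).trans this
  set ξ : K := IntermediateField.AdjoinSimple.gen ℚ_[p] (1 + x.1) - 1 with hξ
  have hξx : (ξ : ℂ_[p]) = x.1 := by
    rw [hξ]
    push_cast
    rw [IntermediateField.AdjoinSimple.coe_gen]
    ring
  have hσξ : σ ξ = y.1 := by
    rw [hξ, map_sub, hσ, map_one]
    ring
  -- The embedding σ is continuous because its source is finite-dimensional over ℚ_p. It may thus be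
  -- applied term by term to the Laurent series at x, whose coefficients it fixes.
  have hcont : Continuous σ.toLinearMap := LinearMap.continuous_of_finiteDimensional _
  obtain ⟨c, -, hc⟩ := exists_expansion hab f
  have h1 := hasSum_ev hc x
  rw [hf] at h1
  have h2 : HasSum (fun n : ℤ => c n • ξ ^ n) 0 := by
    rw [HasSum, Topology.IsInducing.subtypeVal.tendsto_nhds_iff]
    refine h1.congr fun s => ?_
    simp only [Function.comp_apply]
    rw [AddSubmonoidClass.coe_finsetSum]
    refine Finset.sum_congr rfl fun n _ => ?_
    rw [← hξx]
    rfl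
  have h3 := h2.map σ.toLinearMap hcont
  rw [map_zero] at h3
  refine (hasSum_ev hc y).unique (h3.congr_fun fun n => ?_)
  simp only [Function.comp_apply]
  rw [map_smul, AlgHom.toLinearMap_apply, map_zpow₀, hσξ]

/-! ### Radii -/

/-- The radii p^{-q} with q > 0 rational are dense in (0, 1) and are attained by roots of powers of
p. -/
theorem exists_rad {s t : ℝ} (hs : 0 ≤ s) (hst : s < t) (ht : t ≤ 1) :
    ∃ b : Rad p, s < ‖b.1‖ ∧ ‖b.1‖ < t := by
  have hp1 : (1 : ℝ) < p := by exact_mod_cast (Fact.out : p.Prime).one_lt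
  have hp0 : (0 : ℝ) < p := one_pos.trans hp1
  obtain ⟨s', hs1, hs2⟩ := exists_between hst
  have hs'0 : 0 < s' := hs.trans_lt hs1
  have ht0 : 0 < t := hs.trans_lt hst
  obtain ⟨q, hq1, hq2⟩ := exists_rat_btwn (neg_lt_neg (Real.logb_lt_logb hp1 hs'0 hs2))
  have hlt : Real.logb p t ≤ 0 := Real.logb_nonpos hp1 ht0.le ht
  have hq0 : (0 : ℝ) < q := by linarith
  have hq0' : 0 < q := by exact_mod_cast hq0
  obtain ⟨x, hx⟩ := IsAlgClosed.exists_pow_nat_eq ((p : ℂ_[p]) ^ q.num.toNat) q.den_pos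
  have hnum : ((q.num.toNat : ℕ) : ℝ) = (q : ℝ) * q.den := by
    have h1 : ((q.num.toNat : ℕ) : ℤ) = q.num := Int.toNat_of_nonneg (Rat.num_nonneg.2 hq0'.le)
    have h2 : (q.num : ℚ) = q * q.den := (Rat.mul_den_eq_num q).symm
    have h3 : ((q.num.toNat : ℕ) : ℚ) = q * q.den := by rw [← h2]; exact_mod_cast h1
    exact_mod_cast h3
  have hxn : ‖x‖ = (p : ℝ) ^ (-(q : ℝ)) := by
    have h1 := congrArg norm hx
    rw [norm_pow, norm_pow, norm_p] at h1
    refine (pow_left_inj₀ (norm_nonneg x) (by positivity) q.den_nz).1 ?_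
    rw [h1, ← Real.rpow_natCast, ← Real.rpow_natCast, ← Real.rpow_mul hp0.le, hnum,
      ← Real.rpow_neg_one, ← Real.rpow_mul hp0.le]
    ring_nf
  have hx1 : s' < ‖x‖ := by
    rw [hxn, ← Real.logb_lt_iff_lt_rpow hp1 hs'0]
    linarith
  have hx2 : ‖x‖ < t := by
    rw [hxn, ← Real.lt_logb_iff_rpow_lt hp1 ht0]
    linarith
  exact ⟨⟨x, norm_pos_iff.1 (hs'0.trans hx1), hx2.trans_le ht⟩, hs1.trans hx1, hx2⟩

theorem exists_rad_gt {r : ℝ} (hr : r < 1) : ∃ b : Rad p, r < ‖b.1‖ := by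
  obtain ⟨b, hb, -⟩ := exists_rad (p := p) (le_max_right r 0) (max_lt hr one_pos) le_rfl
  exact ⟨b, (le_max_left _ _).trans_lt hb⟩

theorem infinite_radii {s t : ℝ} (hs : 0 ≤ s) (hst : s < t) (ht : t ≤ 1) :
    {c : ℝ | ∃ b : Rad p, ‖b.1‖ = c ∧ s < c ∧ c < t}.Infinite := by
  intro hfin
  obtain ⟨b, hb1, hb2⟩ := exists_rad (p := p) hs hst ht
  obtain ⟨m, ⟨a, rfl, ha1, ha2⟩, hm⟩ := Set.exists_max_image _ id hfin ⟨_, b, rfl, hb1, hb2⟩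
  obtain ⟨d, hd1, hd2⟩ := exists_rad (p := p) (norm_nonneg _) ha2 ht
  exact absurd (hm _ ⟨d, rfl, ha1.trans hd1, hd2⟩) (not_le.2 hd1)

theorem omegaPoly_ne_zero (n : ℕ) : omegaPoly p n ≠ 0 := by
  intro hz
  have h1 := aeval_omegaPoly (p := p) (-1 : ℚ_[p]) n
  rw [hz, map_zero, add_neg_cancel, zero_pow (pow_pos (Fact.out : p.Prime).pos n).ne'] at h1
  norm_num at h1

/-- Otherwise (1 + T)^(p^n) - 1, being a multiple of the logarithm, would vanish on an annulus
containing points of infinitely many norms. -/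
theorem logA_ne_zero {a b : Rad p} (hab : ‖a.1‖ < ‖b.1‖) : logA a b ≠ 0 := by
  classical
  intro h
  obtain ⟨n, hn⟩ := exists_omega (a := a) (b := b)
  have hinf := infinite_radii (p := p) (norm_nonneg _) hab b.2.2.le
  have h0 : (Polynomial.aeval (amon a b 1) (omegaPoly p n)) = 0 :=
    zero_dvd_iff.1 (h ▸ logA_dvd_omega hab.le hn)
  refine hinf (((omegaPoly p n).aroots ℂ_[p]).toFinset.finite_toSet.image norm |>.subset ?_)
  rintro c ⟨d, rfl, hd1, hd2⟩
  refine ⟨d.1, ?_, rfl⟩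
  simp only [Finset.mem_coe, Multiset.mem_toFinset, Polynomial.mem_aroots]
  refine ⟨omegaPoly_ne_zero n, ?_⟩
  have := ev_aeval (⟨d.1, hd1.le, hd2.le⟩ : Annulus a b) (omegaPoly p n)
  rw [h0, map_zero] at this
  exact this.symm

/-- Between two radii the logarithm has finitely many zeros, but there are infinitely many radii. -/
theorem exists_good {r : ℝ} (hr : r < 1) : ∃ a : Rad p, Good a ∧ r < ‖a.1‖ := by
  obtain ⟨a, ha⟩ := exists_rad_gt (p := p) hr
  obtain ⟨b, hb⟩ := exists_rad_gt (p := p) a.2.2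
  have hfin := (finite_zeros hb.le (logA_ne_zero hb)).image fun x => ‖x.1‖
  obtain ⟨c, ⟨d, rfl, hd1, hd2⟩, hc⟩ :=
    (infinite_radii (p := p) (norm_nonneg _) hb b.2.2.le).exists_notMem_finite hfin
  refine ⟨d, fun x hx h0 => hc ⟨⟨x, hx ▸ hd1.le, hx ▸ hd2.le⟩, ?_, hx⟩, ha.trans hd1⟩
  change ev _ _ = 0
  rw [ev_logA, h0]

/-! ### Analytic functions on half-open annuli -/

/-- The half-open annulus `‖a‖ ≤ ‖x‖ < 1`. -/
abbrev Omega (a : Rad p) := {x : ℂ_[p] // ‖a.1‖ ≤ ‖x‖ ∧ ‖x‖ < 1}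

/-- The inclusion of a closed annulus. -/
def Annulus.incl {a b : Rad p} (x : Annulus a b) : Omega a := ⟨x.1, x.2.1, x.2.2.trans_lt b.2.2⟩

/-- The algebra of analytic functions, defined over `ℚ_p`, on a half-open annulus. -/
def OAlg (a : Rad p) : Subalgebra ℚ_[p] (Omega a → ℂ_[p]) where
  carrier := {f | ∀ b : Rad p, ∃ g : AnnAlg a b, ∀ x : Annulus a b, ev x g = f x.incl}
  mul_mem' := by
    intro f g hf hg b
    obtain ⟨f', hf'⟩ := hf b
    obtain ⟨g', hg'⟩ := hg b
    exact ⟨f' * g', fun x => by rw [map_mul, hf', hg', Pi.mul_apply]⟩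
  add_mem' := by
    intro f g hf hg b
    obtain ⟨f', hf'⟩ := hf b
    obtain ⟨g', hg'⟩ := hg b
    exact ⟨f' + g', fun x => by rw [map_add, hf', hg', Pi.add_apply]⟩
  algebraMap_mem' c b := ⟨algebraMap _ _ c, fun x => by
    rw [AlgHom.commutes, Pi.algebraMap_apply]⟩

/-- Restriction to a closed annulus. -/
def toAnn {a : Rad p} (b : Rad p) : OAlg a →ₐ[ℚ_[p]] AnnAlg a b where
  toFun f := (f.2 b).choose
  map_one' := AnnAlg.ext fun x => by
    rw [((1 : OAlg a).2 b).choose_spec, map_one]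
    rfl
  map_mul' f g := AnnAlg.ext fun x => by
    rw [((f * g).2 b).choose_spec, map_mul, (f.2 b).choose_spec, (g.2 b).choose_spec]
    rfl
  map_zero' := AnnAlg.ext fun x => by
    rw [((0 : OAlg a).2 b).choose_spec, map_zero]
    rfl
  map_add' f g := AnnAlg.ext fun x => by
    rw [((f + g).2 b).choose_spec, map_add, (f.2 b).choose_spec, (g.2 b).choose_spec]
    rfl
  commutes' c := AnnAlg.ext fun x => by
    rw [((algebraMap _ _ c : OAlg a).2 b).choose_spec, AlgHom.commutes]
    rfl

@[simp] theorem ev_toAnn {a b : Rad p} (f : OAlg a) (x : Annulus a b) :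
    ev x (toAnn b f) = f.1 x.incl := (f.2 b).choose_spec x

theorem mem_OAlg_of_frequently {a : Rad p} {f : Omega a → ℂ_[p]}
    (h : ∀ r < (1 : ℝ), ∃ b : Rad p, r < ‖b.1‖ ∧ ∃ g : AnnAlg a b, ∀ x : Annulus a b,
      ev x g = f x.incl) : f ∈ OAlg a := by
  intro b
  obtain ⟨b', hb', g, hg⟩ := h ‖b.1‖ b.2.2
  refine ⟨res le_rfl hb'.le g, fun x => ?_⟩
  rw [ev_res, hg]
  rfl

/-- The coefficients are determined on the inner circle, so the expansions on the various closed
annuli coincide. -/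
theorem exists_expansion_OAlg {a : Rad p} (f : OAlg a) :
    ∃ c : ℤ → ℚ_[p], ∀ x : Omega a, HasSum (fun n => c n • x.1 ^ n) (f.1 x) := by
  have h1 : ∀ b : Rad p, ‖a.1‖ ≤ ‖b.1‖ → ∃ c : ℤ → ℚ_[p], ∀ x : Annulus a b,
      HasSum (fun n => c n • x.1 ^ n) (f.1 x.incl) := fun b hb => by
    obtain ⟨c, -, hc⟩ := exists_expansion hb (toAnn b f)
    exact ⟨c, fun x => by simpa using hasSum_ev hc x⟩
  obtain ⟨c, hc⟩ := h1 a le_rfl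
  refine ⟨c, fun x => ?_⟩
  obtain ⟨b, hb⟩ := exists_rad_gt (p := p) x.2.2
  have hab : ‖a.1‖ ≤ ‖b.1‖ := x.2.1.trans hb.le
  obtain ⟨c', hc'⟩ := h1 b hab
  have : c = c' := by
    funext n
    refine sub_eq_zero.1 (coeff_eq_zero_of_circle (a := a) (c := fun n => c n - c' n)
      (fun y hy => ?_) n)
    have := (hc ⟨y, hy.ge, hy.le⟩).sub (hc' ⟨y, hy.ge, hy.le.trans hab⟩)
    simp only [← sub_smul] at this
    rwa [show Annulus.incl ⟨y, hy.ge, hy.le⟩ = Annulus.incl ⟨y, hy.ge, hy.le.trans hab⟩ from rfl,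
      sub_self] at this
  rw [this]
  exact hc' ⟨x.1, x.2.1, hb.le⟩

theorem exists_OAlg_of_hasSum {a : Rad p} {c : ℤ → ℚ_[p]} {f : ℂ_[p] → ℂ_[p]}
    (h : ∀ x : Omega a, HasSum (fun n => c n • x.1 ^ n) (f x.1)) :
    ∃ F : OAlg a, ∀ x, F.1 x = f x.1 := by
  refine ⟨⟨fun x => f x.1, mem_OAlg_of_frequently fun r hr => ?_⟩, fun _ => rfl⟩
  obtain ⟨b, hb⟩ := exists_rad_gt (p := p) (max_lt hr a.2.2)
  have hab : ‖a.1‖ ≤ ‖b.1‖ := ((le_max_right _ _).trans hb.le)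
  obtain ⟨g, hg⟩ := exists_of_pointwise (h ⟨a.1, le_rfl, a.2.2⟩).summable
    (h ⟨b.1, hab, b.2.2⟩).summable
  exact ⟨b, (le_max_left _ _).trans_lt hb, g, fun x => (hasSum_ev hg x).unique (h x.incl)⟩

/-- Restriction to a smaller half-open annulus. -/
def resO {a a' : Rad p} (h : ‖a.1‖ ≤ ‖a'.1‖) : OAlg a →ₐ[ℚ_[p]] OAlg a' where
  toFun f := ⟨fun x => f.1 ⟨x.1, h.trans x.2.1, x.2.2⟩, fun b =>
    ⟨res h le_rfl (toAnn b f), fun x => by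
      rw [ev_res, ev_toAnn]
      rfl⟩⟩
  map_one' := rfl
  map_mul' _ _ := rfl
  map_zero' := rfl
  map_add' _ _ := rfl
  commutes' _ := rfl

theorem resO_apply {a a' : Rad p} (h : ‖a.1‖ ≤ ‖a'.1‖) (f : OAlg a) (x : Omega a') :
    (resO h f).1 x = f.1 ⟨x.1, h.trans x.2.1, x.2.2⟩ := rfl

theorem OAlg.ext {a : Rad p} {f g : OAlg a} (h : ∀ x, f.1 x = g.1 x) : f = g :=
  Subtype.ext (funext h)

/-! ### Analytic functions on half-open annuli as elements of the Robba ring. -/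

open Classical in
/-- Extension by zero of a function on a half-open annulus. -/
def extFun {a : Rad p} (f : OAlg a) (x : ℂ_[p]) : ℂ_[p] :=
  if h : ‖a.1‖ ≤ ‖x‖ ∧ ‖x‖ < 1 then f.1 ⟨x, h⟩ else 0

theorem extFun_apply {a : Rad p} (f : OAlg a) (x : Omega a) : extFun f x.1 = f.1 x :=
  dif_pos x.2

theorem eventually_Omega (a : Rad p) : ∀ᶠ x : ℂ_[p] in bdry p, ‖a.1‖ ≤ ‖x‖ ∧ ‖x‖ < 1 :=
  ((eventually_gt_bdry a.2.2).mono fun _ h => h.le).and eventually_lt_one_bdry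

theorem hasLaurentExpansion_extFun {a : Rad p} (f : OAlg a) :
    ∃ c, HasLaurentExpansion p c (extFun f) := by
  obtain ⟨c, hc⟩ := exists_expansion_OAlg f
  refine ⟨c, (eventually_Omega a).mono fun x hx => ?_⟩
  have := hc ⟨x, hx⟩
  rwa [← extFun_apply] at this

/-- The element of the Robba ring given by an analytic function on a half-open annulus. -/
def toR (a : Rad p) : OAlg a →+* RobbaRing p where
  toFun f := ⟨(extFun f : (bdry p).Germ ℂ_[p]), extFun f, (hasLaurentExpansion_extFun f).choose,
    rfl, (hasLaurentExpansion_extFun f).choose_spec⟩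
  map_one' := Subtype.ext (Germ.coe_eq.2 ((eventually_Omega a).mono fun x hx =>
    extFun_apply 1 ⟨x, hx⟩))
  map_mul' f g := Subtype.ext (Germ.coe_eq.2 ((eventually_Omega a).mono fun x hx => by
    rw [extFun_apply _ ⟨x, hx⟩]
    exact congrArg₂ (· * ·) (extFun_apply f ⟨x, hx⟩).symm (extFun_apply g ⟨x, hx⟩).symm))
  map_zero' := Subtype.ext (Germ.coe_eq.2 ((eventually_Omega a).mono fun x hx =>
    extFun_apply 0 ⟨x, hx⟩))
  map_add' f g := Subtype.ext (Germ.coe_eq.2 ((eventually_Omega a).mono fun x hx => by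
    rw [extFun_apply _ ⟨x, hx⟩]
    exact congrArg₂ (· + ·) (extFun_apply f ⟨x, hx⟩).symm (extFun_apply g ⟨x, hx⟩).symm))

/-- A function representing an element of the Robba ring. -/
def rep (f : RobbaRing p) : ℂ_[p] → ℂ_[p] := f.2.choose

theorem coe_rep (f : RobbaRing p) : (rep f : (bdry p).Germ ℂ_[p]) = f.1 :=
  f.2.choose_spec.choose_spec.1

theorem rep_eq_iff {f g : RobbaRing p} : f = g ↔ ∀ᶠ x in bdry p, rep f x = rep g x := by
  rw [Subtype.ext_iff, ← coe_rep, ← coe_rep, Germ.coe_eq]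
  rfl

theorem rep_add (f g : RobbaRing p) : ∀ᶠ x in bdry p, rep (f + g) x = rep f x + rep g x := by
  refine Germ.coe_eq.1 ?_
  change _ = (rep f : (bdry p).Germ ℂ_[p]) + rep g
  rw [coe_rep, coe_rep, coe_rep]
  rfl

theorem rep_mul (f g : RobbaRing p) : ∀ᶠ x in bdry p, rep (f * g) x = rep f x * rep g x := by
  refine Germ.coe_eq.1 ?_
  change _ = (rep f : (bdry p).Germ ℂ_[p]) * rep g
  rw [coe_rep, coe_rep, coe_rep]
  rfl

theorem rep_zero : ∀ᶠ x in bdry p, rep (0 : RobbaRing p) x = 0 := by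
  refine Germ.coe_eq.1 ?_
  rw [coe_rep]
  rfl

theorem rep_sum {ι : Type*} (s : Finset ι) (f : ι → RobbaRing p) :
    ∀ᶠ x in bdry p, rep (∑ i ∈ s, f i) x = ∑ i ∈ s, rep (f i) x := by
  classical
  induction s using Finset.induction_on with
  | empty => simpa using rep_zero
  | insert i s hi ih =>
    rw [Finset.sum_insert hi]
    filter_upwards [ih, rep_add (f i) (∑ i ∈ s, f i)] with x h1 h2
    rw [h2, h1, Finset.sum_insert hi]

theorem rep_toR {a : Rad p} (f : OAlg a) : ∀ᶠ x in bdry p, rep (toR a f) x = extFun f x :=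
  Germ.coe_eq.1 (coe_rep _)

theorem rep_tElt : ∀ᶠ x in bdry p, rep (tElt p) x = logFun p x :=
  Germ.coe_eq.1 (coe_rep _)

theorem rep_substHom {w : ℂ_[p] → ℂ_[p]} {k : ℕ} {e : ℤ} {θ : ℝ} {G : PowerSeries ℚ_[p]}
    (hw : IsSubst p w k e θ G) (f : RobbaRing p) :
    ∀ᶠ x in bdry p, rep (substHom w hw f) x = rep f (w x) := by
  refine Germ.coe_eq.1 ?_
  rw [coe_rep]
  change germComp w hw.tendsto f.1 = _
  rw [← coe_rep]
  rfl

theorem rep_frob (f : RobbaRing p) : ∀ᶠ x in bdry p, rep (frob p f) x = rep f (frobFun p x) :=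
  rep_substHom _ f

theorem rep_gammaHom (u : ℤ_[p]ˣ) (f : RobbaRing p) :
    ∀ᶠ x in bdry p, rep (gammaHom u f) x = rep f (gammaFun (u : ℤ_[p]) x) :=
  rep_substHom _ f

/-- Every element of the Robba ring extends to all half-open annuli close to the boundary. -/
theorem exists_lift (f : RobbaRing p) : ∀ᶠ y in bdry p, ∀ a : Rad p, ‖a.1‖ = ‖y‖ →
    ∃ F : OAlg a, toR a F = f ∧ ∀ x, F.1 x = rep f x.1 := by
  obtain ⟨g, c, hg, hc⟩ := f.2
  have h1 : ∀ᶠ x in bdry p, g x = rep f x := Germ.coe_eq.1 (hg.trans (coe_rep f).symm)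
  obtain ⟨r, hr, h⟩ := eventually_bdry_iff.1 (hc.and h1)
  filter_upwards [eventually_gt_bdry hr] with y hy a ha
  have hra : r < ‖a.1‖ := ha ▸ hy
  obtain ⟨F, hF⟩ := exists_OAlg_of_hasSum (a := a) (c := c) (f := g) fun x =>
    (h x.1 (hra.trans_le x.2.1) x.2.2).1
  have hF' : ∀ x, F.1 x = rep f x.1 := fun x => by
    rw [hF, (h x.1 (hra.trans_le x.2.1) x.2.2).2]
  refine ⟨F, rep_eq_iff.2 ?_, hF'⟩
  filter_upwards [rep_toR F, eventually_Omega a] with x h2 h3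
  rw [h2, extFun_apply F ⟨x, h3⟩, hF']

theorem eq_of_eventually {a : Rad p} {f g : OAlg a}
    (h : ∀ᶠ x in bdry p, extFun f x = extFun g x) : f = g := by
  obtain ⟨r, hr, h⟩ := eventually_bdry_iff.1 h
  obtain ⟨c, hc⟩ := exists_expansion_OAlg (f - g)
  obtain ⟨b, hb⟩ := exists_rad_gt (p := p) (max_lt hr a.2.2)
  have hc0 : ∀ n, c n = 0 := coeff_eq_zero_of_circle (a := b) fun x hx => by
    have hx1 : ‖a.1‖ ≤ ‖x‖ ∧ ‖x‖ < 1 := ⟨hx ▸ (le_max_right _ _).trans hb.le, hx ▸ b.2.2⟩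
    have h1 := hc ⟨x, hx1⟩
    have h2 := h x (hx ▸ (le_max_left _ _).trans_lt hb) hx1.2
    rw [extFun_apply f ⟨x, hx1⟩, extFun_apply g ⟨x, hx1⟩] at h2
    have h3 : (f - g).1 ⟨x, hx1⟩ = 0 := sub_eq_zero.2 h2
    rwa [h3] at h1
  refine OAlg.ext fun x => sub_eq_zero.1 ?_
  have h1 := hc x
  simp only [hc0, zero_smul] at h1
  exact (hasSum_zero.unique h1).symm

theorem toR_injective (a : Rad p) : Function.Injective (toR a) := fun f g h =>
  eq_of_eventually (by
    filter_upwards [rep_toR f, rep_toR g] with x h1 h2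
    rw [← h1, ← h2, h])

theorem toR_resO {a a' : Rad p} (h : ‖a.1‖ ≤ ‖a'.1‖) (f : OAlg a) :
    toR a' (resO h f) = toR a f := by
  refine Subtype.ext (Germ.coe_eq.2 ((eventually_Omega a').mono fun x hx => ?_))
  rw [extFun_apply (resO h f) ⟨x, hx⟩, extFun_apply f ⟨x, h.trans hx.1, hx.2⟩, resO_apply]

theorem exists_logO (a : Rad p) : ∃ f : OAlg a, ∀ x, f.1 x = logFun p x.1 :=
  exists_OAlg_of_hasSum fun x => hasSum_logCoeff x.2.2

/-- The logarithm as an analytic function on a half-open annulus. -/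
def logO (a : Rad p) : OAlg a := (exists_logO a).choose

@[simp] theorem logO_apply {a : Rad p} (x : Omega a) : (logO a).1 x = logFun p x.1 :=
  (exists_logO a).choose_spec x

theorem toAnn_logO (a b : Rad p) : toAnn b (logO a) = logA a b :=
  AnnAlg.ext fun x => by rw [ev_toAnn, logO_apply, ev_logA]; rfl

theorem toR_logO (a : Rad p) : toR a (logO a) = tElt p := by
  refine Subtype.ext (Germ.coe_eq.2 ((eventually_Omega a).mono fun x hx => ?_))
  rw [extFun_apply _ ⟨x, hx⟩, logO_apply]

theorem frob_tElt : frob p (tElt p) = (p : RobbaRing p) * tElt p := by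
  refine Subtype.ext (Germ.coe_eq.2 (eventually_lt_one_bdry.mono fun x hx => ?_))
  exact log_frobFun hx

theorem isUnit_natCast_robba {n : ℕ} (hn : n ≠ 0) : IsUnit (n : RobbaRing p) := by
  have h : IsUnit ((n : ℚ_[p])) := IsUnit.mk0 _ (by exact_mod_cast hn)
  obtain ⟨a, -⟩ := exists_rad_gt (p := p) one_pos
  have := (h.map (algebraMap ℚ_[p] (OAlg a))).map (toR a)
  rwa [map_natCast, map_natCast] at this

/-- The constants of the Robba ring. -/
def constR (c : ℚ_[p]) : RobbaRing p :=
  ⟨((fun _ => algebraMap ℚ_[p] ℂ_[p] c : ℂ_[p] → ℂ_[p]) : (bdry p).Germ ℂ_[p]), _, _, rfl, by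
    simpa [Algebra.smul_def] using hasLaurentExpansion_const c⟩

theorem toR_algebraMap (a : Rad p) (c : ℚ_[p]) : toR a (algebraMap _ _ c) = constR c :=
  Subtype.ext (Germ.coe_eq.2 ((eventually_Omega a).mono fun x hx =>
    extFun_apply (algebraMap ℚ_[p] (OAlg a) c) ⟨x, hx⟩))

theorem gammaHom_tElt (u : ℤ_[p]ˣ) :
    gammaHom u (tElt p) = constR ((u : ℤ_[p]) : ℚ_[p]) * tElt p := by
  refine Subtype.ext (Germ.coe_eq.2 (eventually_lt_one_bdry.mono fun x hx => ?_))
  refine (log_gammaFun (u : ℤ_[p]) hx).trans ?_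
  rw [Algebra.smul_def]

/-! ### Divisibility on half-open annuli -/

theorem toAnn_injective {a b : Rad p} (hab : ‖a.1‖ ≤ ‖b.1‖) :
    Function.Injective (toAnn (a := a) b) := by
  refine (injective_iff_map_eq_zero _).2 fun f hf => ?_
  obtain ⟨c, hc⟩ := exists_expansion_OAlg f
  have hc0 : ∀ n, c n = 0 := coeff_eq_zero_of_circle (a := a) fun x hx => by
    have h1 := hc ⟨x, hx.ge, hx ▸ a.2.2⟩
    have h2 := ev_toAnn f (⟨x, hx.ge, hx.le.trans hab⟩ : Annulus a b)
    rw [hf, map_zero] at h2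
    have h3 : f.1 ⟨x, hx.ge, hx ▸ a.2.2⟩ = 0 := h2.symm
    rwa [h3] at h1
  refine OAlg.ext fun x => ?_
  have h1 := hc x
  simp only [hc0, zero_smul] at h1
  exact (hasSum_zero.unique h1).symm

theorem logA_mul_cancel {a b : Rad p} (hab : ‖a.1‖ ≤ ‖b.1‖) (ha : Good a) (hb : Good b)
    {f g : AnnAlg a b} (h : logA a b * f = logA a b * g) : f = g := by
  obtain ⟨c, hc, hmul⟩ := exists_norm_mul_ge hab (f := logA a b) (by
    intro x hx h0
    rw [ev_logA] at h0
    rcases hx with hx | hx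
    · exact ha _ hx h0
    · exact hb _ hx h0)
  have h1 := hmul (f - g)
  rw [mul_sub, h, sub_self, norm_zero] at h1
  exact sub_eq_zero.1 (norm_le_zero_iff.1 (nonpos_of_mul_nonpos_right h1 hc))

theorem res_logA {a b b' : Rad p} (h : ‖b.1‖ ≤ ‖b'.1‖) :
    res le_rfl h (logA a b') = logA a b :=
  AnnAlg.ext fun x => by rw [ev_res, ev_logA, ev_logA]

theorem res_toAnn {a b b' : Rad p} (h : ‖b.1‖ ≤ ‖b'.1‖) (f : OAlg a) :
    res le_rfl h (toAnn b' f) = toAnn b f :=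
  AnnAlg.ext fun x => by
    rw [ev_res, ev_toAnn, ev_toAnn]
    rfl

/-- The quotients on closed annuli with good outer circle are unique, because multiplication by the
logarithm is injective there. They are therefore compatible under restriction and glue. -/
theorem logO_dvd_of_forall_zero {a : Rad p} (ha : Good a) {f : OAlg a}
    (hf : ∀ x : Omega a, logFun p x.1 = 0 → f.1 x = 0) : logO a ∣ f := by
  have h1 : ∀ b : Rad p, Good b → ‖a.1‖ ≤ ‖b.1‖ → ∃ q : AnnAlg a b,
      toAnn b f = logA a b * q := fun b hb hab =>
    log_dvd_of_forall_zero hab ha hb fun x hx => by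
      rw [ev_toAnn]
      exact hf _ hx
  choose q hq using h1
  have hqq : ∀ (b b' : Rad p) (hb : Good b) (hb' : Good b') (hab : ‖a.1‖ ≤ ‖b.1‖)
      (hab' : ‖a.1‖ ≤ ‖b'.1‖) (h : ‖b.1‖ ≤ ‖b'.1‖),
      res le_rfl h (q b' hb' hab') = q b hb hab := by
    intro b b' hb hb' hab hab' h
    refine logA_mul_cancel hab ha hb ?_
    rw [← hq, ← res_logA h, ← map_mul, ← hq, res_toAnn]
  have hex : ∀ x : Omega a, ∃ b : Rad p, Good b ∧ ‖x.1‖ < ‖b.1‖ := fun x => exists_good x.2.2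
  choose B hBg hBx using hex
  let g : Omega a → ℂ_[p] := fun x =>
    ev ⟨x.1, x.2.1, (hBx x).le⟩ (q (B x) (hBg x) (x.2.1.trans (hBx x).le))
  have hg : ∀ (b : Rad p) (hb : Good b) (hab : ‖a.1‖ ≤ ‖b.1‖) (x : Annulus a b),
      ev x (q b hb hab) = g x.incl := by
    intro b hb hab x
    rcases le_total ‖b.1‖ ‖(B x.incl).1‖ with h | h
    · rw [← hqq b (B x.incl) hb (hBg _) hab (x.2.1.trans (hBx x.incl).le) h, ev_res]
      rfl
    · have := hqq (B x.incl) b (hBg _) hb (x.2.1.trans (hBx x.incl).le) hab h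
      simp only [g]
      rw [← this, ev_res]
      rfl
  have hmem : g ∈ OAlg a := mem_OAlg_of_frequently fun r hr => by
    obtain ⟨b, hb, hrb⟩ := exists_good (p := p) (max_lt hr a.2.2)
    exact ⟨b, (le_max_left _ _).trans_lt hrb, q b hb ((le_max_right _ _).trans hrb.le),
      hg b hb _⟩
  refine ⟨⟨g, hmem⟩, OAlg.ext fun x => ?_⟩
  have h2 := ev_toAnn f (⟨x.1, x.2.1, (hBx x).le⟩ : Annulus a (B x))
  rw [hq _ (hBg x) (x.2.1.trans (hBx x).le), map_mul, ev_logA] at h2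
  refine h2.symm.trans ?_
  change _ = (logO a).1 x * g x
  rw [logO_apply]

/-- The zero x is essential: without one the logarithm would be a unit. Restriction to a good closed
annulus containing x is injective and reduces to that case. -/
theorem eq_zero_of_forall_logO_pow_dvd {a : Rad p} (ha : Good a) {f : OAlg a}
    (hf : ∀ k, logO a ^ k ∣ f) {x : Omega a} (hx : logFun p x.1 = 0) : f = 0 := by
  obtain ⟨b, hb, hxb⟩ := exists_good (p := p) x.2.2
  have hab : ‖a.1‖ ≤ ‖b.1‖ := x.2.1.trans hxb.le
  refine toAnn_injective hab ?_
  rw [map_zero]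
  refine eq_zero_of_forall_log_pow_dvd hab ha hb (fun k => ?_)
    (x := ⟨x.1, x.2.1, hxb.le⟩) hx
  rw [← toAnn_logO, ← map_pow]
  exact map_dvd _ (hf k)

theorem logO_mul_cancel {a : Rad p} (ha : Good a) {f g : OAlg a}
    (h : logO a * f = logO a * g) : f = g := by
  refine toAnn_injective (a := a) (b := a) le_rfl (logA_mul_cancel le_rfl ha ha ?_)
  rw [← toAnn_logO, ← map_mul, ← map_mul, h]

/-! ### Functions without common zeros generate the unit ideal -/

theorem exists_radii (a : Rad p) : ∃ b : ℕ → Rad p, (∀ n, ‖a.1‖ ≤ ‖(b n).1‖) ∧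
    Monotone (fun n => ‖(b n).1‖) ∧ ∀ r < (1 : ℝ), ∃ n, r < ‖(b n).1‖ := by
  have hstep : ∀ (c : Rad p) (n : ℕ), ∃ d : Rad p, ‖c.1‖ < ‖d.1‖ ∧
      1 - 1 / ((n : ℝ) + 1) < ‖d.1‖ := fun c n => by
    have h1 : 1 - 1 / ((n : ℝ) + 1) < 1 := by
      have : (0 : ℝ) < 1 / ((n : ℝ) + 1) := by positivity
      linarith
    obtain ⟨d, hd⟩ := exists_rad_gt (p := p) (max_lt c.2.2 h1)
    exact ⟨d, (le_max_left _ _).trans_lt hd, (le_max_right _ _).trans_lt hd⟩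
  choose s hs1 hs2 using hstep
  let b : ℕ → Rad p := fun n => Nat.rec a (fun n c => s c n) n
  have hmono : Monotone (fun n => ‖(b n).1‖) :=
    monotone_nat_of_le_succ fun n => (hs1 (b n) n).le
  refine ⟨b, fun n => hmono (Nat.zero_le n), hmono, fun r hr => ?_⟩
  obtain ⟨n, hn⟩ := exists_nat_one_div_lt (sub_pos.2 hr)
  refine ⟨n + 1, lt_trans ?_ (hs2 (b n) n)⟩
  linarith

section Lifting

variable {ι : Type*} [Fintype ι]

/-- Two solutions of the Bézout equation on the smaller annulus differ by a syzygy `d`, and d is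
Koszul: d_i = ∑_j (d_i c_j - d_j c_i) F_j. Approximating the products d_i c_j by Laurent
polynomials, which extend to the larger annulus, changes a solution there into one that is close to
`c` on the smaller annulus. -/
theorem exists_correction {a b b' : Rad p} (hab : ‖a.1‖ ≤ ‖b.1‖) (hbb : ‖b.1‖ ≤ ‖b'.1‖)
    (F : ι → OAlg a) (hF : ∀ x, ∃ i, (F i).1 x ≠ 0) (c : ι → AnnAlg a b)
    (hc : ∑ i, c i * toAnn b (F i) = 1) {ε : ℝ} (hε : 0 < ε) :
    ∃ c' : ι → AnnAlg a b', ∑ i, c' i * toAnn b' (F i) = 1 ∧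
      ∀ i, ‖res le_rfl hbb (c' i) - c i‖ ≤ ε := by
  have hspan := span_eq_top_of_forall_exists_ne_zero (hab.trans hbb)
    (F := fun i => toAnn b' (F i)) fun x => by
      obtain ⟨i, hi⟩ := hF x.incl
      exact ⟨i, by rwa [ev_toAnn]⟩
  obtain ⟨c₀, hc₀⟩ := Ideal.mem_span_range_iff_exists_fun.1 ((Ideal.eq_top_iff_one _).1 hspan)
  set d : ι → AnnAlg a b := fun i => res le_rfl hbb (c₀ i) - c i with hd
  have hd0 : ∑ i, d i * toAnn b (F i) = 0 := by
    have := congrArg (res (le_refl ‖a.1‖) hbb) hc₀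
    rw [map_sum, map_one] at this
    simp only [map_mul, res_toAnn] at this
    simp only [hd, sub_mul, Finset.sum_sub_distrib, this, hc, sub_self]
  obtain ⟨M, hM0, hM⟩ : ∃ M : ℝ, 0 < M ∧ ∀ i, ‖toAnn b (F i)‖ ≤ M := by
    refine ⟨1 + ∑ i, ‖toAnn b (F i)‖, ?_, fun i => ?_⟩
    · have : 0 ≤ ∑ i, ‖toAnn b (F i)‖ := Finset.sum_nonneg fun i _ => norm_nonneg _
      linarith
    · have := Finset.single_le_sum (f := fun i => ‖toAnn b (F i)‖)
        (fun i _ => norm_nonneg _) (Finset.mem_univ i)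
      linarith
  choose l hl using fun i j => exists_lpoly_approx (d i * c j) (div_pos hε hM0)
  refine ⟨fun i => c₀ i - ∑ j, (lpoly a b' (l i j) - lpoly a b' (l j i)) * toAnn b' (F j), ?_,
    fun i => ?_⟩
  -- The correction is antisymmetric in i and j, so it cancels in ∑ c_i F_i.
  · simp only [sub_mul, Finset.sum_sub_distrib, hc₀, Finset.sum_mul, sub_eq_self]
    rw [sub_eq_zero]
    conv_rhs => rw [Finset.sum_comm]
    refine Finset.sum_congr rfl fun i _ => Finset.sum_congr rfl fun j _ => ?_
    ring
  · have hdi : d i = ∑ j, (d i * c j - d j * c i) * toAnn b (F j) := by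
      have h1 : d i = d i * ∑ j, c j * toAnn b (F j) := by rw [hc, mul_one]
      have h2 : c i * ∑ j, d j * toAnn b (F j) = 0 := by rw [hd0, mul_zero]
      have h3 : d i = d i * (∑ j, c j * toAnn b (F j)) - c i * ∑ j, d j * toAnn b (F j) := by
        rw [h2, sub_zero]
        exact h1
      refine h3.trans ?_
      rw [Finset.mul_sum, Finset.mul_sum, ← Finset.sum_sub_distrib]
      refine Finset.sum_congr rfl fun j _ => ?_
      ring
    have hkey : res le_rfl hbb (c₀ i - ∑ j, (lpoly a b' (l i j) - lpoly a b' (l j i)) *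
        toAnn b' (F j)) - c i = ∑ j, ((d i * c j - lpoly a b (l i j)) -
          (d j * c i - lpoly a b (l j i))) * toAnn b (F j) := by
      rw [map_sub, map_sum]
      simp only [map_mul, map_sub, res_toAnn, res_lpoly]
      rw [sub_right_comm]
      change d i - _ = _
      nth_rewrite 1 [hdi]
      rw [← Finset.sum_sub_distrib]
      refine Finset.sum_congr rfl fun j _ => ?_
      ring
    rw [hkey]
    refine IsUltrametricDist.norm_sum_le_of_forall_le_of_nonneg hε.le fun j _ => ?_
    refine (norm_mul_le _ _).trans ?_
    have h3 := (norm_sub_le_max (d i * c j - lpoly a b (l i j))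
      (d j * c i - lpoly a b (l j i))).trans (max_le (hl i j).le (hl j i).le)
    calc _ ≤ ε / M * M := mul_le_mul h3 (hM j) (norm_nonneg _) (by positivity)
      _ = ε := div_mul_cancel₀ _ hM0.ne'

open Classical in
/-- Extension by zero of a function on a closed annulus. -/
def extA {a b : Rad p} (f : AnnAlg a b) (x : ℂ_[p]) : ℂ_[p] :=
  if h : ‖a.1‖ ≤ ‖x‖ ∧ ‖x‖ ≤ ‖b.1‖ then ev ⟨x, h⟩ f else 0

theorem extA_apply {a b : Rad p} (f : AnnAlg a b) (x : Annulus a b) : extA f x.1 = ev x f :=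
  dif_pos x.2

/-- Gluing of analytic functions on an exhausting sequence of closed annuli that differ little from
each other. -/
theorem exists_limit {a : Rad p} {b : ℕ → Rad p} (hmono : Monotone fun n => ‖(b n).1‖)
    (hlim : ∀ r < (1 : ℝ), ∃ n, r < ‖(b n).1‖) (c : ∀ n, AnnAlg a (b n))
    (hc : ∀ n, ‖res le_rfl (hmono n.le_succ) (c (n + 1)) - c n‖ ≤ (1 / 2) ^ n) :
    ∃ f : OAlg a, ∀ x : Omega a, Tendsto (fun n => extA (c n) x.1) atTop (𝓝 (f.1 x)) := by
  have hN : ∀ N, ∃ e : AnnAlg a (b N), ∀ x : Annulus a (b N),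
      Tendsto (fun n => extA (c n) x.1) atTop (𝓝 (ev x e)) := by
    intro N
    let u : ℕ → AnnAlg a (b N) := fun k => res le_rfl (hmono (Nat.le_add_right N k)) (c (N + k))
    have hu : CauchySeq u := by
      refine cauchySeq_of_le_geometric (1 / 2) 1 (by norm_num) fun k => ?_
      rw [dist_comm, dist_eq_norm, one_mul]
      have h1 : u (k + 1) - u k = res le_rfl (hmono (Nat.le_add_right N k))
          (res le_rfl (hmono (N + k).le_succ) (c (N + k + 1)) - c (N + k)) := by
        refine AnnAlg.ext fun x => ?_
        simp only [u, map_sub, ev_res]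
        rfl
      rw [h1]
      refine (norm_res_le _ _ _).trans ((hc (N + k)).trans ?_)
      exact pow_le_pow_of_le_one (by norm_num) (by norm_num) (Nat.le_add_left k N)
    obtain ⟨e, he⟩ := cauchySeq_tendsto_of_complete hu
    refine ⟨e, fun x => (tendsto_add_atTop_iff_nat N).1 ?_⟩
    refine (((continuous_ev x).tendsto e).comp he).congr fun k => ?_
    simp only [u, Function.comp_apply, ev_res]
    rw [add_comm k N]
    exact (extA_apply (c (N + k))
      ⟨x.1, x.2.1, x.2.2.trans (hmono (Nat.le_add_right N k))⟩).symm
  choose e he using hN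
  choose N hN using fun x : Omega a => hlim ‖x.1‖ x.2.2
  refine ⟨⟨fun x => ev ⟨x.1, x.2.1, (hN x).le⟩ (e (N x)), mem_OAlg_of_frequently fun r hr => ?_⟩,
    fun x => he (N x) ⟨x.1, x.2.1, (hN x).le⟩⟩
  obtain ⟨n, hn⟩ := hlim r hr
  refine ⟨b n, hn, e n, fun x => ?_⟩
  exact tendsto_nhds_unique (he n x)
    (he (N x.incl) ⟨x.1, x.2.1, (hN x.incl).le⟩)

/-- Mittag-Leffler: solutions exist on each closed annulus by the Nullstellensatz, and each can be
chosen within 2^{-n} of the preceding one, so they converge on the half-open annulus. -/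
theorem exists_sum_mul_eq_one {a : Rad p} (F : ι → OAlg a) (hF : ∀ x, ∃ i, (F i).1 x ≠ 0) :
    ∃ c : ι → OAlg a, ∑ i, c i * F i = 1 := by
  obtain ⟨b, hab, hmono, hlim⟩ := exists_radii a
  let Sol : ℕ → Type _ := fun n => {c : ι → AnnAlg a (b n) // ∑ i, c i * toAnn (b n) (F i) = 1}
  have h0 : Nonempty (Sol 0) := by
    have hspan := span_eq_top_of_forall_exists_ne_zero (hab 0)
      (F := fun i => toAnn (b 0) (F i)) fun x => by
        obtain ⟨i, hi⟩ := hF x.incl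
        exact ⟨i, by rwa [ev_toAnn]⟩
    obtain ⟨c₀, hc₀⟩ :=
      Ideal.mem_span_range_iff_exists_fun.1 ((Ideal.eq_top_iff_one _).1 hspan)
    exact ⟨⟨c₀, hc₀⟩⟩
  have hstep : ∀ (n : ℕ) (c : Sol n), ∃ c' : Sol (n + 1), ∀ i,
      ‖res le_rfl (hmono n.le_succ) (c'.1 i) - c.1 i‖ ≤ (1 / 2) ^ n := by
    intro n c
    obtain ⟨c', h1, h2⟩ := exists_correction (hab n) (hmono n.le_succ) F hF c.1 c.2
      (ε := (1 / 2) ^ n) (by positivity)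
    exact ⟨⟨c', h1⟩, h2⟩
  choose s hs using hstep
  let c : ∀ n, Sol n := fun n => Nat.rec h0.some (fun n c => s n c) n
  have hc : ∀ n i, ‖res le_rfl (hmono n.le_succ) ((c (n + 1)).1 i) - (c n).1 i‖ ≤ (1 / 2) ^ n :=
    fun n i => hs n (c n) i
  choose f hf using fun i => exists_limit hmono hlim (fun n => (c n).1 i) fun n => hc n i
  refine ⟨f, OAlg.ext fun x => ?_⟩
  have h1 : Tendsto (fun n => ∑ i, extA ((c n).1 i) x.1 * (F i).1 x) atTop
      (𝓝 (∑ i, (f i).1 x * (F i).1 x)) :=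
    tendsto_finsetSum _ fun i _ => (hf i x).mul_const _
  obtain ⟨N, hN⟩ := hlim ‖x.1‖ x.2.2
  have h2 : Tendsto (fun n => ∑ i, extA ((c n).1 i) x.1 * (F i).1 x) atTop (𝓝 1) := by
    refine tendsto_const_nhds.congr' ?_
    filter_upwards [eventually_ge_atTop N] with n hn
    let y : Annulus a (b n) := ⟨x.1, x.2.1, hN.le.trans (hmono hn)⟩
    have h3 := congrArg (ev y) (c n).2
    rw [map_sum, map_one] at h3
    rw [← h3]
    refine Finset.sum_congr rfl fun i _ => ?_
    rw [map_mul, ev_toAnn, ← extA_apply]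
    rfl
  have h3 := tendsto_nhds_unique h1 h2
  have h4 : (∑ i, f i * F i : OAlg a).1 x = ∑ i, (f i).1 x * (F i).1 x := by
    rw [AddSubmonoidClass.coe_finsetSum, Finset.sum_apply]
    rfl
  rw [h4, h3]
  rfl

end Lifting

/-! ### Ideals stable under Frobenius and `Γ` -/

theorem norm_gammaFun (u : ℤ_[p]ˣ) {x : ℂ_[p]} (hx : ‖x‖ < 1) :
    ‖gammaFun (u : ℤ_[p]) x‖ = ‖x‖ := by
  have h := gammaFun_isSubst u
  have h1 : gammaFun (u : ℤ_[p]) x = x * evalPS (gammaPS (u : ℤ_[p])) x := by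
    rw [gammaFun, evalPS, ← tsum_mul_left]
    refine tsum_congr fun n => ?_
    rw [gammaPS, PowerSeries.coeff_mk, mul_smul_comm, pow_succ']
  rw [h1, norm_mul, norm_evalPS zero_le_one h.isBdd h.norm_coeff_zero (by rwa [one_mul]), mul_one]

theorem norm_eq_nhds {x : ℂ_[p]} (hx : x ≠ 0) : ∀ᶠ y in 𝓝 x, ‖y‖ = ‖x‖ := by
  filter_upwards [Metric.ball_mem_nhds x (norm_pos_iff.2 hx)] with y hy
  rw [mem_ball_iff_norm] at hy
  have := norm_add_eq_left hy
  rwa [add_sub_cancel] at this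

theorem Omega.ne_zero {a : Rad p} (x : Omega a) : x.1 ≠ 0 := norm_pos_iff.1 (a.pos.trans_le x.2.1)

theorem continuousAt_extFun {a : Rad p} (f : OAlg a) (x : Omega a) :
    ContinuousAt (extFun f) x.1 := by
  obtain ⟨b, hb⟩ := exists_rad_gt (p := p) x.2.2
  set S : Set ℂ_[p] := {y | ‖a.1‖ ≤ ‖y‖ ∧ ‖y‖ ≤ ‖b.1‖} with hS
  have hmem : S ∈ 𝓝 x.1 := by
    filter_upwards [norm_eq_nhds x.ne_zero] with y hy
    exact ⟨hy ▸ x.2.1, hy ▸ hb.le⟩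
  refine ContinuousOn.continuousAt ?_ hmem
  rw [continuousOn_iff_continuous_domRestrict]
  refine (toAnn b f).1.continuous.congr fun y => ?_
  exact (ev_toAnn f y).trans (extFun_apply f (Annulus.incl y)).symm

theorem eventually_log_ne_zero {a : Rad p} (x : Omega a) :
    ∀ᶠ y in 𝓝[≠] x.1, logFun p y ≠ 0 := by
  obtain ⟨b, hb⟩ := exists_rad_gt (p := p) x.2.2
  have hab : ‖a.1‖ < ‖b.1‖ := x.2.1.trans_lt hb
  have hfin := ((finite_zeros hab.le (logA_ne_zero hab)).image Subtype.val).subset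
    (Set.sdiff_subset (t := {x.1}))
  have h1 : ∀ᶠ y in 𝓝 x.1, y ∉ Subtype.val '' {x : Annulus a b | ev x (logA a b) = 0} \ {x.1} :=
    hfin.isClosed.isOpen_compl.mem_nhds fun h => h.2 rfl
  filter_upwards [nhdsWithin_le_nhds h1, nhdsWithin_le_nhds (norm_eq_nhds x.ne_zero),
    self_mem_nhdsWithin] with y hy hn hne h0
  refine hy ⟨⟨⟨y, hn ▸ x.2.1, hn ▸ hb.le⟩, ?_, rfl⟩, hne⟩
  change ev _ _ = 0
  rw [ev_logA, h0]

/-- Two functions continuous at a point agree there if they agree at the nearby points where the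
logarithm does not vanish. -/
theorem eq_of_forall_log_ne_zero {a : Rad p} (x : Omega a) {f g : ℂ_[p] → ℂ_[p]}
    (hf : ContinuousAt f x.1) (hg : ContinuousAt g x.1)
    (h : ∀ᶠ y in 𝓝[≠] x.1, logFun p y ≠ 0 → f y = g y) : f x.1 = g x.1 := by
  refine tendsto_nhds_unique ((hf.tendsto.mono_left nhdsWithin_le_nhds : Tendsto f (𝓝[≠] x.1) _))
    ((hg.tendsto.mono_left nhdsWithin_le_nhds : Tendsto g (𝓝[≠] x.1) _).congr' ?_)
  filter_upwards [h, eventually_log_ne_zero x] with y h1 h2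
  exact (h1 h2).symm

theorem continuous_frobFun : Continuous (frobFun p) := by
  unfold frobFun
  fun_prop

section Stable

variable {ι : Type*} [Fintype ι]

/-- The functions `F i` generate an ideal stable under `φ` and `γ_u`. -/
structure StableFamily (u : ℤ_[p]ˣ) {a : Rad p} (F : ι → OAlg a) : Prop where
  frob : ∃ G : ι → ι → OAlg a, ∀ i (x : Omega a), ‖a.1‖ ≤ ‖frobFun p x.1‖ →
    extFun (F i) (frobFun p x.1) = ∑ j, (G i j).1 x * (F j).1 x
  -- This relation is needed only off the zeros of the logarithm, and in this form it survives
  -- division by the logarithm at once. The relation for φ is used at torsion points and must hold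
  -- there too.
  gamma : ∃ H : ι → ι → OAlg a, ∀ i (x : Omega a), logFun p x.1 ≠ 0 →
    extFun (F i) (gammaFun (u : ℤ_[p]) x.1) = ∑ j, (H i j).1 x * (F j).1 x

theorem extFun_logO_mul {a : Rad p} (f : OAlg a) {x : ℂ_[p]} (hx : ‖a.1‖ ≤ ‖x‖ ∧ ‖x‖ < 1) :
    extFun (logO a * f) x = logFun p x * extFun f x := by
  rw [extFun_apply _ ⟨x, hx⟩, extFun_apply f ⟨x, hx⟩, ← logO_apply (a := a) ⟨x, hx⟩]
  rfl

/-- Since log∘φ = p log and log∘γ_u = u log, the factor log cancels wherever it is nonzero, leaving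
the constants p⁻¹ and u⁻¹. For φ the identity extends to the zeros of the logarithm, which are
isolated, by continuity. -/
theorem StableFamily.of_logO_mul {u : ℤ_[p]ˣ} {a : Rad p} {F : ι → OAlg a}
    (h : StableFamily u fun i => logO a * F i) : StableFamily u F := by
  have hp0 : (p : ℂ_[p]) ≠ 0 := by exact_mod_cast (Fact.out : p.Prime).ne_zero
  have hp0' : (p : ℚ_[p]) ≠ 0 := by exact_mod_cast (Fact.out : p.Prime).ne_zero
  have hu0 : ((u : ℤ_[p]) : ℚ_[p]) ≠ 0 := fun h =>
    u.ne_zero (Subtype.ext h)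
  constructor
  · obtain ⟨G, hG⟩ := h.frob
    refine ⟨fun i j => (p : ℚ_[p])⁻¹ • G i j, fun i x hx => ?_⟩
    have hφ1 : ∀ y : ℂ_[p], ‖y‖ < 1 → ‖frobFun p y‖ < 1 := fun y hy =>
      (norm_frobFun_le hy).trans_lt hy
    have hkey : ∀ y : Omega a, ‖a.1‖ ≤ ‖frobFun p y.1‖ → logFun p y.1 ≠ 0 →
        extFun (F i) (frobFun p y.1) =
          ∑ j, (p : ℂ_[p])⁻¹ * extFun (G i j) y.1 * extFun (F j) y.1 := by
      intro y hy hl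
      have h1 := hG i y hy
      rw [extFun_logO_mul _ ⟨hy, hφ1 _ y.2.2⟩, log_frobFun y.2.2] at h1
      have h2 : ∑ j, (G i j).1 y * (logO a * F j).1 y =
          (p : ℂ_[p]) * logFun p y.1 * ∑ j, (p : ℂ_[p])⁻¹ * extFun (G i j) y.1 *
            extFun (F j) y.1 := by
        rw [Finset.mul_sum]
        refine Finset.sum_congr rfl fun j _ => ?_
        rw [← extFun_apply (logO a * F j), extFun_logO_mul _ y.2, ← extFun_apply (G i j)]
        field_simp
      rw [h2] at h1
      exact mul_left_cancel₀ (mul_ne_zero hp0 hl) h1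
    have hcont : extFun (F i) (frobFun p x.1) =
        ∑ j, (p : ℂ_[p])⁻¹ * extFun (G i j) x.1 * extFun (F j) x.1 := by
      refine eq_of_forall_log_ne_zero x (f := fun y => extFun (F i) (frobFun p y))
        (g := fun y => ∑ j, (p : ℂ_[p])⁻¹ * extFun (G i j) y * extFun (F j) y)
        ?_ ?_ (nhdsWithin_le_nhds ?_)
      · exact ContinuousAt.comp (f := frobFun p) (g := extFun (F i))
          (continuousAt_extFun (F i) ⟨frobFun p x.1, hx, hφ1 _ x.2.2⟩)
          continuous_frobFun.continuousAt
      · exact tendsto_finsetSum _ fun j _ =>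
          ((continuousAt_extFun (G i j) x).const_mul _).mul (continuousAt_extFun (F j) x)
      · have h0 : frobFun p x.1 ≠ 0 := norm_pos_iff.1 (a.pos.trans_le hx)
        filter_upwards [norm_eq_nhds x.ne_zero,
          continuous_frobFun.continuousAt.eventually (norm_eq_nhds h0)] with y h1 h2 h3
        exact hkey ⟨y, h1 ▸ x.2.1, h1 ▸ x.2.2⟩ (h2 ▸ hx) h3
    rw [hcont]
    refine Finset.sum_congr rfl fun j _ => ?_
    rw [extFun_apply, extFun_apply]
    congr 1
    change _ = (p : ℚ_[p])⁻¹ • (G i j).1 x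
    rw [Algebra.smul_def, map_inv₀, map_natCast]
  · obtain ⟨H, hH⟩ := h.gamma
    refine ⟨fun i j => ((u : ℤ_[p]) : ℚ_[p])⁻¹ • H i j, fun i x hx => ?_⟩
    have h1 := hH i x hx
    rw [extFun_logO_mul _ (by rw [norm_gammaFun u x.2.2]; exact x.2), log_gammaFun _ x.2.2] at h1
    refine mul_left_cancel₀ (smul_ne_zero hu0 hx) (h1.trans ?_)
    rw [Finset.mul_sum]
    refine Finset.sum_congr rfl fun j _ => ?_
    change _ * ((logO a).1 x * (F j).1 x) = _ * (((u : ℤ_[p]) : ℚ_[p])⁻¹ • (H i j).1 x * (F j).1 x)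
    rw [logO_apply, smul_mul_assoc, smul_mul_assoc, mul_smul_comm, smul_smul,
      mul_inv_cancel₀ hu0, one_smul]
    ring

/-- A topological generator of (an open subgroup of) `Γ`. -/
theorem exists_unit_one_add_p : ∃ u : ℤ_[p]ˣ, (u : ℤ_[p]) = ((p + 1 : ℕ) : ℤ_[p]) := by
  have h : IsUnit (((p + 1 : ℕ) : ℤ_[p])) := by
    rw [PadicInt.isUnit_iff]
    refine le_antisymm (PadicInt.norm_le_one _) (not_lt.1 fun h => ?_)
    rw [← Int.cast_natCast, PadicInt.norm_int_lt_one_iff_dvd] at h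
    have h2 : (p : ℤ) ∣ 1 := by
      have := dvd_sub h (dvd_refl (p : ℤ))
      push_cast at this
      simpa using this
    have h3 := Int.le_of_dvd one_pos h2
    have := (Fact.out : p.Prime).one_lt
    omega
  exact ⟨h.unit, rfl⟩

/-- If log(1 + x) ≠ 0, the orbit of x under γ with u = 1 + p consists of common zeros on one circle,
and the logarithms (p + 1)^n log(1 + x) tell them apart. This contradicts the finiteness of the
zeros of F i₀. -/
theorem StableFamily.log_eq_zero {u : ℤ_[p]ˣ} (hu : (u : ℤ_[p]) = ((p + 1 : ℕ) : ℤ_[p]))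
    {a : Rad p} {F : ι → OAlg a} (h : StableFamily u F) {i₀ : ι} (hi₀ : F i₀ ≠ 0)
    (x : Omega a) (hx : ∀ i, (F i).1 x = 0) : logFun p x.1 = 0 := by
  by_contra hl
  obtain ⟨H, hH⟩ := h.gamma
  obtain ⟨b, hb⟩ := exists_rad_gt (p := p) x.2.2
  have hab : ‖a.1‖ ≤ ‖b.1‖ := x.2.1.trans hb.le
  set g : ℂ_[p] → ℂ_[p] := gammaFun (u : ℤ_[p]) with hg
  have hglog : ∀ y, ‖y‖ < 1 → logFun p (g y) = ((p + 1 : ℕ) : ℂ_[p]) * logFun p y :=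
    fun y hy => by rw [hg, hu, gammaFun_natCast, log_pow hy]
  have hstep : ∀ n, ‖g^[n] x.1‖ = ‖x.1‖ ∧
      logFun p (g^[n] x.1) = ((p + 1 : ℕ) : ℂ_[p]) ^ n * logFun p x.1 ∧
      ∀ i, extFun (F i) (g^[n] x.1) = 0 := by
    intro n
    induction n with
    | zero => exact ⟨rfl, by simp, fun i => by simpa [extFun_apply] using hx i⟩
    | succ n ih =>
      obtain ⟨h1, h2, h3⟩ := ih
      have hlt : ‖g^[n] x.1‖ < 1 := h1 ▸ x.2.2
      have hp1 : ((p + 1 : ℕ) : ℂ_[p]) ≠ 0 := by exact_mod_cast p.succ_ne_zero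
      rw [Function.iterate_succ_apply']
      refine ⟨(norm_gammaFun u hlt).trans h1, ?_, fun i => ?_⟩
      · rw [hglog _ hlt, h2]
        ring
      · rw [hg, hH i ⟨g^[n] x.1, h1 ▸ x.2.1, hlt⟩ (by
          change logFun p (g^[n] x.1) ≠ 0
          rw [h2]
          exact mul_ne_zero (pow_ne_zero _ hp1) hl)]
        refine Finset.sum_eq_zero fun j _ => ?_
        rw [← extFun_apply (F j), h3 j, mul_zero]
  have hne : toAnn b (F i₀) ≠ 0 := fun h0 => hi₀ (toAnn_injective hab (by rw [h0, map_zero]))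
  have hfin := finite_zeros hab hne
  have hann : ∀ n, ‖a.1‖ ≤ ‖g^[n] x.1‖ ∧ ‖g^[n] x.1‖ ≤ ‖b.1‖ := fun n => by
    rw [(hstep n).1]
    exact ⟨x.2.1, hb.le⟩
  have hinj : Function.Injective fun n : ℕ => (⟨g^[n] x.1, hann n⟩ : Annulus a b) := by
    intro m n hmn
    have h1 : g^[m] x.1 = g^[n] x.1 := congrArg Subtype.val hmn
    have h2 := (hstep m).2.1
    rw [h1, (hstep n).2.1] at h2
    have h3 := mul_right_cancel₀ hl h2
    have h4 : (p + 1) ^ n = (p + 1) ^ m := by exact_mod_cast h3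
    exact (Nat.pow_right_injective (by have := (Fact.out : p.Prime).one_lt; omega) h4).symm
  refine Set.infinite_range_of_injective hinj (hfin.subset ?_)
  rintro _ ⟨n, rfl⟩
  change ev _ _ = 0
  rw [ev_toAnn, ← extFun_apply]
  exact (hstep n).2.2 i₀

theorem ext_conj {a : Rad p} {x y : Omega a} {n : ℕ} (hx : IsPrimitiveRoot (1 + x.1) (p ^ n))
    (hy : IsPrimitiveRoot (1 + y.1) (p ^ n)) {f : OAlg a} (hf : f.1 x = 0) : f.1 y = 0 := by
  obtain ⟨b, hb⟩ := exists_rad_gt (p := p) (max_lt x.2.2 y.2.2)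
  have hxb : ‖x.1‖ ≤ ‖b.1‖ := (le_max_left _ _).trans hb.le
  have hyb : ‖y.1‖ ≤ ‖b.1‖ := (le_max_right _ _).trans hb.le
  have := ev_eq_zero_of_isPrimitiveRoot (x.2.1.trans hxb) (f := toAnn b f)
    (x := ⟨x.1, x.2.1, hxb⟩) (y := ⟨y.1, y.2.1, hyb⟩) hx hy (by rwa [ev_toAnn])
  rwa [ev_toAnn] at this

/-- A set of torsion points stable under `φ` that comes close to the boundary, and is stable under
conjugation, contains all torsion points. -/
theorem forall_torsion_of_frequently {a : Rad p} {V : Omega a → Prop}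
    (hV : ∀ x, V x → logFun p x.1 = 0)
    (hφ : ∀ (x : Omega a) (h : ‖a.1‖ ≤ ‖frobFun p x.1‖), V x →
      V ⟨frobFun p x.1, h, (norm_frobFun_le x.2.2).trans_lt x.2.2⟩)
    (hconj : ∀ (x y : Omega a) (n : ℕ), IsPrimitiveRoot (1 + x.1) (p ^ n) →
      IsPrimitiveRoot (1 + y.1) (p ^ n) → V x → V y)
    (hbd : ∀ r < (1 : ℝ), ∃ x : Omega a, r < ‖x.1‖ ∧ V x) (z : Omega a)
    (hz : logFun p z.1 = 0) : V z := by
  -- A point of V closer to the boundary than z has order p^N with N ≥ n. Applying φ exactly N - n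
  -- times gives a point of order p^n, conjugate to z, and the orbit never has norm below that of z,
  -- so it stays in the annulus.
  obtain ⟨y, hyz, hy⟩ := hbd ‖z.1‖ z.2.2
  obtain ⟨n, hn⟩ := exists_isPrimitiveRoot z.2.2 hz
  obtain ⟨N, hN⟩ := exists_isPrimitiveRoot y.2.2 (hV y hy)
  have hnN : n ≤ N := by
    by_contra hlt
    push Not at hlt
    exact absurd (norm_le_of_isPrimitiveRoot z.2.2 hlt.le hn hN.pow_eq_one) (not_le.2 hyz)
  have hnorm : ∀ i ≤ N - n, ‖z.1‖ ≤ ‖(frobFun p)^[i] y.1‖ := fun i hi =>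
    norm_le_norm_iterate y.2.2 hnN hN hn hi
  have hlt : ∀ i, ‖(frobFun p)^[i] y.1‖ < 1 := fun i =>
    (norm_iterate_frobFun_le y.2.2 i).trans_lt y.2.2
  have hiter : ∀ i (hi : i ≤ N - n),
      V ⟨(frobFun p)^[i] y.1, z.2.1.trans (hnorm i hi), hlt i⟩ := by
    intro i
    induction i with
    | zero => exact fun _ => hy
    | succ i ih =>
      intro hi
      have h1 := hnorm (i + 1) hi
      have h2 := ih (by omega)
      rw [Function.iterate_succ_apply'] at h1
      have h3 := hφ _ (z.2.1.trans h1) h2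
      simp only [Function.iterate_succ_apply']
      exact h3
  exact hconj _ z n (isPrimitiveRoot_iterate hnN hN) hn (hiter _ le_rfl)

/-- Either the functions of a stable family generate the unit ideal near the boundary, or they are
divisible by the logarithm. -/
theorem StableFamily.dichotomy {u : ℤ_[p]ˣ} (hu : (u : ℤ_[p]) = ((p + 1 : ℕ) : ℤ_[p]))
    {a : Rad p} (ha : Good a) {F : ι → OAlg a} (h : StableFamily u F) {i₀ : ι} (hi₀ : F i₀ ≠ 0) :
    (∃ c : ι → RobbaRing p, ∑ i, c i * toR a (F i) = 1) ∨
      ((∃ x : Omega a, logFun p x.1 = 0) ∧ ∀ i, logO a ∣ F i) := by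
  -- The alternative is whether the common zeros accumulate at the boundary.
  by_cases hbd : ∀ r < (1 : ℝ), ∃ x : Omega a, r < ‖x.1‖ ∧ ∀ i, (F i).1 x = 0
  · right
    have hV := fun x hx => h.log_eq_zero hu hi₀ x hx
    obtain ⟨G, hG⟩ := h.frob
    have hall : ∀ z : Omega a, logFun p z.1 = 0 → ∀ i, (F i).1 z = 0 := by
      refine forall_torsion_of_frequently hV (fun x hx hx0 i => ?_)
        (fun x y n hx hy hx0 i => ext_conj hx hy (hx0 i)) hbd
      have h1 := hG i x hx
      rw [extFun_apply (F i) ⟨frobFun p x.1, hx, (norm_frobFun_le x.2.2).trans_lt x.2.2⟩] at h1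
      rw [h1]
      exact Finset.sum_eq_zero fun j _ => by rw [hx0 j, mul_zero]
    obtain ⟨x, -, hx⟩ := hbd 0 one_pos
    exact ⟨⟨x, hV x hx⟩, fun i => logO_dvd_of_forall_zero ha fun z hz => hall z hz i⟩
  · left
    push Not at hbd
    obtain ⟨r, hr, hno⟩ := hbd
    obtain ⟨a', ha'⟩ := exists_rad_gt (p := p) (max_lt hr a.2.2)
    have haa : ‖a.1‖ ≤ ‖a'.1‖ := (le_max_right _ _).trans ha'.le
    obtain ⟨c, hc⟩ := exists_sum_mul_eq_one (fun i => resO haa (F i)) fun x =>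
      hno ⟨x.1, haa.trans x.2.1, x.2.2⟩ (((le_max_left _ _).trans_lt ha').trans_le x.2.1)
    refine ⟨fun i => toR a' (c i), ?_⟩
    rw [← map_one (toR a'), ← hc, map_sum]
    exact Finset.sum_congr rfl fun i _ => by rw [map_mul, toR_resO]

/-- If no power of `t` generates the ideal, the dichotomy always allows one more division by the
logarithm, so every member is divisible by all its powers and F i₀ would be 0. -/
theorem StableFamily.span_eq {u : ℤ_[p]ˣ} (hu : (u : ℤ_[p]) = ((p + 1 : ℕ) : ℤ_[p]))
    {a : Rad p} (ha : Good a) {F : ι → OAlg a} (h : StableFamily u F) {i₀ : ι} (hi₀ : F i₀ ≠ 0) :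
    ∃ k, Ideal.span (Set.range fun i => toR a (F i)) = Ideal.span {tElt p ^ k} := by
  by_contra hcon
  have key : ∀ k, ∃ F' : ι → OAlg a, (F = fun i => logO a ^ k * F' i) ∧ StableFamily u F' := by
    intro k
    induction k with
    | zero => exact ⟨F, by simp, h⟩
    | succ k ih =>
      obtain ⟨F', hF', hst⟩ := ih
      have hi : F' i₀ ≠ 0 := fun h0 => hi₀ (by rw [hF']; simp only [h0, mul_zero])
      rcases hst.dichotomy hu ha hi with ⟨c, hc⟩ | ⟨-, hdvd⟩
      · refine absurd ⟨k, le_antisymm ?_ ?_⟩ hcon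
        · rw [Ideal.span_le]
          rintro _ ⟨i, rfl⟩
          rw [SetLike.mem_coe, Ideal.mem_span_singleton, hF']
          simp only [map_mul, map_pow, toR_logO]
          exact dvd_mul_right _ _
        · rw [Ideal.span_singleton_le_iff_mem, Ideal.mem_span_range_iff_exists_fun]
          refine ⟨c, ?_⟩
          rw [hF']
          simp only [map_mul, map_pow, toR_logO]
          have h1 : tElt p ^ k = tElt p ^ k * ∑ i, c i * toR a (F' i) := by rw [hc, mul_one]
          refine Eq.trans ?_ h1.symm
          rw [Finset.mul_sum]
          refine Finset.sum_congr rfl fun i _ => ?_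
          ring
      · choose F'' hF'' using hdvd
        have hst' : StableFamily u fun i => logO a * F'' i := by
          convert hst using 1
          funext i
          exact (hF'' i).symm
        refine ⟨F'', ?_, hst'.of_logO_mul⟩
        rw [hF']
        funext i
        rw [hF'' i, pow_succ, mul_assoc]
  rcases h.dichotomy hu ha hi₀ with ⟨c, hc⟩ | ⟨⟨x, hx⟩, -⟩
  · refine hcon ⟨0, ?_⟩
    rw [pow_zero, Ideal.span_singleton_one, Ideal.eq_top_iff_one,
      Ideal.mem_span_range_iff_exists_fun]
    exact ⟨c, hc⟩
  · refine hi₀ (eq_zero_of_forall_logO_pow_dvd ha (fun k => ?_) hx)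
    obtain ⟨F', hF', -⟩ := key k
    rw [hF']
    exact dvd_mul_right _ _

end Stable

/-- Finitely generated nonzero ideals of the Robba ring stable under `φ` and `Γ` are generated by a
power of `t`. -/
theorem exists_eq_span_tElt_pow {I : Ideal (RobbaRing p)} (hfg : I.FG) (hI : I ≠ ⊥)
    (hφ : ∀ f ∈ I, frob p f ∈ I) (hγ : ∀ u : ℤ_[p]ˣ, ∀ f ∈ I, gammaHom u f ∈ I) :
    ∃ k : ℕ, I = Ideal.span {tElt p ^ k} := by
  obtain ⟨u, hu⟩ := exists_unit_one_add_p (p := p)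
  obtain ⟨m, f, hf⟩ := Submodule.fg_iff_exists_fin_generating_family.1 hfg
  change Ideal.span (Set.range f) = I at hf
  have hfI : ∀ i, f i ∈ I := fun i => hf ▸ Ideal.subset_span ⟨i, rfl⟩
  have hG : ∀ i, ∃ g : Fin m → RobbaRing p, ∑ j, g j * f j = frob p (f i) := fun i =>
    Ideal.mem_span_range_iff_exists_fun.1 (hf ▸ hφ _ (hfI i))
  have hH : ∀ i, ∃ g : Fin m → RobbaRing p, ∑ j, g j * f j = gammaHom u (f i) := fun i =>
    Ideal.mem_span_range_iff_exists_fun.1 (hf ▸ hγ u _ (hfI i))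
  choose g hg using hG
  choose h hh using hH
  have e1 : ∀ᶠ x in bdry p, ∀ i, rep (f i) (frobFun p x) = ∑ j, rep (g i j) x * rep (f j) x := by
    refine eventually_all.2 fun i => ?_
    filter_upwards [rep_frob (f i), rep_sum Finset.univ fun j => g i j * f j,
      eventually_all.2 fun j => rep_mul (g i j) (f j)] with x h1 h2 h3
    rw [← h1, ← hg, h2]
    exact Finset.sum_congr rfl fun j _ => h3 j
  have e2 : ∀ᶠ x in bdry p, ∀ i, rep (f i) (gammaFun (u : ℤ_[p]) x) =
      ∑ j, rep (h i j) x * rep (f j) x := by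
    refine eventually_all.2 fun i => ?_
    filter_upwards [rep_gammaHom u (f i), rep_sum Finset.univ fun j => h i j * f j,
      eventually_all.2 fun j => rep_mul (h i j) (f j)] with x h1 h2 h3
    rw [← h1, ← hh, h2]
    exact Finset.sum_congr rfl fun j _ => h3 j
  have e3 := eventually_all.2 fun i => exists_lift (f i)
  have e4 := eventually_all.2 fun i => eventually_all.2 fun j => exists_lift (g i j)
  have e5 := eventually_all.2 fun i => eventually_all.2 fun j => exists_lift (h i j)
  -- Finitely many germs and identities are involved, so one annulus carries all of them as honest
  -- functions.
  obtain ⟨r, hr, hall⟩ := eventually_bdry_iff.1 (e1.and (e2.and (e3.and (e4.and e5))))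
  obtain ⟨a, ha, hra⟩ := exists_good (p := p) hr
  obtain ⟨-, -, h3, h4, h5⟩ := hall a.1 hra a.2.2
  choose F hFR hF using fun i => h3 i a rfl
  choose G hGR hG using fun i j => h4 i j a rfl
  choose H hHR hH using fun i j => h5 i j a rfl
  have hst : StableFamily u F := by
    refine ⟨⟨G, fun i x hx => ?_⟩, ⟨H, fun i x _ => ?_⟩⟩
    · rw [extFun_apply (F i) ⟨frobFun p x.1, hx, (norm_frobFun_le x.2.2).trans_lt x.2.2⟩, hF,
        (hall x.1 (hra.trans_le x.2.1) x.2.2).1 i]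
      exact Finset.sum_congr rfl fun j _ => by rw [hG, hF]
    · have hn := norm_gammaFun u x.2.2
      rw [extFun_apply (F i) ⟨gammaFun (u : ℤ_[p]) x.1, hn ▸ x.2.1, hn ▸ x.2.2⟩, hF,
        (hall x.1 (hra.trans_le x.2.1) x.2.2).2.1 i]
      exact Finset.sum_congr rfl fun j _ => by rw [hH, hF]
  obtain ⟨i₀, hi₀⟩ : ∃ i, F i ≠ 0 := by
    by_contra hcon
    push Not at hcon
    refine hI (hf ▸ ?_)
    rw [Ideal.span_eq_bot]
    rintro _ ⟨i, rfl⟩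
    rw [← hFR, hcon, map_zero]
  obtain ⟨k, hk⟩ := hst.span_eq hu ha hi₀
  refine ⟨k, ?_⟩
  rw [← hf, ← hk]
  congr 2
  funext i
  exact (hFR i).symm

/-! ### Fitting ideals -/

section Fitting

variable {R : Type*} [CommRing R]

/-- Expand the determinant multilinearly after writing each row as a combination of the `w`. -/
theorem det_mem_span_of_rows {n : ℕ} {ι : Type*} [Finite ι] (w : ι → Fin n → R)
    (M : Matrix (Fin n) (Fin n) R) (hM : ∀ i, M i ∈ Submodule.span R (Set.range w)) :
    M.det ∈ Ideal.span (Set.range fun s : Fin n → ι => Matrix.det (Matrix.of fun i => w (s i))) := by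
  classical
  have := Fintype.ofFinite ι
  choose c hc using fun i => (Submodule.mem_span_range_iff_exists_fun R).1 (hM i)
  have h1 : M.det = Matrix.detRowAlternating.toMultilinearMap
      (fun i => ∑ l, c i l • w l) := by
    rw [funext hc]
    rfl
  rw [h1, MultilinearMap.map_sum]
  refine Ideal.sum_mem _ fun s _ => ?_
  rw [MultilinearMap.map_smul_univ, smul_eq_mul]
  exact Ideal.mul_mem_left _ _ (Ideal.subset_span ⟨s, rfl⟩)

variable {M : Type*} [AddCommGroup M] [Module R M]

/-- The relations between finitely many elements of a module. -/
def relations {n : ℕ} (e : Fin n → M) : Submodule R (Fin n → R) :=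
  LinearMap.ker (Fintype.linearCombination R e)

theorem mem_relations {n : ℕ} {e : Fin n → M} {v : Fin n → R} :
    v ∈ relations e ↔ ∑ j, v j • e j = 0 := Iff.rfl

variable (R) in
/-- The ideal generated by the determinants of square matrices of relations. -/
def fitting {n : ℕ} (e : Fin n → M) : Ideal R :=
  Ideal.span {x | ∃ N : Matrix (Fin n) (Fin n) R, (∀ i, N i ∈ relations e) ∧ N.det = x}

theorem det_mem_fitting {n : ℕ} {e : Fin n → M} {N : Matrix (Fin n) (Fin n) R}
    (h : ∀ i, N i ∈ relations e) : N.det ∈ fitting R e := Ideal.subset_span ⟨N, h, rfl⟩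

theorem fitting_fg {n : ℕ} {e : Fin n → M} (h : (relations (R := R) e).FG) :
    (fitting R e).FG := by
  obtain ⟨m, w, hw⟩ := Submodule.fg_iff_exists_fin_generating_family.1 h
  have : fitting R e =
      Ideal.span (Set.range fun s : Fin n → Fin m => Matrix.det (Matrix.of fun i => w (s i))) := by
    refine le_antisymm (Ideal.span_le.2 ?_) (Ideal.span_le.2 ?_)
    · rintro _ ⟨N, hN, rfl⟩
      exact det_mem_span_of_rows w N fun i => hw.symm ▸ hN i
    · rintro _ ⟨s, rfl⟩
      exact det_mem_fitting fun i => hw ▸ Submodule.subset_span ⟨s i, rfl⟩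
  rw [this]
  exact Submodule.fg_span (Set.finite_range _)

/-- The determinant of a matrix whose first columns consist of relations. -/
theorem det_mem_fitting_of_columns {n : ℕ} {e : Fin n → M} (b : ℕ)
    (N : Matrix (Fin (n + b)) (Fin (n + b)) R)
    (h : ∀ i, (fun j => N i (Fin.castAdd b j)) ∈ relations e) : N.det ∈ fitting R e := by
  induction b with
  | zero => exact det_mem_fitting h
  | succ b ih =>
    -- Expansion along the last column, about which nothing is assumed, leaves minors whose first n
    -- columns are still rows of relations.
    have h1 := Matrix.det_succ_column (n := n + b) N (Fin.last (n + b))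
    refine h1 ▸ Ideal.sum_mem _ fun i _ => Ideal.mul_mem_left _ _ (ih _ fun l => ?_)
    simp only [Matrix.submatrix_apply, Fin.succAbove_last]
    exact h (i.succAbove l)

/-- Independence of the generators. With f = Φ e and e = Ψ f, the determinant of N equals that of
the block matrix with rows (1 - ΨΦ, -Ψ) and (NΦ, N), whose first n columns consist of relations
among the e. -/
theorem det_mem_fitting_of_span {n m : ℕ} {e : Fin n → M} {f : Fin m → M}
    (hf : ∀ i, f i ∈ Submodule.span R (Set.range e))
    (he : ∀ i, e i ∈ Submodule.span R (Set.range f))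
    {N : Matrix (Fin m) (Fin m) R} (hN : ∀ i, N i ∈ relations f) : N.det ∈ fitting R e := by
  choose Φ hΦ using fun i => (Submodule.mem_span_range_iff_exists_fun R).1 (hf i)
  choose Ψ hΨ using fun i => (Submodule.mem_span_range_iff_exists_fun R).1 (he i)
  have hdet : N.det = (Matrix.fromBlocks (1 - Matrix.of Ψ * Matrix.of Φ) (-Matrix.of Ψ)
      (N * Matrix.of Φ) N).det := by
    have h1 : Matrix.fromBlocks (1 - Matrix.of Ψ * Matrix.of Φ) (-Matrix.of Ψ)
        (N * Matrix.of Φ) N = Matrix.fromBlocks 1 (-Matrix.of Ψ) 0 N *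
          Matrix.fromBlocks 1 0 (Matrix.of Φ) 1 := by
      rw [Matrix.fromBlocks_multiply]
      simp only [Matrix.mul_one, Matrix.mul_zero, zero_add, Matrix.neg_mul, sub_eq_add_neg]
    rw [h1, Matrix.det_mul, Matrix.det_fromBlocks_zero₂₁, Matrix.det_fromBlocks_zero₁₂]
    simp
  rw [hdet, ← Matrix.det_reindex_self finSumFinEquiv]
  refine det_mem_fitting_of_columns m _ fun i => ?_
  obtain ⟨i, rfl⟩ := finSumFinEquiv.surjective i
  have hf' : ∀ g : Fin m → R, ∑ j, (∑ l, g l * Φ l j) • e j = ∑ l, g l • f l := by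
    intro g
    simp only [Finset.sum_smul, mul_smul]
    rw [Finset.sum_comm]
    refine Finset.sum_congr rfl fun l _ => ?_
    rw [← Finset.smul_sum, hΦ]
  rw [mem_relations]
  have hcol : ∀ j : Fin n, finSumFinEquiv.symm (Fin.castAdd m j) = Sum.inl j := fun j => by
    rw [Equiv.symm_apply_eq, finSumFinEquiv_apply_left]
  rcases i with i | i
  · simp only [Matrix.reindex_apply, Matrix.submatrix_apply, Equiv.symm_apply_apply, hcol,
      Matrix.fromBlocks_apply₁₁, Matrix.sub_apply, Matrix.mul_apply, Matrix.of_apply, sub_smul,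
      Finset.sum_sub_distrib]
    rw [hf' (Ψ i), hΨ, sub_eq_zero, Finset.sum_eq_single i]
    · simp
    · intro j _ hj
      rw [Matrix.one_apply_ne' hj, zero_smul]
    · simp
  · simp only [Matrix.reindex_apply, Matrix.submatrix_apply, Equiv.symm_apply_apply, hcol,
      Matrix.fromBlocks_apply₂₁, Matrix.mul_apply, Matrix.of_apply]
    rw [hf' (N i)]
    exact hN i

/-- Cramer's rule: the adjugate of a matrix of relations multiplies it to its determinant. -/
theorem smul_eq_zero_of_mem_fitting {n : ℕ} {e : Fin n → M} {x : R} (hx : x ∈ fitting R e)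
    (j : Fin n) : x • e j = 0 := by
  have hle : fitting R e ≤ LinearMap.ker (LinearMap.toSpanSingleton R M (e j)) := by
    refine Ideal.span_le.2 ?_
    rintro _ ⟨N, hN, rfl⟩
    change N.det • e j = 0
    have h1 : N.det • e j = ∑ l, (N.adjugate * N) j l • e l := by
      rw [Matrix.adjugate_mul, Finset.sum_eq_single j]
      · simp
      · intro l _ hl
        rw [Matrix.smul_apply, Matrix.one_apply_ne' hl, smul_zero, zero_smul]
      · simp
    rw [h1]
    simp only [Matrix.mul_apply, Finset.sum_smul, mul_smul]
    rw [Finset.sum_comm]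
    refine Finset.sum_eq_zero fun i _ => ?_
    rw [← Finset.smul_sum, mem_relations.1 (hN i), smul_zero]
  exact hle hx

theorem prod_mem_fitting {n : ℕ} {e : Fin n → M} {h : Fin n → R} (hh : ∀ i, h i • e i = 0) :
    ∏ i, h i ∈ fitting R e := by
  rw [← Matrix.det_diagonal]
  refine det_mem_fitting fun i => ?_
  rw [mem_relations, Finset.sum_eq_single i]
  · rw [Matrix.diagonal_apply_eq, hh]
  · intro j _ hj
    rw [Matrix.diagonal_apply_ne' _ hj, zero_smul]
  · simp

/-- Applying ψ to a relation among the e gives a relation among the ψ(e) with coefficients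
transformed by σ. As the ψ(e) also generate, independence of the generators applies. This is how φ
and Γ act on Fitting ideals. -/
theorem map_mem_fitting {σ : R →+* R} (ψ : M →ₛₗ[σ] M) {n : ℕ} {e : Fin n → M}
    (he : Submodule.span R (Set.range e) = ⊤) (hψ : Submodule.span R (Set.range ψ) = ⊤) {x : R}
    (hx : x ∈ fitting R e) : σ x ∈ fitting R e := by
  have hψe : Submodule.span R (Set.range fun i => ψ (e i)) = ⊤ := by
    rw [eq_top_iff, ← hψ, Submodule.span_le]
    rintro _ ⟨y, rfl⟩
    obtain ⟨c, rfl⟩ := (Submodule.mem_span_range_iff_exists_fun R).1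
      (he ▸ Submodule.mem_top : y ∈ Submodule.span R (Set.range e))
    rw [map_sum]
    refine Submodule.sum_mem _ fun i _ => ?_
    rw [LinearMap.map_smulₛₗ]
    exact Submodule.smul_mem _ _ (Submodule.subset_span ⟨i, rfl⟩)
  have hle : fitting R e ≤ (fitting R e).comap σ := by
    refine Ideal.span_le.2 ?_
    rintro _ ⟨N, hN, rfl⟩
    change σ N.det ∈ fitting R e
    rw [RingHom.map_det]
    refine det_mem_fitting_of_span (f := fun i => ψ (e i)) (fun i => he ▸ Submodule.mem_top)
      (fun i => hψe ▸ Submodule.mem_top) fun i => ?_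
    rw [mem_relations]
    have := congrArg ψ (mem_relations.1 (hN i))
    rw [map_sum, map_zero] at this
    simp only [LinearMap.map_smulₛₗ] at this
    exact this
  exact hle hx

theorem exists_presentation [Module.FinitePresentation R M] :
    ∃ (n : ℕ) (e : Fin n → M), Submodule.span R (Set.range e) = ⊤ ∧
      (relations (R := R) e).FG := by
  obtain ⟨n, e, he⟩ := Module.Finite.exists_fin (R := R) (M := M)
  refine ⟨n, e, he, ?_⟩
  refine Module.FinitePresentation.fg_ker (Fintype.linearCombination R e) ?_
  rw [← LinearMap.range_eq_top, Fintype.range_linearCombination, he]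

end Fitting

/-! ### Annihilation of torsion (φ, Γ)-modules by a power of t. -/

namespace PhiGammaAction

variable {D : Type*} [AddCommGroup D] [Module (RobbaRing p) D] (A : PhiGammaAction p D)

open scoped TensorProduct in
theorem linearization_tmul (f : RobbaRing p) (x : D) :
    A.linearization ((f : FrobTwist p) ⊗ₜ[RobbaRing p] x) = f • A.phi x := rfl

theorem linearization_mem_span (z) :
    A.linearization z ∈ Submodule.span (RobbaRing p) (Set.range A.phi) := by
  induction z using TensorProduct.induction_on with
  | zero => rw [map_zero]; exact zero_mem _
  | tmul f x => exact Submodule.smul_mem _ _ (Submodule.subset_span ⟨x, rfl⟩)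
  | add x y hx hy => rw [map_add]; exact add_mem hx hy

open scoped TensorProduct in
theorem exists_linearization_eq_smul (r : RobbaRing p) (z) :
    ∃ z', A.linearization z' = r • A.linearization z := by
  induction z using TensorProduct.induction_on with
  | zero => exact ⟨0, by rw [map_zero, smul_zero]⟩
  | tmul f x =>
    exact ⟨((r * (show RobbaRing p from f) : RobbaRing p) : FrobTwist p) ⊗ₜ[RobbaRing p] x,
      mul_smul r (show RobbaRing p from f) (A.phi x)⟩
  | add u v hu hv =>
    obtain ⟨u', hu'⟩ := hu
    obtain ⟨v', hv'⟩ := hv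
    exact ⟨u' + v', by rw [map_add, map_add, smul_add, hu', hv']⟩

theorem surjective_linearization_iff : Function.Surjective A.linearization ↔
    Submodule.span (RobbaRing p) (Set.range A.phi) = ⊤ := by
  constructor
  · intro h
    rw [eq_top_iff]
    intro x _
    obtain ⟨z, rfl⟩ := h x
    exact A.linearization_mem_span z
  · intro h x
    have hx : x ∈ Submodule.span (RobbaRing p) (Set.range A.phi) := h ▸ Submodule.mem_top
    induction hx using Submodule.span_induction with
    | mem x hx =>
      obtain ⟨y, rfl⟩ := hx
      exact ⟨(1 : RobbaRing p) ⊗ₜ[RobbaRing p] y, by rw [linearization_tmul, one_smul]⟩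
    | zero => exact ⟨0, map_zero _⟩
    | add x y _ _ hx hy =>
      obtain ⟨u, rfl⟩ := hx
      obtain ⟨v, rfl⟩ := hy
      exact ⟨u + v, map_add _ _ _⟩
    | smul r x _ hx =>
      obtain ⟨u, rfl⟩ := hx
      exact A.exists_linearization_eq_smul r u

theorem span_range_gamma (u : ℤ_[p]ˣ) :
    Submodule.span (RobbaRing p) (Set.range (A.gamma u)) = ⊤ := by
  have : Set.range (A.gamma u) = Set.univ := Set.range_eq_univ.2 fun x =>
    ⟨A.gamma u⁻¹ x, by rw [← A.gamma_mul, mul_inv_cancel, A.gamma_one]⟩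
  rw [this, Submodule.span_univ]

theorem nontrivial_robba : Nontrivial (RobbaRing p) := by
  obtain ⟨a, -⟩ := exists_rad_gt (p := p) one_pos
  refine ⟨1, 0, fun h => ?_⟩
  have h1 : (1 : OAlg a) = 0 := toR_injective a (by rw [map_one, map_zero, h])
  have h2 := congrArg (fun f : OAlg a => f.1 ⟨a.1, le_rfl, a.2.2⟩) h1
  exact one_ne_zero (α := ℂ_[p]) h2

/-- A torsion `(φ, Γ)`-module is killed by a power of `t`. -/
theorem exists_tElt_pow_smul_eq_zero (hA : A.IsTorsion) :
    ∃ k : ℕ, ∀ x : D, tElt p ^ k • x = 0 := by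
  have := nontrivial_robba (p := p)
  have := hA.isGeneralized.finitePresentation
  obtain ⟨n, e, he, hfg⟩ := exists_presentation (R := RobbaRing p) (M := D)
  have hspan := A.surjective_linearization_iff.1 hA.isGeneralized.bijective_linearization.2
  -- The product of regular annihilators of the generators is a nonzero element of the Fitting
  -- ideal.
  choose h hh using fun i => hA.isTorsion (x := e i)
  have hne : fitting (RobbaRing p) e ≠ ⊥ := by
    intro hbot
    have h1 : ∏ i, (h i : RobbaRing p) ∈ fitting (RobbaRing p) e := prod_mem_fitting hh
    rw [hbot, Ideal.mem_bot] at h1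
    have h2 : ∏ i, (h i : RobbaRing p) ∈ nonZeroDivisors (RobbaRing p) :=
      Submonoid.prod_mem _ fun i _ => (h i).2
    exact nonZeroDivisors.ne_zero h2 h1
  obtain ⟨k, hk⟩ := exists_eq_span_tElt_pow (fitting_fg hfg) hne
    (fun f hf => map_mem_fitting A.phi he hspan hf)
    (fun u f hf => map_mem_fitting (A.gamma u) he (A.span_range_gamma u) hf)
  have ht : tElt p ^ k ∈ fitting (RobbaRing p) e := hk ▸ Ideal.mem_span_singleton_self _
  refine ⟨k, fun x => ?_⟩
  obtain ⟨c, rfl⟩ := (Submodule.mem_span_range_iff_exists_fun (RobbaRing p)).1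
    (he ▸ Submodule.mem_top : x ∈ Submodule.span (RobbaRing p) (Set.range e))
  rw [Finset.smul_sum]
  refine Finset.sum_eq_zero fun i _ => ?_
  rw [smul_comm, smul_eq_zero_of_mem_fitting ht, smul_zero]

end PhiGammaAction

/-! ### Vectors in general position -/

section GeneralPosition

variable {k K : Type*} [Field k] [Field K] [Algebra k K]

/-- A point of the moment curve. -/
def momentVec (K : Type*) [Field K] [Algebra k K] (n : ℕ) (z : k) : Fin n → K :=
  fun j => algebraMap k K (z ^ (j : ℕ))

theorem span_rows_eq_top {n : ℕ} {M : Matrix (Fin n) (Fin n) K} (h : M.det ≠ 0) :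
    Submodule.span K (Set.range fun i => M i) = ⊤ :=
  (Matrix.linearIndependent_rows_iff_isUnit.2
    ((Matrix.isUnit_iff_isUnit_det M).2 h.isUnit)).span_eq_top_of_card_eq_finrank' (by simp)

/-- Otherwise expanding the determinant of the identity matrix in the spanning rows would give 1 =
0. -/
theorem exists_det_ne_zero {n : ℕ} {ι : Type*} [Finite ι] {w : ι → Fin n → K}
    (h : Submodule.span K (Set.range w) = ⊤) :
    ∃ s : Fin n → ι, Matrix.det (Matrix.of fun i => w (s i)) ≠ 0 := by
  by_contra hcon
  push Not at hcon
  have h1 := det_mem_span_of_rows w (1 : Matrix (Fin n) (Fin n) K) fun i =>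
    h.symm ▸ Submodule.mem_top
  rw [Matrix.det_one] at h1
  have h2 : Ideal.span (Set.range fun s : Fin n → ι => Matrix.det (Matrix.of fun i => w (s i)))
      = ⊥ := by
    rw [Ideal.span_eq_bot]
    rintro _ ⟨s, rfl⟩
    exact hcon s
  rw [h2, Ideal.mem_bot] at h1
  exact one_ne_zero h1

/-- Any n distinct points of the moment curve form a basis, by Vandermonde. -/
theorem finite_momentVec_mem {n : ℕ} {W : Submodule K (Fin n → K)} (hW : W ≠ ⊤) :
    {z : k | momentVec K n z ∈ W}.Finite := by
  by_contra hinf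
  let f := Set.Infinite.natEmbedding _ hinf
  let v : Fin n → K := fun i => algebraMap k K (f i).1
  have hv : Function.Injective v := fun i j hij =>
    Fin.ext (f.injective (Subtype.ext ((algebraMap k K).injective hij)))
  refine hW (eq_top_iff.2 ?_)
  rw [← span_rows_eq_top (Matrix.det_vandermonde_ne_zero_iff.2 hv), Submodule.span_le]
  rintro _ ⟨i, rfl⟩
  have h1 : momentVec K n (f i).1 = Matrix.vandermonde v i := by
    funext j
    rw [momentVec, Matrix.vandermonde_apply, map_pow]
  change Matrix.vandermonde v i ∈ W
  rw [← h1]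
  exact (f i).2

/-- The space spanned by `W` and the first `d` points of a sequence on the moment curve. -/
def addMoments {n : ℕ} (W : Submodule K (Fin n → K)) (z : ℕ → k) (d : ℕ) :
    Submodule K (Fin n → K) :=
  W ⊔ Submodule.span K (Set.range fun i : Fin d => momentVec K n (z i))

theorem addMoments_zero {n : ℕ} (W : Submodule K (Fin n → K)) (z : ℕ → k) :
    addMoments W z 0 = W := by
  simp [addMoments]

theorem addMoments_succ {n : ℕ} (W : Submodule K (Fin n → K)) (z : ℕ → k) (d : ℕ) :
    addMoments W z (d + 1) = addMoments W z d ⊔ Submodule.span K {momentVec K n (z d)} := by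
  rw [addMoments, addMoments, sup_assoc, ← Submodule.span_union]
  congr 2
  ext v
  constructor
  · rintro ⟨i, rfl⟩
    refine Fin.lastCases (Or.inr ?_) (fun i => Or.inl ⟨i, ?_⟩) i
    · simp
    · simp
  · rintro (⟨i, rfl⟩ | rfl)
    · exact ⟨i.castSucc, by simp⟩
    · exact ⟨Fin.last d, by simp⟩

theorem addMoments_congr {n : ℕ} (W : Submodule K (Fin n → K)) {z z' : ℕ → k} {d : ℕ}
    (h : ∀ i < d, z i = z' i) : addMoments W z d = addMoments W z' d := by
  rw [addMoments, addMoments]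
  congr 3
  funext i
  rw [h i i.2]

/-- The sequence `z` is in general position with respect to `W`. -/
def IsGeneric {n : ℕ} (W : Submodule K (Fin n → K)) (z : ℕ → k) : Prop :=
  ∀ d, addMoments W z d ≠ ⊤ → momentVec K n (z d) ∉ addMoments W z d

/-- The parameters are chosen one after another: each of the countably many conditions excludes
finitely many values of the uncountable field `k`. -/
theorem exists_isGeneric {X : Type*} {S : Set X} (hS : S.Countable) (hk : ¬ Countable k) {n : ℕ}
    (W : X → Submodule K (Fin n → K)) : ∃ z : ℕ → k, ∀ x ∈ S, IsGeneric (W x) z := by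
  have hstep : ∀ (z : ℕ → k) (d : ℕ), ∃ c : k, ∀ x ∈ S, addMoments (W x) z d ≠ ⊤ →
      momentVec K n c ∉ addMoments (W x) z d := by
    intro z d
    by_contra hcon
    push Not at hcon
    have h1 : (⋃ x ∈ S, {c : k | addMoments (W x) z d ≠ ⊤ ∧
        momentVec K n c ∈ addMoments (W x) z d}).Countable := by
      refine hS.biUnion fun x _ => ?_
      by_cases h : addMoments (W x) z d = ⊤
      · simp [h]
      · exact ((finite_momentVec_mem h).subset fun c hc => hc.2).countable
    refine hk (Set.countable_univ_iff.1 (h1.mono fun c _ => ?_))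
    obtain ⟨x, hx, h2, h3⟩ := hcon c
    exact Set.mem_biUnion hx ⟨h2, h3⟩
  choose g hg using hstep
  let Z : ℕ → ℕ → k := fun m => Nat.rec (fun _ => 0) (fun d z => Function.update z d (g z d)) m
  have hZ : ∀ m, Z (m + 1) = Function.update (Z m) m (g (Z m) m) := fun m => rfl
  have hst : ∀ i m, i < m → Z m i = Z (i + 1) i := by
    intro i m hm
    induction m, hm using Nat.le_induction with
    | base => rfl
    | succ m hm ih =>
      rw [hZ m, Function.update_of_ne (by have : i + 1 ≤ m := hm; omega), ih]
  refine ⟨fun i => Z (i + 1) i, fun x hx d => ?_⟩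
  have h1 : addMoments (W x) (fun i => Z (i + 1) i) d = addMoments (W x) (Z d) d :=
    addMoments_congr _ fun i hi => (hst i d hi).symm
  have h2 : Z (d + 1) d = g (Z d) d := by rw [hZ, Function.update_self]
  simp only [h1, h2]
  exact hg (Z d) d x hx

variable {n : ℕ} {W : Submodule K (Fin n → K)} {z : ℕ → k}

theorem IsGeneric.finrank_eq (h : IsGeneric W z) {d : ℕ} (hd : addMoments W z d ≠ ⊤) :
    Module.finrank K (addMoments W z d) = Module.finrank K W + d := by
  induction d with
  | zero => rw [addMoments_zero, add_zero]
  | succ d ih =>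
    have h1 : addMoments W z d ≠ ⊤ := by
      intro h1
      refine hd (eq_top_iff.2 ?_)
      rw [addMoments_succ, ← h1]
      exact le_sup_left
    rw [addMoments_succ, Submodule.finrank_sup_span_singleton (h d h1), ih h1, add_assoc]

theorem finrank_addMoments_le (d : ℕ) :
    Module.finrank K (addMoments W z d) ≤ Module.finrank K W + d := by
  induction d with
  | zero => rw [addMoments_zero, add_zero]
  | succ d ih =>
    rw [addMoments_succ]
    refine (Submodule.finrank_add_le_finrank_add_finrank _ _).trans ?_
    have := finrank_span_le_card (R := K) ({momentVec K n (z d)} : Set (Fin n → K))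
    rw [Set.toFinset_singleton, Finset.card_singleton] at this
    omega

theorem IsGeneric.addMoments_eq_top_iff (h : IsGeneric W z) {d : ℕ} :
    addMoments W z d = ⊤ ↔ n ≤ Module.finrank K W + d := by
  constructor
  · intro h1
    have := finrank_addMoments_le (W := W) (z := z) d
    rwa [h1, finrank_top, Module.finrank_fin_fun] at this
  · intro h1
    by_contra h2
    have h3 := Submodule.finrank_lt h2
    rw [h.finrank_eq h2, Module.finrank_fin_fun] at h3
    omega

/-- By the dimension count the d moment vectors form a basis of the quotient by W. -/
theorem eq_zero_of_sum_momentVec_mem {d : ℕ} (htop : addMoments W z d = ⊤)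
    (hd : Module.finrank K W + d = n) {b : Fin d → K}
    (hb : ∑ i, b i • momentVec K n (z i) ∈ W) : b = 0 := by
  have h1 : ⊤ ≤ Submodule.span K (Set.range fun i : Fin d => W.mkQ (momentVec K n (z i))) := by
    rw [show (fun i : Fin d => W.mkQ (momentVec K n (z i)))
      = W.mkQ ∘ fun i : Fin d => momentVec K n (z i) from rfl, Set.range_comp, ← Submodule.map_span]
    have h2 := congrArg (Submodule.map W.mkQ) htop
    rw [addMoments, Submodule.map_sup, Submodule.map_top, Submodule.range_mkQ,
      Submodule.mkQ_map_self, bot_sup_eq] at h2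
    exact h2.ge
  have h3 := Submodule.finrank_quotient_add_finrank W
  rw [Module.finrank_fin_fun] at h3
  have hli := linearIndependent_of_top_le_span_of_card_eq_finrank h1 (by
    rw [Fintype.card_fin]
    omega)
  refine funext (Fintype.linearIndependent_iff.1 hli b ?_)
  rw [← (Submodule.Quotient.mk_eq_zero W).2 hb, ← Submodule.mkQ_apply, map_sum]
  simp only [map_smul]

/-- Φ induces a surjection from the quotient by W' onto the quotient by W. -/
theorem finrank_le_of_approx {W' : Submodule K (Fin n → K)} (Φ Ψ : (Fin n → K) →ₗ[K] (Fin n → K))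
    (h1 : W' ≤ W.comap Φ) (h2 : ∀ v, v - Φ (Ψ v) ∈ W) :
    Module.finrank K W' ≤ Module.finrank K W := by
  have hsurj : Function.Surjective (W'.mapQ W Φ h1) := by
    intro y
    obtain ⟨v, rfl⟩ := Submodule.mkQ_surjective W y
    refine ⟨W'.mkQ (Ψ v), ?_⟩
    rw [Submodule.mkQ_apply, Submodule.mapQ_apply]
    exact ((Submodule.Quotient.eq W).2 (h2 v)).symm
  have h3 := LinearMap.finrank_le_finrank_of_surjective hsurj
  have h4 := Submodule.finrank_quotient_add_finrank W
  have h5 := Submodule.finrank_quotient_add_finrank W'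
  omega

end GeneralPosition

/-! ### Fibers at torsion points -/

theorem not_countable_padic : ¬ Countable ℚ_[p] := by
  intro h
  have h1 := continuum_le_cardinal_of_nontriviallyNormedField ℚ_[p]
  exact absurd (h1.trans (Cardinal.mk_le_aleph0)) (not_le.2 Cardinal.aleph0_lt_continuum)

theorem countable_torsion : {x : ℂ_[p] | ‖x‖ < 1 ∧ logFun p x = 0}.Countable := by
  classical
  have h1 : (⋃ m : ℕ, (((omegaPoly p m).aroots ℂ_[p]).toFinset : Set ℂ_[p])).Countable :=
    Set.countable_iUnion fun m => (Finset.finite_toSet _).countable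
  refine h1.mono ?_
  rintro x ⟨hx, h0⟩
  obtain ⟨m, hm⟩ := (log_eq_zero_iff hx).1 h0
  refine Set.mem_iUnion.2 ⟨m, ?_⟩
  simp only [Finset.mem_coe, Multiset.mem_toFinset, Polynomial.mem_aroots]
  refine ⟨omegaPoly_ne_zero m, ?_⟩
  rw [aeval_omegaPoly, hm, sub_self]

/-- Evaluation at a point of a half-open annulus. -/
def evO {a : Rad p} (x : Omega a) : OAlg a →ₐ[ℚ_[p]] ℂ_[p] :=
  (Pi.evalAlgHom ℚ_[p] (fun _ : Omega a => ℂ_[p]) x).comp (OAlg a).val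

theorem rep_sum_mul {ι : Type*} (s : Finset ι) (f g : ι → RobbaRing p) :
    ∀ᶠ x in bdry p, rep (∑ i ∈ s, f i * g i) x = ∑ i ∈ s, rep (f i) x * rep (g i) x := by
  have h : ∀ᶠ x in bdry p, ∀ i ∈ s, rep (f i * g i) x = rep (f i) x * rep (g i) x :=
    (Finset.eventually_all s).2 fun i _ => rep_mul (f i) (g i)
  filter_upwards [h, rep_sum s fun i => f i * g i] with x h1 h2
  rw [h2]
  exact Finset.sum_congr rfl h1

theorem rep_constR (c : ℚ_[p]) : ∀ᶠ x in bdry p, rep (constR c) x = algebraMap ℚ_[p] ℂ_[p] c :=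
  Germ.coe_eq.1 (coe_rep _)

theorem rep_one : ∀ᶠ x in bdry p, rep (1 : RobbaRing p) x = 1 :=
  Germ.coe_eq.1 (coe_rep _)

/-- The span of the values at a point of vectors over the Robba ring. -/
def fiberSpan {ι : Type*} {n : ℕ} (w : ι → Fin n → RobbaRing p) (x : ℂ_[p]) :
    Submodule ℂ_[p] (Fin n → ℂ_[p]) :=
  Submodule.span ℂ_[p] (Set.range fun s j => rep (w s j) x)

theorem eventually_mem_fiberSpan {ι : Type*} [Finite ι] {n : ℕ} {w : ι → Fin n → RobbaRing p}
    {v : Fin n → RobbaRing p} (hv : v ∈ Submodule.span (RobbaRing p) (Set.range w)) :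
    ∀ᶠ x in bdry p, (fun j => rep (v j) x) ∈ fiberSpan w x := by
  have := Fintype.ofFinite ι
  obtain ⟨c, hc⟩ := (Submodule.mem_span_range_iff_exists_fun _).1 hv
  have h : ∀ᶠ x in bdry p, ∀ j, rep (∑ s, c s * w s j) x = ∑ s, rep (c s) x * rep (w s j) x :=
    eventually_all.2 fun j => rep_sum_mul _ _ _
  filter_upwards [h] with x hx
  refine (Submodule.mem_span_range_iff_exists_fun _).2 ⟨fun s => rep (c s) x, ?_⟩
  funext j
  rw [← hc, Finset.sum_apply, Finset.sum_apply]
  exact (hx j).symm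

/-- If the `w` generate the relations of a module, the quotient by `fiberSpan w x` is its fiber at
x. Here Φ is the matrix of φ and Ψ expresses the generators through their Frobenius images, so the
fiber at φ(x) maps onto the fiber at x. -/
theorem eventually_finrank_fiberSpan_le {ι : Type*} [Finite ι] {n : ℕ}
    {w : ι → Fin n → RobbaRing p} (Φ Ψ : Matrix (Fin n) (Fin n) (RobbaRing p))
    (h1 : ∀ s, (fun j => ∑ i, frob p (w s i) * Φ i j) ∈
      Submodule.span (RobbaRing p) (Set.range w))
    (h2 : ∀ i, (1 - Ψ * Φ) i ∈ Submodule.span (RobbaRing p) (Set.range w)) :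
    ∀ᶠ x in bdry p, Module.finrank ℂ_[p] (fiberSpan w (frobFun p x)) ≤
      Module.finrank ℂ_[p] (fiberSpan w x) := by
  have e1 : ∀ᶠ x in bdry p, ∀ s, (fun j => rep (∑ i, frob p (w s i) * Φ i j) x) ∈ fiberSpan w x :=
    eventually_all.2 fun s => eventually_mem_fiberSpan (h1 s)
  have e2 : ∀ᶠ x in bdry p, ∀ i, (fun j => rep ((1 - Ψ * Φ) i j) x) ∈ fiberSpan w x :=
    eventually_all.2 fun i => eventually_mem_fiberSpan (h2 i)
  have e3 : ∀ᶠ x in bdry p, ∀ s j, rep (∑ i, frob p (w s i) * Φ i j) x =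
      ∑ i, rep (frob p (w s i)) x * rep (Φ i j) x :=
    eventually_all.2 fun s => eventually_all.2 fun j => rep_sum_mul _ _ _
  have e4 : ∀ᶠ x in bdry p, ∀ s i, rep (frob p (w s i)) x = rep (w s i) (frobFun p x) :=
    eventually_all.2 fun s => eventually_all.2 fun i => rep_frob _
  have e5 : ∀ᶠ x in bdry p, ∀ i j, rep ((1 - Ψ * Φ) i j + (Ψ * Φ) i j) x =
      rep ((1 - Ψ * Φ) i j) x + rep ((Ψ * Φ) i j) x :=
    eventually_all.2 fun s => eventually_all.2 fun j => rep_add _ _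
  have e6 : ∀ᶠ x in bdry p, ∀ i j, rep (∑ l, Ψ i l * Φ l j) x =
      ∑ l, rep (Ψ i l) x * rep (Φ l j) x :=
    eventually_all.2 fun s => eventually_all.2 fun j => rep_sum_mul _ _ _
  filter_upwards [e1, e2, e3, e4, e5, e6, rep_one, rep_zero] with x h1 h2 h3 h4 h5 h6 h7 h8
  refine finrank_le_of_approx
    (Matrix.vecMulLinear (Matrix.of fun i j => rep (Φ i j) x))
    (Matrix.vecMulLinear (Matrix.of fun i j => rep (Ψ i j) x)) ?_ ?_
  · rw [fiberSpan, Submodule.span_le]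
    rintro _ ⟨s, rfl⟩
    have := h1 s
    simp only [h3, h4] at this
    exact this
  · have hone : ∀ i, (fun j => rep ((1 - Ψ * Φ) i j) x) =
        Pi.single i 1 - Matrix.vecMulLinear (Matrix.of fun i j => rep (Φ i j) x)
          (Matrix.vecMulLinear (Matrix.of fun i j => rep (Ψ i j) x) (Pi.single i 1)) := by
      intro i
      funext j
      have h9 := h5 i j
      rw [← Matrix.add_apply, sub_add_cancel, Matrix.mul_apply, h6] at h9
      have h10 : rep ((1 : Matrix (Fin n) (Fin n) (RobbaRing p)) i j) x =
          (Pi.single i 1 : Fin n → ℂ_[p]) j := by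
        rcases eq_or_ne i j with rfl | hij
        · rw [Matrix.one_apply_eq, h7, Pi.single_eq_same]
        · rw [Matrix.one_apply_ne hij, h8, Pi.single_eq_of_ne' hij]
      rw [h10] at h9
      rw [Pi.sub_apply, h9]
      simp [Matrix.vecMul, dotProduct]
    intro v
    have hv : v = ∑ i, v i • (Pi.single i 1 : Fin n → ℂ_[p]) := by
      funext j
      simp [Finset.sum_apply, Pi.single_apply]
    rw [hv, map_sum, map_sum, ← Finset.sum_sub_distrib]
    refine Submodule.sum_mem _ fun i _ => ?_
    rw [map_smul, map_smul, ← smul_sub, ← hone]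
    exact Submodule.smul_mem _ _ (h2 i)

/-! ### Generators independent modulo t. -/

section Basis

/-- The rows of a matrix over the Robba ring together with constant rows on the moment curve. -/
def augRows {B : Type*} {ι : Type*} {n : ℕ} (w : ι → Fin n → B) (C : ℚ_[p] → B)
    (z : ℕ → ℚ_[p]) (d : ℕ) : ι ⊕ Fin d → Fin n → B :=
  Sum.elim w fun i j => C (z i ^ (j : ℕ))

variable {ι : Type*} [Finite ι] {n : ℕ} {w : ι → Fin n → RobbaRing p} {z : ℕ → ℚ_[p]}

/-- Spanning is the nonvanishing at x of one of finitely many minors. As the parameters `z` lie in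
ℚ_p, these minors are analytic functions over ℚ_p, so the condition is invariant under conjugation.
-/
theorem addMoments_fiberSpan_eq_top_iff {a : Rad p} {W : ι → Fin n → OAlg a} (x : Omega a)
    (hW : ∀ s j, (W s j).1 x = rep (w s j) x.1) (d : ℕ) :
    addMoments (fiberSpan w x.1) z d = ⊤ ↔ ∃ s : Fin n → ι ⊕ Fin d,
      (Matrix.det (Matrix.of fun i => augRows W (algebraMap ℚ_[p] (OAlg a)) z d (s i))).1 x ≠ 0 := by
  have h1 : addMoments (fiberSpan w x.1) z d = Submodule.span ℂ_[p] (Set.range fun c j =>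
      evO x (augRows W (algebraMap ℚ_[p] (OAlg a)) z d c j)) := by
    rw [addMoments, fiberSpan, ← Submodule.span_union]
    congr 1
    ext v
    constructor
    · rintro (⟨s, rfl⟩ | ⟨i, rfl⟩)
      · exact ⟨Sum.inl s, funext fun j => hW s j⟩
      · refine ⟨Sum.inr i, funext fun j => ?_⟩
        exact AlgHom.commutes _ _
    · rintro ⟨s | i, rfl⟩
      · exact Or.inl ⟨s, funext fun j => (hW s j).symm⟩
      · refine Or.inr ⟨i, funext fun j => ?_⟩
        exact (AlgHom.commutes _ _).symm
  have h2 : ∀ s : Fin n → ι ⊕ Fin d,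
      (Matrix.det (Matrix.of fun i => augRows W (algebraMap ℚ_[p] (OAlg a)) z d (s i))).1 x =
      Matrix.det (Matrix.of fun i j =>
        evO x (augRows W (algebraMap ℚ_[p] (OAlg a)) z d (s i) j)) := fun s =>
    AlgHom.map_det (evO x) _
  simp only [h1, h2]
  constructor
  · exact fun h => exists_det_ne_zero h
  · rintro ⟨s, hs⟩
    rw [eq_top_iff, ← span_rows_eq_top hs]
    refine Submodule.span_mono ?_
    rintro _ ⟨i, rfl⟩
    exact ⟨s i, rfl⟩

theorem eventually_exists_lift_matrix (w : ι → Fin n → RobbaRing p) :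
    ∀ᶠ y in bdry p, ∀ a : Rad p, ‖a.1‖ = ‖y‖ → ∃ W : ι → Fin n → OAlg a,
      (∀ s j, toR a (W s j) = w s j) ∧ ∀ s j (x : Omega a), (W s j).1 x = rep (w s j) x.1 := by
  filter_upwards [eventually_all.2 fun s => eventually_all.2 fun j => exists_lift (w s j)]
    with y hy a ha
  choose W h1 h2 using fun s j => hy s j a ha
  exact ⟨W, h1, h2⟩

theorem exists_good_of_eventually {P : ℂ_[p] → Prop} (h : ∀ᶠ x in bdry p, P x) {r : ℝ}
    (hr : r < 1) : ∃ a : Rad p, Good a ∧ r < ‖a.1‖ ∧ ∀ x : ℂ_[p], ‖a.1‖ ≤ ‖x‖ → ‖x‖ < 1 → P x := by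
  obtain ⟨r', hr', h⟩ := eventually_bdry_iff.1 h
  obtain ⟨a, ha, hra⟩ := exists_good (p := p) (max_lt hr hr')
  exact ⟨a, ha, (le_max_left _ _).trans_lt hra,
    fun x h1 h2 => h x (((le_max_right _ _).trans_lt hra).trans_le h1) h2⟩

/-- A property of torsion points that is stable under conjugation, and holds at a point if it holds
at its image under `φ`, holds at all torsion points closer to the boundary than a given one. -/
theorem of_torsion_lt {a : Rad p} {Q : Omega a → Prop}
    (hconj : ∀ (x y : Omega a) (n : ℕ), IsPrimitiveRoot (1 + x.1) (p ^ n) →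
      IsPrimitiveRoot (1 + y.1) (p ^ n) → Q x → Q y)
    (hQ : ∀ (x : Omega a) (h : ‖a.1‖ ≤ ‖frobFun p x.1‖), logFun p x.1 = 0 →
      Q ⟨frobFun p x.1, h, (norm_frobFun_le x.2.2).trans_lt x.2.2⟩ → Q x)
    {x₀ x : Omega a} (hx₀ : logFun p x₀.1 = 0) (hQ₀ : Q x₀) (hx : logFun p x.1 = 0)
    (h : ‖x₀.1‖ < ‖x.1‖) : Q x := by
  obtain ⟨n, hn⟩ := exists_isPrimitiveRoot x₀.2.2 hx₀
  obtain ⟨N, hN⟩ := exists_isPrimitiveRoot x.2.2 hx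
  have hnN : n ≤ N := by
    by_contra hlt
    push Not at hlt
    exact absurd (norm_le_of_isPrimitiveRoot x₀.2.2 hlt.le hn hN.pow_eq_one) (not_le.2 h)
  have hlt : ∀ i, ‖(frobFun p)^[i] x.1‖ < 1 := fun i =>
    (norm_iterate_frobFun_le x.2.2 i).trans_lt x.2.2
  have hge : ∀ i ≤ N - n, ‖a.1‖ ≤ ‖(frobFun p)^[i] x.1‖ := fun i hi =>
    x₀.2.1.trans (norm_le_norm_iterate x.2.2 hnN hN hn hi)
  have hlog : ∀ i, logFun p ((frobFun p)^[i] x.1) = 0 := by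
    intro i
    induction i with
    | zero => exact hx
    | succ i ih => rw [Function.iterate_succ_apply', log_frobFun (hlt i), ih, mul_zero]
  have key : ∀ i (hi : i ≤ N - n), Q ⟨(frobFun p)^[i] x.1, hge i hi, hlt i⟩ → Q x := by
    intro i
    induction i with
    | zero => exact fun _ h => h
    | succ i ih =>
      intro hi h1
      refine ih (by omega) (hQ _ ?_ (hlog i) ?_)
      · have := hge (i + 1) hi
        rwa [Function.iterate_succ_apply'] at this
      · simpa only [Function.iterate_succ_apply'] using h1
  exact key (N - n) le_rfl (hconj x₀ _ n hn (isPrimitiveRoot_iterate hnN hN) hQ₀)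

theorem add_eq_of_minimal {q d n : ℕ} (h1 : n ≤ q + d) (h2 : q ≤ n)
    (h3 : 0 < d → ¬ n ≤ q + (d - 1)) : q + d = n := by
  omega

/-- The dimensions of the fibers at the torsion points close to the boundary are constant. -/
theorem exists_forall_finrank_fiberSpan
    (hz : ∀ x : ℂ_[p], ‖x‖ < 1 → logFun p x = 0 → IsGeneric (fiberSpan w x) z)
    (hφ : ∀ᶠ x in bdry p, Module.finrank ℂ_[p] (fiberSpan w (frobFun p x)) ≤
      Module.finrank ℂ_[p] (fiberSpan w x)) :
    ∃ d, ∃ r < (1 : ℝ), ∀ x : ℂ_[p], r < ‖x‖ → ‖x‖ < 1 → logFun p x = 0 →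
      addMoments (fiberSpan w x) z d = ⊤ ∧ Module.finrank ℂ_[p] (fiberSpan w x) + d = n := by
  classical
  obtain ⟨a, -, -, ha⟩ := exists_good_of_eventually
    (hφ.and (eventually_exists_lift_matrix w)) one_pos
  obtain ⟨W, -, hW⟩ := (ha a.1 le_rfl a.2.2).2 a rfl
  let Q : ℕ → Omega a → Prop := fun d x => addMoments (fiberSpan w x.1) z d = ⊤
  have hQ : ∀ (d : ℕ) (x : Omega a), logFun p x.1 = 0 →
      (Q d x ↔ n ≤ Module.finrank ℂ_[p] (fiberSpan w x.1) + d) := fun d x hx =>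
    (hz x.1 x.2.2 hx).addMoments_eq_top_iff
  have hconj : ∀ (d : ℕ) (x y : Omega a) (N : ℕ), IsPrimitiveRoot (1 + x.1) (p ^ N) →
      IsPrimitiveRoot (1 + y.1) (p ^ N) → Q d x → Q d y := by
    intro d x y N hx hy h
    obtain ⟨s, hs⟩ := (addMoments_fiberSpan_eq_top_iff x (fun s j => hW s j x) d).1 h
    exact (addMoments_fiberSpan_eq_top_iff y (fun s j => hW s j y) d).2
      ⟨s, fun h0 => hs (ext_conj hy hx h0)⟩
  -- Taking d = n always works at a torsion point, so failure means that the annulus contains none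
  -- and the claim is vacuous.
  by_cases hex : ∃ d, ∃ x : Omega a, logFun p x.1 = 0 ∧ Q d x
  swap
  · refine ⟨0, ‖a.1‖, a.2.2, fun x h1 h2 h3 => absurd ⟨n, ⟨x, h1.le, h2⟩, h3, ?_⟩ hex⟩
    rw [hQ n _ h3]
    exact Nat.le_add_left _ _
  -- With d minimal, d moment vectors suffice at x₀, hence at every torsion point closer to the
  -- boundary, and d - 1 suffice nowhere. General position turns this into the exact dimension
  -- count.
  obtain ⟨d, ⟨x₀, hx₀, hQ₀⟩, hmin⟩ : ∃ d, (∃ x : Omega a, logFun p x.1 = 0 ∧ Q d x) ∧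
      ∀ d' < d, ¬ ∃ x : Omega a, logFun p x.1 = 0 ∧ Q d' x :=
    ⟨Nat.find hex, Nat.find_spec hex, fun d' hd' => Nat.find_min hex hd'⟩
  refine ⟨d, ‖x₀.1‖, x₀.2.2, fun x h1 h2 h3 => ?_⟩
  have hQx : Q d ⟨x, x₀.2.1.trans h1.le, h2⟩ := by
    refine of_torsion_lt (hconj d) (fun y hy hl hq => ?_) hx₀ hQ₀ h3 h1
    have h4 := (hQ d _ ((log_frobFun y.2.2).trans (by rw [hl, mul_zero]))).1 hq
    exact (hQ d y hl).2 (h4.trans (Nat.add_le_add_right (ha y.1 y.2.1 y.2.2).1 d))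
  have hle : Module.finrank ℂ_[p] (fiberSpan w x) ≤ n :=
    (Submodule.finrank_le _).trans (Module.finrank_fin_fun _).le
  refine ⟨hQx, add_eq_of_minimal ((hQ d ⟨x, _⟩ h3).1 hQx) hle fun hpos h4 => ?_⟩
  exact hmin (d - 1) (Nat.sub_lt hpos one_pos)
    ⟨⟨x, x₀.2.1.trans h1.le, h2⟩, h3, (hQ (d - 1) ⟨x, _⟩ h3).2 h4⟩

variable {D : Type*} [AddCommGroup D] [Module (RobbaRing p) D]

/-- A finitely presented module with an étale Frobenius that is killed by a power of `t` is
generated by elements that are independent modulo `t`. -/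
theorem exists_generators_independent_mod [Module.FinitePresentation (RobbaRing p) D]
    (φ : D →ₛₗ[frob p] D) (hφ : Submodule.span (RobbaRing p) (Set.range φ) = ⊤) {k : ℕ}
    (hk : ∀ x : D, tElt p ^ k • x = 0) :
    ∃ (d : ℕ) (m : Fin d → D), Submodule.span (RobbaRing p) (Set.range m) = ⊤ ∧
      ∀ (b : Fin d → RobbaRing p) (y : D), ∑ i, b i • m i = tElt p • y → ∀ i, tElt p ∣ b i := by
  obtain ⟨n, e, he, hfg⟩ := exists_presentation (R := RobbaRing p) (M := D)
  obtain ⟨l, w, hw⟩ := Submodule.fg_iff_exists_fin_generating_family.1 hfg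
  have hwrel : ∀ s, w s ∈ relations e := fun s => hw ▸ Submodule.subset_span ⟨s, rfl⟩
  obtain ⟨z, hz⟩ := exists_isGeneric (K := ℂ_[p]) (countable_torsion (p := p))
    (not_countable_padic (p := p))
    (fiberSpan w)
  have hcoord : ∀ y : D, ∃ c : Fin n → RobbaRing p, ∑ i, c i • e i = y := fun y =>
    (Submodule.mem_span_range_iff_exists_fun _).1 (he.symm ▸ Submodule.mem_top)
  have hφe : Submodule.span (RobbaRing p) (Set.range fun i => φ (e i)) = ⊤ := by
    rw [eq_top_iff, ← hφ, Submodule.span_le]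
    rintro _ ⟨y, rfl⟩
    obtain ⟨c, rfl⟩ := hcoord y
    rw [map_sum]
    refine Submodule.sum_mem _ fun i _ => ?_
    rw [LinearMap.map_smulₛₗ]
    exact Submodule.smul_mem _ _ (Submodule.subset_span ⟨i, rfl⟩)
  choose Φ hΦ using fun i => hcoord (φ (e i))
  choose Ψ hΨ using fun i => (Submodule.mem_span_range_iff_exists_fun (RobbaRing p)).1
    (hφe.symm ▸ Submodule.mem_top : e i ∈ Submodule.span (RobbaRing p) (Set.range fun i => φ (e i)))
  have hΦsum : ∀ g : Fin n → RobbaRing p, ∑ j, (∑ i, g i * Φ i j) • e j = ∑ i, g i • φ (e i) := by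
    intro g
    simp only [Finset.sum_smul, mul_smul]
    rw [Finset.sum_comm]
    refine Finset.sum_congr rfl fun i _ => ?_
    rw [← Finset.smul_sum, hΦ]
  have hrank := eventually_finrank_fiberSpan_le (w := w) (Matrix.of Φ) (Matrix.of Ψ)
    (fun s => by
      rw [hw, mem_relations]
      refine (hΦsum _).trans ?_
      have := congrArg φ (mem_relations.1 (hwrel s))
      rw [map_sum, map_zero] at this
      simp only [LinearMap.map_smulₛₗ] at this
      exact this)
    (fun i => by
      rw [hw, mem_relations]
      simp only [Matrix.sub_apply, Matrix.mul_apply, Matrix.of_apply, sub_smul,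
        Finset.sum_sub_distrib]
      rw [hΦsum (Ψ i), hΨ, sub_eq_zero, Finset.sum_eq_single i]
      · simp
      · intro j _ hj
        rw [Matrix.one_apply_ne' hj, zero_smul]
      · simp)
  obtain ⟨d, r, hr, hd⟩ := exists_forall_finrank_fiberSpan
    (fun x h1 h2 => hz x ⟨h1, h2⟩) hrank
  let m : Fin d → D := fun i => ∑ j : Fin n, constR (z i ^ (j : ℕ)) • e j
  refine ⟨d, m, ?_, fun b y hby => ?_⟩
  · obtain ⟨a, -, hra, ha⟩ := exists_good_of_eventually (eventually_exists_lift_matrix w) hr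
    obtain ⟨W, hWR, hW⟩ := ha a.1 le_rfl a.2.2 a rfl
    -- The logarithm together with the maximal minors of relations and moment rows. They have no
    -- common zero, since at every torsion point one of the minors is nonzero.
    let F : Option (Fin n → Fin l ⊕ Fin d) → OAlg a := fun o => o.elim (logO a) fun s =>
      Matrix.det (Matrix.of fun i => augRows W (algebraMap ℚ_[p] (OAlg a)) z d (s i))
    obtain ⟨c, hc⟩ := exists_sum_mul_eq_one F fun x => by
      by_cases hx : logFun p x.1 = 0
      · obtain ⟨s, hs⟩ := (addMoments_fiberSpan_eq_top_iff x (fun s j => hW s j x) d).1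
          (hd x.1 (hra.trans_le x.2.1) x.2.2 hx).1
        exact ⟨some s, hs⟩
      · exact ⟨none, by rwa [← logO_apply (a := a) x] at hx⟩
    set N := Submodule.span (RobbaRing p) (Set.range m) with hN
    -- Modulo N the moment rows become relations too, so each minor lies in a Fitting ideal of D/N
    -- and kills it. Together with the Bézout identity this gives D = N + tD.
    have hdet : ∀ s j, toR a (F (some s)) • e j ∈ N := by
      intro s j
      rw [← Submodule.Quotient.mk_eq_zero, Submodule.Quotient.mk_smul]
      refine smul_eq_zero_of_mem_fitting (e := fun j => (Submodule.Quotient.mk (e j) : D ⧸ N)) ?_ j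
      change toR a (Matrix.det _) ∈ _
      rw [RingHom.map_det]
      refine det_mem_fitting fun i => ?_
      rw [mem_relations]
      have hmk : ∀ g : Fin n → RobbaRing p,
          ∑ j, g j • (Submodule.Quotient.mk (e j) : D ⧸ N) = N.mkQ (∑ j, g j • e j) := fun g => by
        rw [map_sum]
        rfl
      rw [hmk, Submodule.mkQ_apply, Submodule.Quotient.mk_eq_zero]
      change ∑ j, toR a (augRows W (algebraMap ℚ_[p] (OAlg a)) z d (s i) j) • e j ∈ N
      rcases s i with t | t
      · have : ∑ j, toR a (W t j) • e j = 0 := by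
          simp only [hWR]
          exact hwrel t
        exact this ▸ zero_mem N
      · refine Submodule.subset_span ⟨t, ?_⟩
        refine Finset.sum_congr rfl fun j _ => ?_
        rw [← toR_algebraMap a]
        rfl
    have hone : ∀ j, ∃ y, e j - tElt p • y ∈ N := by
      intro j
      refine ⟨toR a (c none) • e j, ?_⟩
      have h1 : (1 : RobbaRing p) = toR a (c none) * tElt p +
          ∑ s, toR a (c (some s)) * toR a (F (some s)) := by
        rw [← map_one (toR a), ← hc, map_sum, Fintype.sum_option, map_mul]
        simp only [map_mul]
        rw [← toR_logO a]
        rfl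
      have h2 : e j - tElt p • toR a (c none) • e j =
          ∑ s, toR a (c (some s)) • toR a (F (some s)) • e j := by
        nth_rewrite 1 [← one_smul (RobbaRing p) (e j)]
        rw [h1, add_smul, Finset.sum_smul, smul_smul, mul_comm (tElt p), add_sub_cancel_left]
        simp only [mul_smul]
      rw [h2]
      exact Submodule.sum_mem _ fun s _ => Submodule.smul_mem _ _ (hdet s j)
    have hone' : ∀ x : D, ∃ y, x - tElt p • y ∈ N := by
      intro x
      obtain ⟨c, rfl⟩ := hcoord x
      choose y hy using hone
      refine ⟨∑ j, c j • y j, ?_⟩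
      rw [Finset.smul_sum, ← Finset.sum_sub_distrib]
      refine Submodule.sum_mem _ fun j _ => ?_
      rw [smul_comm, ← smul_sub]
      exact Submodule.smul_mem _ _ (hy j)
    -- Iterating gives D = N + t^i D, and t^k kills D.
    have hpow : ∀ i (x : D), ∃ y, x - tElt p ^ i • y ∈ N := by
      intro i
      induction i with
      | zero => exact fun x => ⟨x, by rw [pow_zero, one_smul, sub_self]; exact zero_mem N⟩
      | succ i ih =>
        intro x
        obtain ⟨y, hy⟩ := ih x
        obtain ⟨y', hy'⟩ := hone' y
        refine ⟨y', ?_⟩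
        have := N.add_mem hy (N.smul_mem (tElt p ^ i) hy')
        rwa [smul_sub, smul_smul, ← pow_succ, sub_add_sub_cancel] at this
    rw [eq_top_iff]
    intro x _
    obtain ⟨y, hy⟩ := hpow k x
    rwa [hk, sub_zero] at hy
  · obtain ⟨c, hc⟩ := hcoord y
    -- In terms of the e, the identity ∑ b_i m_i = t y is a relation. At a torsion point its t-part
    -- vanishes and the moment vectors, independent modulo the fiber of relations, force b_i to
    -- vanish there.
    have hrel : (fun j : Fin n => ∑ i, b i * constR (z i ^ (j : ℕ)) + -(tElt p * c j)) ∈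
        relations e := by
      rw [mem_relations]
      simp only [add_smul, neg_smul, Finset.sum_add_distrib, Finset.sum_neg_distrib,
        Finset.sum_smul, mul_smul]
      rw [Finset.sum_comm]
      simp only [← Finset.smul_sum]
      rw [hc, ← sub_eq_add_neg, sub_eq_zero]
      exact hby
    have e1 := eventually_mem_fiberSpan (hw.symm ▸ hrel)
    have e2 : ∀ᶠ x in bdry p, ∀ j : Fin n,
        rep (∑ i, b i * constR (z i ^ (j : ℕ)) + -(tElt p * c j)) x =
        ∑ i, rep (b i) x * rep (constR (z i ^ (j : ℕ))) x +
          rep (-(tElt p * c j)) x := eventually_all.2 fun j => by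
      filter_upwards [rep_add (∑ i, b i * constR (z i ^ (j : ℕ))) (-(tElt p * c j)),
        rep_sum_mul Finset.univ b fun i => constR (z i ^ (j : ℕ))] with x h1 h2
      rw [h1, h2]
    have e3 : ∀ᶠ x in bdry p, ∀ j : Fin n,
        rep (-(tElt p * c j)) x = - (logFun p x * rep (c j) x) := eventually_all.2 fun j => by
      filter_upwards [rep_add (-(tElt p * c j)) (tElt p * c j), rep_mul (tElt p) (c j),
        rep_tElt (p := p), rep_zero (p := p)] with x h1 h2 h3 h4
      rw [neg_add_cancel, h4, h2, h3] at h1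
      exact eq_neg_of_add_eq_zero_left h1.symm
    have e4 : ∀ᶠ x in bdry p, ∀ (i : Fin d) (j : Fin n), rep (constR (z i ^ (j : ℕ))) x =
        algebraMap ℚ_[p] ℂ_[p] (z i ^ (j : ℕ)) :=
      eventually_all.2 fun i => eventually_all.2 fun j => rep_constR _
    have e5 := eventually_all.2 fun i => exists_lift (b i)
    obtain ⟨a, hag, hra, ha⟩ := exists_good_of_eventually
      (e1.and (e2.and (e3.and (e4.and e5)))) hr
    choose B hBR hB using fun i => (ha a.1 le_rfl a.2.2).2.2.2.2 i a rfl
    intro i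
    have hdvd : logO a ∣ B i := by
      refine logO_dvd_of_forall_zero hag fun x hx => ?_
      obtain ⟨h1, h2, h3, h4, -⟩ := ha x.1 x.2.1 x.2.2
      obtain ⟨h5, h6⟩ := hd x.1 (hra.trans_le x.2.1) x.2.2 hx
      have h7 : ∑ i, rep (b i) x.1 • momentVec ℂ_[p] n (z i) ∈ fiberSpan w x.1 := by
        convert h1 using 1
        funext j
        rw [h2, h3, hx, zero_mul, neg_zero, add_zero, Finset.sum_apply]
        refine Finset.sum_congr rfl fun i _ => ?_
        rw [h4]
        rfl
      rw [hB]
      exact congrFun (eq_zero_of_sum_momentVec_mem (b := fun i => rep (b i) x.1) h5 h6 h7) i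
    rw [← hBR i, ← toR_logO a]
    exact map_dvd _ hdvd

end Basis

/-! ### Criteria for torsion `(φ, Γ)`-modules -/

section Criteria

open scoped TensorProduct

/-- An element of the Robba ring as an element of its Frobenius twist. -/
def twist (f : RobbaRing p) : FrobTwist p := f

/-- The vectors that are combinations of Frobenius transforms of vectors in `V`. -/
def FrobRel {n : ℕ} (V : Submodule (RobbaRing p) (Fin n → RobbaRing p))
    (f : Fin n → RobbaRing p) : Prop :=
  ∃ (l : ℕ) (v : Fin l → Fin n → RobbaRing p) (y : Fin l → RobbaRing p),
    (∀ s, v s ∈ V) ∧ ∀ i, f i = ∑ s, frob p (v s i) * y s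

variable {D : Type*} [AddCommGroup D] [Module (RobbaRing p) D]

/-- The equational criterion for the vanishing of a sum of tensors, with the generators on the side
where the relations are known. -/
theorem sum_tmul_eq_zero_iff {n : ℕ} {e : Fin n → D}
    (he : Submodule.span (RobbaRing p) (Set.range e) = ⊤) (f : Fin n → RobbaRing p) :
    ∑ i, twist (f i) ⊗ₜ[RobbaRing p] e i = 0 ↔ FrobRel (relations e) f := by
  have h1 : TensorProduct.comm (RobbaRing p) (FrobTwist p) D
      (∑ i, twist (f i) ⊗ₜ[RobbaRing p] e i) =
        ∑ i, e i ⊗ₜ[RobbaRing p] twist (f i) := by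
    rw [map_sum]
    rfl
  rw [← (TensorProduct.comm (RobbaRing p) (FrobTwist p) D).map_eq_zero_iff, h1]
  constructor
  · intro h
    obtain ⟨l, a, y, h2, h3⟩ :=
      TensorProduct.vanishesTrivially_of_sum_tmul_eq_zero (RobbaRing p) he h
    exact ⟨l, fun s i => a i s, y, h3, h2⟩
  · rintro ⟨l, v, y, h2, h3⟩
    exact TensorProduct.sum_tmul_eq_zero_of_vanishesTrivially (RobbaRing p)
      (n := fun i => twist (f i)) ⟨l, fun i s => v s i, y, h3, h2⟩

namespace PhiGammaAction

theorem linearization_sum (A : PhiGammaAction p D) {n : ℕ} (e : Fin n → D)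
    (f : Fin n → RobbaRing p) :
    A.linearization (∑ i, twist (f i) ⊗ₜ[RobbaRing p] e i) = ∑ i, f i • A.phi (e i) := by
  rw [map_sum]
  rfl

theorem exists_eq_sum_tmul {n : ℕ} {e : Fin n → D}
    (he : Submodule.span (RobbaRing p) (Set.range e) = ⊤) (z : FrobTwist p ⊗[RobbaRing p] D) :
    ∃ f : Fin n → RobbaRing p, z = ∑ i, twist (f i) ⊗ₜ[RobbaRing p] e i := by
  induction z using TensorProduct.induction_on with
  | zero =>
    refine ⟨0, (Finset.sum_eq_zero fun i _ => ?_).symm⟩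
    exact TensorProduct.zero_tmul _ _
  | tmul g x =>
    obtain ⟨c, rfl⟩ := (Submodule.mem_span_range_iff_exists_fun (RobbaRing p)).1
      (he.symm ▸ Submodule.mem_top : x ∈ Submodule.span (RobbaRing p) (Set.range e))
    refine ⟨fun i => frob p (c i) * (show RobbaRing p from g), ?_⟩
    rw [TensorProduct.tmul_sum]
    exact Finset.sum_congr rfl fun i _ => (TensorProduct.smul_tmul (c i) g (e i)).symm
  | add u v hu hv =>
    obtain ⟨f, rfl⟩ := hu
    obtain ⟨g, rfl⟩ := hv
    refine ⟨f + g, ?_⟩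
    rw [← Finset.sum_add_distrib]
    exact Finset.sum_congr rfl fun i _ => (TensorProduct.add_tmul _ _ _).symm

theorem injective_linearization_iff (A : PhiGammaAction p D) {n : ℕ} {e : Fin n → D}
    (he : Submodule.span (RobbaRing p) (Set.range e) = ⊤) :
    Function.Injective A.linearization ↔
      ∀ f : Fin n → RobbaRing p, ∑ i, f i • A.phi (e i) = 0 → FrobRel (relations e) f := by
  rw [injective_iff_map_eq_zero]
  constructor
  · intro h f hf
    rw [← sum_tmul_eq_zero_iff he]
    exact h _ (by rw [linearization_sum, hf])
  · intro h z hz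
    obtain ⟨f, rfl⟩ := exists_eq_sum_tmul he z
    rw [linearization_sum] at hz
    exact (sum_tmul_eq_zero_iff he f).2 (h f hz)

/-- The conditions defining a torsion module involve φ only, so this criterion in coordinates never
mentions Γ. -/
theorem isTorsion_of_generators (A : PhiGammaAction p D) {n : ℕ} {e : Fin n → D}
    (he : Submodule.span (RobbaRing p) (Set.range e) = ⊤)
    (hfg : (relations (R := RobbaRing p) e).FG)
    (hsurj : Submodule.span (RobbaRing p) (Set.range A.phi) = ⊤)
    (hinj : ∀ f : Fin n → RobbaRing p, ∑ i, f i • A.phi (e i) = 0 → FrobRel (relations e) f)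
    (htors : Module.IsTorsion (RobbaRing p) D) : A.IsTorsion where
  isGeneralized :=
    { finitePresentation := Module.finitePresentation_of_surjective
        (Fintype.linearCombination (RobbaRing p) e)
        (by rw [← LinearMap.range_eq_top, Fintype.range_linearCombination, he]) hfg
      bijective_linearization := ⟨(A.injective_linearization_iff he).2 hinj,
        A.surjective_linearization_iff.2 hsurj⟩ }
  isTorsion := htors

end PhiGammaAction

theorem fg_relations [Module.FinitePresentation (RobbaRing p) D] {n : ℕ} {e : Fin n → D}
    (he : Submodule.span (RobbaRing p) (Set.range e) = ⊤) :
    (relations (R := RobbaRing p) e).FG :=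
  Module.FinitePresentation.fg_ker (Fintype.linearCombination (RobbaRing p) e)
    (by rw [← LinearMap.range_eq_top, Fintype.range_linearCombination, he])

theorem tElt_mem_nonZeroDivisors : tElt p ∈ nonZeroDivisors (RobbaRing p) := by
  refine mem_nonZeroDivisors_iff_right.2 fun f hf => ?_
  obtain ⟨a, hag, -, ha⟩ := exists_good_of_eventually (exists_lift f) one_pos
  obtain ⟨F, hFR, -⟩ := ha a.1 le_rfl a.2.2 a rfl
  rw [← hFR, ← toR_logO a, ← map_mul] at hf
  have h1 : logO a * F = logO a * 0 := by
    rw [mul_zero]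
    refine toR_injective a (Eq.trans ?_ (map_zero _).symm)
    rwa [mul_comm] at hf
  rw [← hFR, logO_mul_cancel hag h1, map_zero]

theorem tElt_mul_cancel {f g : RobbaRing p} (h : tElt p * f = tElt p * g) : f = g :=
  (mul_cancel_left_mem_nonZeroDivisors tElt_mem_nonZeroDivisors).1 h

theorem isUnit_p : IsUnit (p : RobbaRing p) := isUnit_natCast_robba (Fact.out : p.Prime).ne_zero

/-- If the relations between generators of a torsion `(φ, Γ)`-module are divisible by `t`, then its
submodule generated by `t` is a torsion `(φ, Γ)`-module. -/
theorem PhiGammaAction.IsTorsion.of_injective {A : PhiGammaAction p D} (hA : A.IsTorsion) {n : ℕ}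
    {e : Fin n → D} (he : Submodule.span (RobbaRing p) (Set.range e) = ⊤)
    (hrel : ∀ v ∈ relations (R := RobbaRing p) e, ∀ i, tElt p ∣ v i)
    {E : Type*} [AddCommGroup E] [Module (RobbaRing p) E] (B : PhiGammaAction p E)
    (j : E →ₗ[RobbaRing p] D) (hj : Function.Injective j)
    (hrange : ∀ x, x ∈ LinearMap.range j ↔ ∃ y, x = tElt p • y)
    (hφ : ∀ x, j (B.phi x) = A.phi (j x)) : B.IsTorsion := by
  have := hA.isGeneralized.finitePresentation
  have hfg := fg_relations he
  have hcoord : ∀ y : D, ∃ c : Fin n → RobbaRing p, ∑ i, c i • e i = y := fun y =>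
    (Submodule.mem_span_range_iff_exists_fun _).1 (he.symm ▸ Submodule.mem_top)
  have hphit : ∀ x, A.phi (tElt p • x) = ((p : RobbaRing p) * tElt p) • A.phi x := fun x => by
    rw [LinearMap.map_smulₛₗ, frob_tElt]
  choose e' he' using fun i => (hrange (tElt p • e i)).2 ⟨e i, rfl⟩
  have hspan : Submodule.span (RobbaRing p) (Set.range e') = ⊤ := by
    rw [eq_top_iff]
    intro x _
    obtain ⟨y, hy⟩ := (hrange (j x)).1 ⟨x, rfl⟩
    obtain ⟨c, rfl⟩ := hcoord y
    refine (Submodule.mem_span_range_iff_exists_fun _).2 ⟨c, hj ?_⟩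
    rw [hy, map_sum, Finset.smul_sum]
    refine Finset.sum_congr rfl fun i _ => ?_
    rw [map_smul, he', smul_comm]
  have hmem : ∀ v : Fin n → RobbaRing p, v ∈ relations e' ↔ tElt p • v ∈ relations e := by
    intro v
    rw [mem_relations, mem_relations, ← hj.eq_iff, map_zero, map_sum]
    simp only [map_smul, he', Pi.smul_apply, smul_eq_mul, mul_smul]
    simp only [smul_comm _ (tElt p)]
  -- The relations among the e are exactly `t` times the relations among the e', so the presentation
  -- of the submodule is that of D divided by `t`.
  have hdiv : ∀ v ∈ relations (R := RobbaRing p) e, ∃ u ∈ relations (R := RobbaRing p) e',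
      v = tElt p • u := by
    intro v hv
    choose u hu using hrel v hv
    have h1 : v = tElt p • u := funext hu
    exact ⟨u, (hmem u).2 (h1 ▸ hv), h1⟩
  refine B.isTorsion_of_generators hspan ?_ ?_ ?_ ?_
  · have hinj : Function.Injective
        (LinearMap.lsmul (RobbaRing p) (Fin n → RobbaRing p) (tElt p)) := fun v w h =>
      funext fun i => tElt_mul_cancel (congrFun h i)
    refine Submodule.fg_of_fg_map_injective _ hinj ?_
    convert hfg using 1
    ext v
    constructor
    · rintro ⟨u, hu, rfl⟩
      exact (hmem u).1 hu
    · intro hv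
      obtain ⟨u, hu, rfl⟩ := hdiv v hv
      exact ⟨u, hu, rfl⟩
  · rw [eq_top_iff]
    intro x _
    obtain ⟨y, hy⟩ := (hrange (j x)).1 ⟨x, rfl⟩
    have hyspan := A.surjective_linearization_iff.1 hA.isGeneralized.bijective_linearization.2
    have hy' : y ∈ Submodule.span (RobbaRing p) (Set.range A.phi) := hyspan.symm ▸ Submodule.mem_top
    have key : ∃ x' ∈ Submodule.span (RobbaRing p) (Set.range B.phi),
        j x' = tElt p • y := by
      clear hy
      induction hy' using Submodule.span_induction with
      | mem y hy =>
        obtain ⟨y, rfl⟩ := hy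
        obtain ⟨x', hx'⟩ := (hrange (tElt p • y)).2 ⟨y, rfl⟩
        -- Since φ(t y) = p t φ(y), the constant p must be inverted to reach t φ(y).
        obtain ⟨c, hc⟩ := isUnit_p (p := p).exists_right_inv
        refine ⟨c • B.phi x', Submodule.smul_mem _ _ (Submodule.subset_span ⟨x', rfl⟩), ?_⟩
        rw [map_smul, hφ, hx', hphit, smul_smul, ← mul_assoc, mul_comm c, hc, one_mul]
      | zero => exact ⟨0, zero_mem _, by rw [map_zero, smul_zero]⟩
      | add y y' _ _ h h' =>
        obtain ⟨u, hu, hu'⟩ := h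
        obtain ⟨v, hv, hv'⟩ := h'
        exact ⟨u + v, add_mem hu hv, by rw [map_add, hu', hv', smul_add]⟩
      | smul r y _ h =>
        obtain ⟨u, hu, hu'⟩ := h
        exact ⟨r • u, Submodule.smul_mem _ _ hu, by rw [map_smul, hu', smul_comm]⟩
    obtain ⟨x', hx', h⟩ := key
    rwa [hj (hy.trans h.symm)]
  · intro f hf
    -- Injectivity for D applies to `t` times the given combination; the resulting Frobenius
    -- relation is divided by `t`, using that `t` is regular and φ(t) = p t.
    have h1 : ∑ i, (tElt p * f i) • A.phi (e i) = 0 := by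
      have h2 := congrArg j hf
      rw [map_sum, map_zero] at h2
      simp only [map_smul, hφ, he', hphit] at h2
      have h3 : (p : RobbaRing p) • ∑ i, (tElt p * f i) • A.phi (e i) = 0 := by
        rw [← h2, Finset.smul_sum]
        refine Finset.sum_congr rfl fun i _ => ?_
        rw [smul_smul, smul_smul]
        congr 1
        ring
      exact (isUnit_p.smul_eq_zero).1 h3
    obtain ⟨l, v, y, hv, hvf⟩ := (A.injective_linearization_iff he).1
      hA.isGeneralized.bijective_linearization.1 _ h1
    choose u hu hvu using fun s => hdiv (v s) (hv s)
    refine ⟨l, u, fun s => (p : RobbaRing p) * y s, hu, fun i => tElt_mul_cancel ?_⟩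
    refine (hvf i).trans ?_
    rw [Finset.mul_sum]
    refine Finset.sum_congr rfl fun s _ => ?_
    rw [hvu, Pi.smul_apply, smul_eq_mul, map_mul, frob_tElt]
    ring
  · intro x
    obtain ⟨r, hr⟩ := hA.isTorsion (x := j x)
    refine ⟨r, hj ?_⟩
    rw [map_zero]
    exact (map_smul j (r : RobbaRing p) x).trans hr

/-- The quotient of a torsion `(φ, Γ)`-module by `t` is pure if the module has generators that are
independent modulo `t`. -/
theorem PhiGammaAction.IsTorsion.isPureTorsion_of_surjective {A : PhiGammaAction p D}
    (hA : A.IsTorsion) {n : ℕ} {e : Fin n → D}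
    (he : Submodule.span (RobbaRing p) (Set.range e) = ⊤)
    (hind : ∀ (b : Fin n → RobbaRing p) (y : D), ∑ i, b i • e i = tElt p • y → ∀ i, tElt p ∣ b i)
    {E : Type*} [AddCommGroup E] [Module (RobbaRing p) E] (B : PhiGammaAction p E)
    (q : D →ₗ[RobbaRing p] E) (hq : Function.Surjective q)
    (hker : ∀ x, q x = 0 ↔ ∃ y, x = tElt p • y)
    (hφ : ∀ x, q (A.phi x) = B.phi (q x)) : B.IsPureTorsion 1 := by
  have hspanφ := A.surjective_linearization_iff.1 hA.isGeneralized.bijective_linearization.2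
  have hrel : ∀ v ∈ relations (R := RobbaRing p) e, ∀ i, tElt p ∣ v i := fun v hv =>
    hind v 0 (by rw [smul_zero]; exact hv)
  have hspan : Submodule.span (RobbaRing p) (Set.range fun i => q (e i)) = ⊤ := by
    rw [show (fun i => q (e i)) = q ∘ e from rfl, Set.range_comp, ← Submodule.map_span, he,
      Submodule.map_top, LinearMap.range_eq_top.2 hq]
  have hmem : ∀ v : Fin n → RobbaRing p, v ∈ relations (fun i => q (e i)) ↔
      ∀ i, tElt p ∣ v i := by
    intro v
    have h1 : ∑ i, v i • q (e i) = q (∑ i, v i • e i) := by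
      rw [map_sum]
      simp only [map_smul]
    rw [mem_relations, h1, hker]
    constructor
    · rintro ⟨y, hy⟩
      exact hind v y hy
    · intro h
      choose u hu using h
      refine ⟨∑ i, u i • e i, ?_⟩
      rw [Finset.smul_sum]
      refine Finset.sum_congr rfl fun i _ => ?_
      rw [smul_smul, ← hu]
  have htE : ∀ x : E, tElt p • x = 0 := by
    intro x
    obtain ⟨y, rfl⟩ := hq x
    rw [← map_smul]
    exact (hker _).2 ⟨y, rfl⟩
  have hB : B.IsTorsion := by
    refine B.isTorsion_of_generators hspan ?_ ?_ ?_ ?_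
    · have h1 : relations (R := RobbaRing p) (fun i => q (e i)) =
          (⊤ : Submodule (RobbaRing p) (Fin n → RobbaRing p)).map
            (LinearMap.lsmul (RobbaRing p) (Fin n → RobbaRing p) (tElt p)) := by
        ext v
        rw [hmem]
        constructor
        · intro h
          choose u hu using h
          exact ⟨u, trivial, (funext hu).symm⟩
        · rintro ⟨u, -, rfl⟩ i
          exact ⟨u i, rfl⟩
      rw [h1]
      exact Module.Finite.fg_top.map _
    · refine Submodule.eq_top_iff'.2 fun x => ?_
      obtain ⟨y, rfl⟩ := hq x
      have hy : y ∈ Submodule.span (RobbaRing p) (Set.range A.phi) :=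
        hspanφ.symm ▸ Submodule.mem_top
      induction hy using Submodule.span_induction with
      | mem y hy =>
        obtain ⟨y, rfl⟩ := hy
        rw [hφ]
        exact Submodule.subset_span ⟨q y, rfl⟩
      | zero => rw [map_zero]; exact zero_mem _
      | add y y' _ _ h h' => rw [map_add]; exact add_mem h h'
      | smul r y _ h => rw [map_smul]; exact Submodule.smul_mem _ _ h
    · intro f hf
      have h1 : q (∑ i, f i • A.phi (e i)) = 0 := by
        rw [map_sum, ← hf]
        simp only [map_smul, hφ]
      obtain ⟨y, hy⟩ := (hker _).1 h1
      -- Surjectivity of the linearization expresses y through the φ(e_i); subtracting t g then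
      -- reduces to an honest relation in D.
      have hy' : ∃ g : Fin n → RobbaRing p, y = ∑ i, g i • A.phi (e i) := by
        obtain ⟨z, rfl⟩ := hA.isGeneralized.bijective_linearization.2 y
        obtain ⟨g, rfl⟩ := exists_eq_sum_tmul he z
        exact ⟨g, A.linearization_sum e g⟩
      obtain ⟨g, rfl⟩ := hy'
      have h2 : ∑ i, (f i - tElt p * g i) • A.phi (e i) = 0 := by
        simp only [sub_smul, Finset.sum_sub_distrib, hy, mul_smul, ← Finset.smul_sum, sub_self]
      obtain ⟨l, v, w, hv, hvf⟩ := (A.injective_linearization_iff he).1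
        hA.isGeneralized.bijective_linearization.1 _ h2
      have h3 : ∀ i, tElt p ∣ f i := by
        intro i
        refine (dvd_sub_left (Dvd.intro (g i) rfl : tElt p ∣ tElt p * g i)).1 ?_
        have h4 : f i - tElt p * g i = ∑ s, frob p (v s i) * w s := hvf i
        rw [h4]
        refine Finset.dvd_sum fun s _ => Dvd.dvd.mul_right ?_ _
        obtain ⟨c, hc⟩ := hrel (v s) (hv s) i
        rw [hc, map_mul, frob_tElt, mul_assoc]
        exact Dvd.dvd.mul_left (Dvd.intro _ rfl) _
      choose c hc using h3
      -- Here t c_i = φ(t) p⁻¹ c_i, so the standard basis vectors multiplied by `t`, which are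
      -- relations in E, witness the Frobenius relation.
      obtain ⟨π, hπ⟩ := (isUnit_p (p := p)).exists_right_inv
      refine ⟨n, fun s => Pi.single s (tElt p), fun s => π * c s, fun s => ?_, fun i => ?_⟩
      · refine (hmem _).2 fun i => ?_
        change tElt p ∣ (Pi.single s (tElt p) : Fin n → RobbaRing p) i
        rcases eq_or_ne i s with rfl | hi
        · rw [Pi.single_eq_same]
        · rw [Pi.single_eq_of_ne hi]
          exact dvd_zero _
      · change f i = ∑ s, frob p ((Pi.single s (tElt p) : Fin n → RobbaRing p) i) * (π * c s)
        rw [Finset.sum_eq_single i]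
        · rw [Pi.single_eq_same, frob_tElt, hc]
          linear_combination (- tElt p * c i) * hπ
        · intro s _ hs
          rw [Pi.single_eq_of_ne hs.symm, map_zero, zero_mul]
        · simp
    · exact fun x => ⟨⟨tElt p, tElt_mem_nonZeroDivisors⟩, htE x⟩
  have hby : Module.IsTorsionBy (RobbaRing p) E (tElt p ^ 1) := fun x => by
    rw [pow_one]
    exact htE x
  refine ⟨hB, hby, ?_⟩
  let _ : Module (RobbaRing p ⧸ Ideal.span {tElt p ^ 1}) E := hby.module
  have hsmul : ∀ (r : RobbaRing p) (x : E),
      (Ideal.Quotient.mk (Ideal.span {tElt p ^ 1}) r) • x = r • x := fun _ _ => rfl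
  refine Module.Free.of_basis (ι := Fin n) (Module.Basis.mk (v := fun i => q (e i)) ?_ ?_)
  · rw [Fintype.linearIndependent_iff]
    intro g hg i
    choose b hb using fun i => Ideal.Quotient.mk_surjective (g i)
    have h1 : b ∈ relations (fun i => q (e i)) := by
      rw [mem_relations, ← hg]
      exact Finset.sum_congr rfl fun i _ => by rw [← hb, hsmul]
    rw [← hb, Ideal.Quotient.eq_zero_iff_mem, Ideal.mem_span_singleton, pow_one]
    exact (hmem b).1 h1 i
  · intro x _
    obtain ⟨c, rfl⟩ := (Submodule.mem_span_range_iff_exists_fun (RobbaRing p)).1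
      (hspan.symm ▸ Submodule.mem_top : x ∈ Submodule.span (RobbaRing p) _)
    refine Submodule.sum_mem _ fun i _ => ?_
    rw [← hsmul]
    exact Submodule.smul_mem _ _ (Submodule.subset_span ⟨i, rfl⟩)

theorem PhiGammaAction.IsTorsion.of_equiv {A : PhiGammaAction p D} (hA : A.IsTorsion)
    {E : Type*} [AddCommGroup E] [Module (RobbaRing p) E] (B : PhiGammaAction p E)
    (j : E ≃ₗ[RobbaRing p] D) (hφ : ∀ x, j (B.phi x) = A.phi (j x)) : B.IsTorsion := by
  have := hA.isGeneralized.finitePresentation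
  obtain ⟨n, e, he, hfg⟩ := exists_presentation (R := RobbaRing p) (M := D)
  have hrel : relations (R := RobbaRing p) (fun i => j.symm (e i)) = relations e := by
    ext v
    rw [mem_relations, mem_relations, ← j.symm.map_eq_zero_iff, map_sum]
    simp only [map_smul]
  have hφ' : ∀ y, B.phi (j.symm y) = j.symm (A.phi y) := fun y => j.injective <| by
    rw [hφ, j.apply_symm_apply, j.apply_symm_apply]
  refine B.isTorsion_of_generators (e := fun i => j.symm (e i)) ?_ (hrel ▸ hfg) ?_ ?_ ?_
  · have h1 := congrArg (Submodule.map (j.symm : D →ₗ[RobbaRing p] E)) he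
    rwa [Submodule.map_span, Submodule.map_top, LinearMap.range_eq_top.2 j.symm.surjective,
      ← Set.range_comp] at h1
  · have h1 := A.surjective_linearization_iff.1 hA.isGeneralized.bijective_linearization.2
    have h2 := congrArg (Submodule.map (j.symm : D →ₗ[RobbaRing p] E)) h1
    rw [Submodule.map_span, Submodule.map_top, LinearMap.range_eq_top.2 j.symm.surjective] at h2
    rw [eq_top_iff, ← h2]
    refine Submodule.span_mono ?_
    rintro _ ⟨_, ⟨y, rfl⟩, rfl⟩
    exact ⟨j.symm y, hφ' y⟩
  · intro f hf
    rw [hrel]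
    refine (A.injective_linearization_iff he).1
      hA.isGeneralized.bijective_linearization.1 f (j.symm.injective ?_)
    rw [map_zero, ← hf, map_sum]
    simp only [map_smul, hφ']
  · intro x
    obtain ⟨r, hr⟩ := hA.isTorsion (x := j x)
    refine ⟨r, j.injective ?_⟩
    rw [map_zero]
    exact (map_smul j (r : RobbaRing p) x).trans hr

end Criteria

/-! ### The filtration by the powers of `t` -/

namespace PhiGammaAction

variable {D : Type*} [AddCommGroup D] [Module (RobbaRing p) D] (A : PhiGammaAction p D)

variable (D) in
/-- The submodule `t ^ j D`. -/
def tPow (j : ℕ) : Submodule (RobbaRing p) D :=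
  LinearMap.range (LinearMap.lsmul (RobbaRing p) D (tElt p ^ j))

theorem isStable_tPow (j : ℕ) : A.IsStable (tPow D j) where
  phi_mem := by
    rintro _ ⟨y, rfl⟩
    refine ⟨((p : RobbaRing p) ^ j) • A.phi y, ?_⟩
    rw [LinearMap.lsmul_apply, LinearMap.lsmul_apply, LinearMap.map_smulₛₗ, map_pow, frob_tElt,
      mul_pow, smul_smul, mul_comm]
  gamma_mem := by
    rintro u _ ⟨y, rfl⟩
    refine ⟨(constR ((u : ℤ_[p]) : ℚ_[p]) ^ j) • A.gamma u y, ?_⟩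
    rw [LinearMap.lsmul_apply, LinearMap.lsmul_apply, LinearMap.map_smulₛₗ, map_pow, gammaHom_tElt,
      mul_pow, smul_smul, mul_comm]

theorem tPow_antitone : Antitone (tPow (p := p) D) := by
  refine antitone_nat_of_succ_le fun j => ?_
  rintro _ ⟨y, rfl⟩
  refine ⟨tElt p • y, ?_⟩
  rw [LinearMap.lsmul_apply, LinearMap.lsmul_apply, smul_smul, pow_succ]

theorem tPow_zero : tPow (p := p) D 0 = ⊤ :=
  Submodule.eq_top_iff'.2 fun x => ⟨x, by rw [LinearMap.lsmul_apply, pow_zero, one_smul]⟩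

theorem mem_tPow_succ_iff {j : ℕ} {x : D} :
    x ∈ tPow (p := p) D (j + 1) ↔ ∃ y : tPow (p := p) D j, x = tElt p • (y : D) := by
  constructor
  · rintro ⟨y, rfl⟩
    refine ⟨⟨tElt p ^ j • y, y, rfl⟩, ?_⟩
    rw [LinearMap.lsmul_apply, pow_succ', mul_smul]
  · rintro ⟨⟨_, y, rfl⟩, rfl⟩
    refine ⟨y, ?_⟩
    rw [LinearMap.lsmul_apply, pow_succ', mul_smul]
    rfl

/-- The submodules `t ^ j D` of a torsion `(φ, Γ)`-module are torsion `(φ, Γ)`-modules. -/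
theorem isTorsion_sub_tPow (hA : A.IsTorsion) (j : ℕ) :
    (A.sub (tPow D j) (A.isStable_tPow j)).IsTorsion := by
  induction j with
  | zero =>
    exact hA.of_equiv _ (LinearEquiv.ofTop _ tPow_zero) fun x => rfl
  | succ j ih =>
    have := ih.isGeneralized.finitePresentation
    obtain ⟨k, hk⟩ := exists_tElt_pow_smul_eq_zero _ ih
    -- Generators independent modulo `t` have relations divisible by `t`, as the case y = 0 shows;
    -- this is what lets the structure descend from t^j D to t^(j+1) D.
    obtain ⟨d, m, hm, hind⟩ := exists_generators_independent_mod
      (A.sub (tPow D j) (A.isStable_tPow j)).phi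
      ((surjective_linearization_iff _).1 ih.isGeneralized.bijective_linearization.2) hk
    refine ih.of_injective hm (fun v hv => hind v 0 ?_) _
      (Submodule.inclusion (tPow_antitone j.le_succ)) (Submodule.inclusion_injective _)
      (fun x => ?_) fun x => rfl
    · rw [smul_zero]
      exact hv
    · rw [Submodule.range_inclusion, Submodule.mem_comap, Submodule.subtype_apply,
        mem_tPow_succ_iff]
      exact exists_congr fun y => by rw [Subtype.ext_iff]; rfl

/-- The graded pieces of the filtration by the powers of `t` are pure. -/
theorem isPureTorsion_quot_tPow (hA : A.IsTorsion) {i j : ℕ} (hi : i = j + 1) :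
    ((A.sub (tPow D j) (A.isStable_tPow j)).quot ((tPow D i).submoduleOf (tPow D j))
      ((A.isStable_tPow i).submoduleOf (A.isStable_tPow j))).IsPureTorsion 1 := by
  subst hi
  have ih := A.isTorsion_sub_tPow hA j
  have := ih.isGeneralized.finitePresentation
  obtain ⟨k, hk⟩ := exists_tElt_pow_smul_eq_zero _ ih
  obtain ⟨d, m, hm, hind⟩ := exists_generators_independent_mod
    (A.sub (tPow D j) (A.isStable_tPow j)).phi
    ((surjective_linearization_iff _).1 ih.isGeneralized.bijective_linearization.2) hk
  refine ih.isPureTorsion_of_surjective hm hind _ (Submodule.mkQ _) (Submodule.mkQ_surjective _)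
    (fun x => ?_) fun x => rfl
  rw [Submodule.mkQ_apply, Submodule.Quotient.mk_eq_zero, Submodule.submoduleOf,
    Submodule.mem_comap, Submodule.subtype_apply, mem_tPow_succ_iff]
  exact exists_congr fun y => by rw [Subtype.ext_iff]; rfl

/-- Torsion `(φ, Γ)`-modules are successive extensions of pure `t`-torsion `(φ, Γ)`-modules. -/
theorem isSuccessiveExtension (hA : A.IsTorsion) : A.IsSuccessiveExtension := by
  obtain ⟨k, hk⟩ := A.exists_tElt_pow_smul_eq_zero hA
  -- The t-adic filtration read backwards; truncated subtraction makes it constantly D from index k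
  -- on.
  refine ⟨k, fun i => tPow D (k - i), fun i => A.isStable_tPow (k - i), ?_, ?_, ?_,
    fun i => A.isTorsion_sub_tPow hA (k - i), fun i hi => ?_⟩
  · rw [eq_bot_iff]
    rintro _ ⟨y, rfl⟩
    exact hk y
  · change tPow D (k - k) = ⊤
    rw [Nat.sub_self, tPow_zero]
  · exact fun i i' h => tPow_antitone (Nat.sub_le_sub_left h k)
  · exact A.isPureTorsion_quot_tPow hA (by omega)

end PhiGammaAction

end Robba

end

theorem proposition3p1 (p : ℕ) [Fact p.Prime] :
    (∀ I : Ideal (Robba.RobbaRing p), I.IsPrincipal → I ≠ ⊥ →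
      (∀ f ∈ I, Robba.frob p f ∈ I) → (∀ u : ℤ_[p]ˣ, ∀ f ∈ I, Robba.gammaHom u f ∈ I) →
      ∃ k : ℕ, I = Ideal.span {Robba.tElt p ^ k}) ∧
    (∀ (S : Type*) [AddCommGroup S] [Module (Robba.RobbaRing p) S]
      (A : Robba.PhiGammaAction p S), A.IsTorsion → A.IsSuccessiveExtension) := by
  refine ⟨fun I hI hI0 hφ hγ => ?_, fun S _ _ A hA => A.isSuccessiveExtension hA⟩
  -- Of principality only finite generation is used.
  exact Robba.exists_eq_span_tElt_pow ((Submodule.isPrincipal_iff I).1 hI |>.elim fun a ha =>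
    ha ▸ Submodule.fg_span_singleton a) hI0 hφ hγ
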